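/- Let $d\ge 1$ and $0<\lambda<\Lambda$. There is a constant $C>0$ depending only on $d,\lambda,\Lambda$ with the following property. Let $\mathcal U\subset\mathbb R\times\mathbb R^d\times\mathbb R^d$ be open, with points $z=(t,x,v)$. Let $A$ be a measurable field of real symmetric $d\times d$ matrices on $\mathcal U$ with eigenvalues in $[\lambda,\Lambda]$, $B$ a measurable vector field on $\mathcal U$ with $|B|\le\Lambda$, and $S\in L^\infty(\mathcal U)$ real-valued. Let $f\ge 0$ be a weak sub-solution in $\mathcal U$ of $$\partial_t f+v\cdot\nabla_x f=\nabla_v\cdot(A\nabla_v f)+B\cdot\nabla_v f+S ,$$ that is, $f\in L^2(\mathcal U)$, its weak velocity gradient satisfies $\nabla_v f\in L^2(\mathcal U)$, $\operatorname{ess\,sup}_t\int_{\{(x,v):(t,x,v)\in\mathcal U\}}f(t,x,v)^2\,dx\,dv<\infty$, and for all $\beta\in C^2(\mathbb R)$ with $\beta'\ge0$, $\beta''\ge0$ both bounded and all $0\le\varphi\in C_c^\infty(\mathcal U)$, $$-\int_{\mathcal U}\beta(f)\,(\partial_t+v\cdot\nabla_x)\varphi\,dz\le-\int_{\mathcal U}A\nabla_v\beta(f)\cdot\nabla_v\varphi\,dz+\int_{\mathcal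 U}\big[B\cdot\nabla_v\beta(f)+S\beta'(f)\big]\varphi\,dz .$$ For $z_0=(t_0,x_0,v_0)$ and $\rho>0$ let $$Q_\rho(z_0)=\{(t,x,v): -\rho^2<t-t_0\le0,\ |x-x_0-(t-t_0)v_0|<\rho^3,\ |v-v_0|<\rho\}.$$ If $0<r<R\le1$ and $Q_R(z_0)\subset\mathcal U$, then for all $p\in[2,2+\frac1d)$ and all $\sigma\in[0,\frac13)$, $$\|f\|_{L^p(Q_r(z_0))}\le C\Big(2+\frac1d-p\Big)^{-1}\mathcal C'(r,R,v_0)\big[\|f\|_{L^2(Q_R(z_0))}+\|S\|_{L^2(Q_R(z_0))}\big],$$ $$\|f\|_{L^1_{t,v}W^{\sigma,1}_x(Q_r(z_0))}\le C\Big(\frac13-\sigma\Big)^{-1}\mathcal C''(r,R,v_0)\big[\|f\|_{L^2(Q_R(z_0))}+\|S\|_{L^2(Q_R(z_0))}\big],$$ where $$\mathcal C(r,R,v_0)=1+\frac1{(R-r)^2}+\frac{|v_0|+R}{(R-r)r^2}+\frac1{(R-r)r},$$ $$\mathcal C'(r,R,v_0)=\Big(1+\frac1{R-r}\Big)\mathcal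 C(r,R,v_0),\qquad \mathcal C''(r,R,v_0)=R^{1+2d}\Big(1+\frac1{R-r}\Big)\mathcal C(r,R,v_0).$$ Here $\|f\|_{L^1_{t,v}W^{\sigma,1}_x(Q)}$ is the integral over $(t,v)$ of the $W^{\sigma,1}$ norm of $x\mapsto f(t,x,v)$ on the slice $\Omega_{t,v}=\{x:(t,x,v)\in Q\}$, where $\|h\|_{W^{\sigma,1}(\Omega)}=\int_\Omega|h|+\iint_{\Omega\times\Omega}\frac{|h(x)-h(y)|}{|x-y|^{d+\sigma}}\,dx\,dy$ for $0<\sigma<1$ and $W^{0,1}=L^1$. -/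

import Mathlib

open MeasureTheory Set

open scoped ENNReal

noncomputable section

namespace KineticFP

/-- Physical (position or velocity) space `ℝ^d` with its Euclidean norm. -/
abbrev E (d : ℕ) : Type := EuclideanSpace ℝ (Fin d)

/-- Phase space-time `ℝ^{1+2d}`; points are `z = (t, x, v)`, with the Lebesgue measure. -/
abbrev Z (d : ℕ) : Type := ℝ × E d × E d

variable {d : ℕ}

/-- The kinetic cylinder `Q_r(z₀)`. -/
def cylinder (r : ℝ) (z₀ : Z d) : Set (Z d) :=
  {z | -r ^ 2 < z.1 - z₀.1 ∧ z.1 - z₀.1 ≤ 0 ∧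
    ‖z.2.1 - z₀.2.1 - (z.1 - z₀.1) • z₀.2.2‖ < r ^ 3 ∧ ‖z.2.2 - z₀.2.2‖ < r}

/-- The free transport derivative `𝒯 φ = ∂_t φ + v · ∇_x φ` of a smooth function. -/
def transport (φ : Z d → ℝ) (z : Z d) : ℝ :=
  fderiv ℝ φ z (1, z.2.2, 0)

/-- The velocity gradient `∇_v φ` of a smooth function. -/
def gradV (φ : Z d → ℝ) (z : Z d) : E d :=
  gradient (fun w : E d => φ (z.1, z.2.1, w)) z.2.2

/-- Test functions `C_c^∞(U)`. -/
structure IsTest (U : Set (Z d)) (φ : Z d → ℝ) : Prop where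
  smooth : ContDiff ℝ ((⊤ : ℕ∞) : WithTop ℕ∞) φ
  compact : HasCompactSupport φ
  support : tsupport φ ⊆ U

/-- `g` is the velocity gradient of `f` in the sense of distributions in `U`. -/
structure IsWeakGradV (U : Set (Z d)) (f : Z d → ℝ) (g : Z d → E d) : Prop where
  locInt : LocallyIntegrableOn f U
  locInt_grad : LocallyIntegrableOn g U
  parts : ∀ φ, IsTest U φ → ∫ z in U, f z • gradV φ z = -∫ z in U, φ z • g z

/-- Hypotheses on the coefficients in `U`: `A` is a measurable field of real symmetric matrices with
eigenvalues in `[lam, Lam]`, `B` is a measurable vector field with `|B| ≤ Lam`, `S ∈ L^∞`. -/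
structure Coefficients (U : Set (Z d)) (lam Lam : ℝ)
    (A : Z d → Matrix (Fin d) (Fin d) ℝ) (B : Z d → E d) (S : Z d → ℝ) : Prop where
  measurable_A : ∀ i j, AEMeasurable (fun z => A z i j) (volume.restrict U)
  symm_A : ∀ᵐ z ∂volume.restrict U, (A z).IsSymm
  eigenvalues_A : ∀ᵐ z ∂volume.restrict U, spectrum ℝ (A z) ⊆ Icc lam Lam
  measurable_B : AEMeasurable B (volume.restrict U)
  bound_B : ∀ᵐ z ∂volume.restrict U, ‖B z‖ ≤ Lam
  bounded_S : MemLp S ∞ (volume.restrict U)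

/-- The energy space `L^∞_t L²_{x,v} ∩ L²_{t,x} H¹_v` over `U`: the `L²` norms of the time slices
are essentially bounded, and `f` and its weak velocity gradient are in `L²(U)`. -/
def EnergySpace (U : Set (Z d)) (f : Z d → ℝ) : Prop :=
  MemLp f 2 (volume.restrict U) ∧
  (∃ M : NNReal, ∀ᵐ t : ℝ, ∫⁻ p in {p : E d × E d | (t, p) ∈ U}, ‖f (t, p)‖ₑ ^ 2 ≤ M) ∧
  ∃ g, IsWeakGradV U f g ∧ MemLp g 2 (volume.restrict U)

/-- The admissible renormalizations `β`: `C²`, with `β' ≥ 0` and `β'' ≥ 0` both bounded. -/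
structure Renormalization (β : ℝ → ℝ) : Prop where
  smooth : ContDiff ℝ 2 β
  deriv_nonneg : ∀ s, 0 ≤ deriv β s
  deriv2_nonneg : ∀ s, 0 ≤ deriv (deriv β) s
  bounded : ∃ M, ∀ s, deriv β s ≤ M ∧ deriv (deriv β) s ≤ M

/-- Weak sub-solutions in `U` of
`∂_t f + v · ∇_x f = ∇_v · (A ∇_v f) + B · ∇_v f + S`.
The field `G` is `∇_v β(f)`; it exists (and equals `β'(f) ∇_v f`) by the chain rule for weak
derivatives, and is unique up to a null set of `U`. -/
structure IsWeakSubsolution (U : Set (Z d)) (A : Z d → Matrix (Fin d) (Fin d) ℝ)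
    (B : Z d → E d) (S : Z d → ℝ) (f : Z d → ℝ) : Prop where
  energy : EnergySpace U f
  ineq : ∀ β, Renormalization β → ∀ G, IsWeakGradV U (fun z => β (f z)) G →
    ∀ φ, IsTest U φ → (∀ z, 0 ≤ φ z) →
      -∫ z in U, β (f z) * transport φ z ≤
        -(∫ z in U, inner ℝ (Matrix.toEuclideanLin (A z) (G z)) (gradV φ z)) +
          ∫ z in U, (inner ℝ (B z) (G z) + S z * deriv β (f z)) * φ z

/-- The norm of `W^{σ,1}(Ω)`, `0 ≤ σ < 1`: the `L¹` norm plus, for `σ ≠ 0`, the Gagliardo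
semi-norm. By convention `W^{0,1} = L¹`. -/
def sobolevNorm (σ : ℝ) (Ω : Set (E d)) (h : E d → ℝ) : ℝ≥0∞ :=
  (∫⁻ x in Ω, ‖h x‖ₑ) +
    if σ = 0 then 0
    else ∫⁻ x in Ω, ∫⁻ y in Ω, ‖h x - h y‖ₑ / ‖x - y‖ₑ ^ ((d : ℝ) + σ)

/-- The norm of `L¹_{t,v} W^{σ,1}_x (Q)`: the integral over `(t,v)` of the `W^{σ,1}` norm in `x` on
the slice `{x | (t,x,v) ∈ Q}`. -/
def kineticSobolevNorm (σ : ℝ) (Q : Set (Z d)) (f : Z d → ℝ) : ℝ≥0∞ :=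
  ∫⁻ p : ℝ × E d, sobolevNorm σ {x : E d | (p.1, x, p.2) ∈ Q} (fun x => f (p.1, x, p.2))

/-- `𝒞(r,R,v₀) = 1 + (R-r)⁻² + (|v₀|+R)/((R-r)r²) + 1/((R-r)r)`. -/
def C0 (r R : ℝ) (v₀ : E d) : ℝ :=
  1 + 1 / (R - r) ^ 2 + (‖v₀‖ + R) / ((R - r) * r ^ 2) + 1 / ((R - r) * r)

/-- `𝒞'(r,R,v₀) = (1 + 1/(R-r)) 𝒞(r,R,v₀)`. -/
def C1 (r R : ℝ) (v₀ : E d) : ℝ :=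
  (1 + 1 / (R - r)) * C0 r R v₀

/-- `𝒞''(r,R,v₀) = R^{1+2d} (1 + 1/(R-r)) 𝒞(r,R,v₀)`. -/
def C2 (r R : ℝ) (v₀ : E d) : ℝ :=
  R ^ (1 + 2 * d) * (1 + 1 / (R - r)) * C0 r R v₀

end KineticFP

end

noncomputable section

namespace KineticFP

variable {d : ℕ}

open Filter Topology

/-! ### Integration by parts for compactly supported functions. -/

section Calculus

variable {X : Type*} [NormedAddCommGroup X] [NormedSpace ℝ X] [FiniteDimensional ℝ X]
  [MeasurableSpace X] [BorelSpace X]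

/-! Write 𝒯 = ∂_t + v·∇_x. A smooth g vanishing one unit of time earlier is recovered by integrating
its derivative along the paths τ ↦ `path z (τ, p, y)`, which leave z backwards in time with the
kinetic scaling τ², τ³, τ in (t, x, v). The derivative of g along such a path consists of -2τ 𝒯g, a
velocity derivative, and -2τ² y·∇_x g, the only term that the equation does not control. Up to
velocity derivatives, this term is -2/τ times the derivative of (p, y) ↦ g(path) along the rotation
field (y, -p). Averaging against a density W invariant under these rotations removes it
(`IsKernel.integral_rot_eq`). The result is `representation`: g(z) is the integral over (τ, p, y) of
F, ∇_v g and 𝒯g - ∇_v·F at the path points, against bounded kernels. The last kernel, 2τW, is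
nonnegative, so the one-sided inequality 𝒯g ≤ ∇_v·F + H already bounds g from above.

Integrability: if H also dominates F and ∇_v g, then g is at most a constant times the average of H
along paths. The map from (τ, p, y) to the path point has Jacobian 2τ^(4d+1), so Young's inequality
from L² to L^p asks that τ^(-a) be integrable near 0 with a = (4d+1)(p-2)/(p+2). This means p < 2 +
1/d, and 1/(1-a) is the source of the factor (2 + 1/d - p)⁻¹ (`exists_pathAvg_bound`).

Regularity: a translation of x by k is undone by moving (p, y) by a vector of size |k|/τ³
(`path_shiftX`). The kernels then vary by O(min(1, |k|/τ³)), whose integral in τ is O(|k|^(1/3)).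
The defect 𝒯g - ∇_v·F is bounded only from above, but its integral vanishes, so its L¹ norm is at
most 2∫H (`SmoothSub.lintegral_total_le`). Integrating these L¹ increments against |k|^(-d-σ) gives
the Gagliardo semi-norm and the factor (1/3 - σ)⁻¹.

Weak sub-solutions: the inequality with β = id is mollified along the kinetic group, whose left
translations commute with 𝒯 and ∇_v, so that it becomes pointwise without commutators. After
multiplication by a cutoff the right-hand side is at most `locBound`. Its L² norm involves ∇_v f,
which the Caccioppoli inequality (`WeakSub.caccioppoli`) controls on a larger cylinder. The cutoffs
vanish near the final time, and the large derivative of that factor has a favourable sign because f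
≥ 0; hence the truncation can be removed in the limit. The total loss is (R-r)⁻², one of the
summands of 𝒞. -/

theorem _root_.HasCompactSupport.fderiv_apply' {X : Type*} [NormedAddCommGroup X] [NormedSpace ℝ X]
    {ψ : X → ℝ} (hψ : HasCompactSupport ψ) (c : X → X) :
    HasCompactSupport fun z => fderiv ℝ ψ z (c z) := by
  refine (hψ.fderiv (𝕜 := ℝ)).mono fun z hz => ?_
  contrapose! hz
  simp only [Function.mem_support, not_not] at hz ⊢
  simp [hz]

theorem integral_mul_fderiv_eq_zero (μ : Measure X) [μ.IsAddHaarMeasure] {c ψ : X → ℝ}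
    (hc : ContDiff ℝ 1 c) (hψ : ContDiff ℝ 1 ψ) (hs : HasCompactSupport ψ) {w : X}
    (hw : ∀ z, fderiv ℝ c z w = 0) : ∫ z, c z * fderiv ℝ ψ z w ∂μ = 0 := by
  rw [integral_mul_fderiv_eq_neg_fderiv_mul_of_integrable]
  · simp [hw]
  · simp [hw]
  · refine Continuous.integrable_of_hasCompactSupport
      (hc.continuous.mul ((hψ.continuous_fderiv one_ne_zero).clm_apply continuous_const)) ?_
    exact (hs.fderiv_apply' fun _ => w).mul_left
  · exact Continuous.integrable_of_hasCompactSupport (hc.continuous.mul hψ.continuous) hs.mul_left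
  · exact fun z _ => hc.differentiable one_ne_zero z
  · exact fun z _ => hψ.differentiable one_ne_zero z

theorem integral_fderiv_eq_zero (μ : Measure X) [μ.IsAddHaarMeasure] {ψ : X → ℝ}
    (hψ : ContDiff ℝ 1 ψ) (hs : HasCompactSupport ψ) (w : X) : ∫ z, fderiv ℝ ψ z w ∂μ = 0 := by
  simpa using integral_mul_fderiv_eq_zero μ (c := fun _ => 1) contDiff_const hψ hs (w := w)
    (by simp)

end Calculus

/-! ### The derivatives 𝒯 and ∇_v of smooth functions, and shears. -/

instance : (volume : Measure (E d × E d)).IsAddHaarMeasure :=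
  inferInstanceAs ((volume : Measure (E d)).prod volume).IsAddHaarMeasure

instance : (volume : Measure (Z d)).IsAddHaarMeasure :=
  Measure.prod.instIsAddHaarMeasure (volume : Measure ℝ) (volume : Measure (E d × E d))

/-- The `i`-th velocity direction. -/
def ev (i : Fin d) : Z d := (0, 0, EuclideanSpace.single i 1)

/-- The partial derivative `∂_{v_i} φ`. -/
def dV (i : Fin d) (φ : Z d → ℝ) (z : Z d) : ℝ := fderiv ℝ φ z (ev i)

theorem gradV_apply {φ : Z d → ℝ} {z : Z d} (hφ : DifferentiableAt ℝ φ z) (i : Fin d) :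
    gradV φ z i = dV i φ z := by
  have h1 : HasFDerivAt (fun w : E d => ((z.1, z.2.1, w) : Z d))
      ((0 : E d →L[ℝ] ℝ).prod ((0 : E d →L[ℝ] E d).prod (ContinuousLinearMap.id ℝ (E d)))) z.2.2 :=
    (hasFDerivAt_const _ _).prodMk ((hasFDerivAt_const _ _).prodMk (hasFDerivAt_id _))
  have h2 : HasFDerivAt (fun w : E d => φ (z.1, z.2.1, w)) _ z.2.2 :=
    HasFDerivAt.comp (g := φ) z.2.2 hφ.hasFDerivAt h1
  have h3 : gradV φ z i = inner ℝ (gradV φ z) (EuclideanSpace.single i 1) := by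
    rw [EuclideanSpace.inner_single_right]; simp
  rw [h3, gradV, inner_gradient_left, h2.fderiv]
  simp [dV, ev]

/-- Integration by parts needs fixed directions: each coefficient v_i is independent of the position
variable in which the derivative is taken, so 𝒯 is divergence free. -/
theorem transport_eq_sum (φ : Z d → ℝ) (z : Z d) :
    transport φ z = fderiv ℝ φ z (1, 0, 0) +
      ∑ i, z.2.2 i * fderiv ℝ φ z (0, EuclideanSpace.single i 1, 0) := by
  have h : ((1, z.2.2, 0) : Z d) = (1, 0, 0) +
      ∑ i, z.2.2 i • ((0, EuclideanSpace.single i 1, 0) : Z d) := by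
    have h0 : z.2.2 = ∑ i, z.2.2 i • (EuclideanSpace.single i 1 : E d) := by
      ext j
      simp [Pi.single_apply]
    ext j
    · simp [Prod.fst_sum]
    · conv_lhs => simp only []
      rw [h0]
      simp [Prod.snd_sum, Prod.fst_sum, Pi.single_apply]
    · simp [Prod.snd_sum]
  rw [transport, h, map_add, map_sum]
  simp_rw [map_smul, smul_eq_mul]

theorem integral_transport_eq_zero {ψ : Z d → ℝ} (hψ : ContDiff ℝ 1 ψ)
    (hs : HasCompactSupport ψ) : ∫ z, transport ψ z = 0 := by
  have hi : ∀ (c : Z d → ℝ), Continuous c → ∀ w : Z d,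
      Integrable fun z => c z * fderiv ℝ ψ z w := by
    intro c hc w
    refine Continuous.integrable_of_hasCompactSupport
      (hc.mul ((hψ.continuous_fderiv one_ne_zero).clm_apply continuous_const)) ?_
    exact (hs.fderiv_apply' fun _ => w).mul_left
  have hv : ∀ i : Fin d, ContDiff ℝ 1 fun z : Z d => z.2.2 i := fun i => by fun_prop
  simp_rw [transport_eq_sum]
  rw [integral_add, integral_finsetSum, integral_fderiv_eq_zero volume hψ hs, zero_add]
  · refine Finset.sum_eq_zero fun i _ =>
      integral_mul_fderiv_eq_zero volume (hv i) hψ hs fun z => ?_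
    let l : Z d →L[ℝ] ℝ := (EuclideanSpace.proj i).comp
      ((ContinuousLinearMap.snd ℝ (E d) (E d)).comp (ContinuousLinearMap.snd ℝ ℝ (E d × E d)))
    change fderiv ℝ l z _ = 0
    rw [l.fderiv]
    simp [l]
  · exact fun i _ => hi _ (hv i).continuous _
  · simpa using hi (fun _ => 1) continuous_const _
  · exact integrable_finsetSum _ fun i _ => hi _ (hv i).continuous _

theorem integral_dV_eq_zero {ψ : Z d → ℝ} (hψ : ContDiff ℝ 1 ψ) (hs : HasCompactSupport ψ)
    (i : Fin d) : ∫ z, dV i ψ z = 0 :=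
  integral_fderiv_eq_zero volume hψ hs _

theorem transport_mul {φ ψ : Z d → ℝ} {z : Z d} (hφ : DifferentiableAt ℝ φ z)
    (hψ : DifferentiableAt ℝ ψ z) :
    transport (fun z => φ z * ψ z) z = φ z * transport ψ z + ψ z * transport φ z := by
  simp [transport, fderiv_fun_mul hφ hψ]

theorem dV_mul {φ ψ : Z d → ℝ} {z : Z d} (hφ : DifferentiableAt ℝ φ z)
    (hψ : DifferentiableAt ℝ ψ z) (i : Fin d) :
    dV i (fun z => φ z * ψ z) z = φ z * dV i ψ z + ψ z * dV i φ z := by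
  simp [dV, fderiv_fun_mul hφ hψ]

theorem continuous_transport {ψ : Z d → ℝ} (hψ : ContDiff ℝ 1 ψ) : Continuous (transport ψ) :=
  (hψ.continuous_fderiv one_ne_zero).clm_apply (by fun_prop)

theorem continuous_dV {ψ : Z d → ℝ} (hψ : ContDiff ℝ 1 ψ) (i : Fin d) : Continuous (dV i ψ) :=
  (hψ.continuous_fderiv one_ne_zero).clm_apply continuous_const

theorem _root_.HasCompactSupport.transport {ψ : Z d → ℝ} (hψ : HasCompactSupport ψ) :
    HasCompactSupport (transport ψ) :=
  hψ.fderiv_apply' _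

theorem _root_.HasCompactSupport.dV {ψ : Z d → ℝ} (hψ : HasCompactSupport ψ) (i : Fin d) :
    HasCompactSupport (dV i ψ) :=
  hψ.fderiv_apply' _

/-- Translations combined with a shear in the position variable preserve the Lebesgue measure. -/
theorem measurePreserving_shear (a : ℝ) (b : E d) {c : ℝ → E d → E d}
    (hc : Measurable (Function.uncurry c)) :
    MeasurePreserving fun z : Z d => ((z.1 + a, z.2.1 + c z.1 z.2.2, z.2.2 + b) : Z d) := by
  refine MeasurePreserving.skew_product (f := fun t : ℝ => t + a)
    (g := fun t (p : E d × E d) => (p.1 + c t p.2, p.2 + b))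
    (measurePreserving_add_right volume a) ?_ (Eventually.of_forall fun t => ?_)
  · have : Measurable fun q : ℝ × E d × E d => c q.1 q.2.2 :=
      hc.comp (measurable_fst.prodMk (measurable_snd.comp measurable_snd))
    fun_prop
  -- The position is shifted by an amount depending on the velocity, so the two variables are
  -- swapped to make the velocity the base of the skew product.
  · have h1 : MeasurePreserving (fun p : E d × E d => (p.1 + b, p.2 + c t p.1))
        (volume.prod volume) (volume.prod volume) := by
      refine MeasurePreserving.skew_product (f := fun v : E d => v + b)
        (g := fun v x => x + c t v) (measurePreserving_add_right volume b) ?_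
        (Eventually.of_forall fun v => (measurePreserving_add_right volume (c t v)).map_eq)
      have : Measurable fun q : E d × E d => c t q.1 :=
        hc.comp (measurable_const.prodMk measurable_fst)
      fun_prop
    exact ((Measure.measurePreserving_swap.comp h1).comp Measure.measurePreserving_swap).map_eq

/-! ### The rotation-invariant averaging density. -/

/-- A smooth probability density on the unit ball of `ℝ^d × ℝ^d`, invariant under the rotations
generated by `(p, y) ↦ (y, -p)`. -/
structure IsKernel (W : E d × E d → ℝ) : Prop where
  smooth : ContDiff ℝ ((⊤ : ℕ∞) : WithTop ℕ∞) W
  nonneg : ∀ w, 0 ≤ W w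
  zero_of_lt : ∀ w, 1 < ‖w‖ → W w = 0
  integral_eq : ∫ w, W w = 1
  rot : ∀ w : E d × E d, fderiv ℝ W w (w.2, -w.1) = 0

theorem exists_isKernel (d : ℕ) : ∃ W : E d × E d → ℝ, IsKernel W := by
  -- The rotation field annihilates every function of |p|² + |y|², the derivative of this sum along
  -- (y, -p) being 2(p·y - y·p) = 0.
  let N : E d × E d → ℝ := fun w => 1 - ‖w.1‖ ^ 2 - ‖w.2‖ ^ 2
  have hN : ContDiff ℝ ((⊤ : ℕ∞) : WithTop ℕ∞) N :=
    (contDiff_const.sub (contDiff_fst.norm_sq ℝ)).sub (contDiff_snd.norm_sq ℝ)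
  let W : E d × E d → ℝ := fun w => Real.smoothTransition (N w)
  have hW : ContDiff ℝ ((⊤ : ℕ∞) : WithTop ℕ∞) W := Real.smoothTransition.contDiff.comp hN
  have h0 : ∀ w, 0 ≤ W w := fun w => Real.smoothTransition.nonneg _
  have hz : ∀ w : E d × E d, 1 < ‖w‖ → W w = 0 := by
    intro w hw
    refine Real.smoothTransition.zero_of_nonpos ?_
    rw [Prod.norm_def, lt_max_iff] at hw
    have h1 := norm_nonneg w.1
    have h2 := norm_nonneg w.2
    simp only [N]
    rcases hw with hw | hw <;> nlinarith
  have hcs : HasCompactSupport W :=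
    HasCompactSupport.intro (isCompact_closedBall 0 1) fun w hw => hz w (by simpa using hw)
  have hpos : 0 < ∫ w, W w := by
    refine hW.continuous.integral_pos_of_hasCompactSupport_nonneg_nonzero hcs h0
      (x := 0) ?_
    exact (Real.smoothTransition.pos_of_pos (by simp [N])).ne'
  refine ⟨fun w => (∫ w, W w)⁻¹ * W w, contDiff_const.mul hW,
    fun w => mul_nonneg (inv_nonneg.2 hpos.le) (h0 w), fun w hw => by simp [hz w hw], ?_, ?_⟩
  · rw [integral_const_mul, inv_mul_cancel₀ hpos.ne']
  · intro w
    have hNd : HasFDerivAt N (fderiv ℝ N w) w :=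
      (hN.differentiable (by simp) w).hasFDerivAt
    have hsd : HasDerivAt Real.smoothTransition (deriv Real.smoothTransition (N w)) (N w) :=
      (Real.smoothTransition.contDiff (n := 1).differentiable (by simp) _).hasDerivAt
    have hWd : HasFDerivAt W (deriv Real.smoothTransition (N w) • fderiv ℝ N w) w :=
      hsd.comp_hasFDerivAt w hNd
    have h1 : HasFDerivAt (fun w : E d × E d => ‖w.1‖ ^ 2) _ w :=
      (hasStrictFDerivAt_norm_sq w.1).hasFDerivAt.comp w hasFDerivAt_fst
    have h2 : HasFDerivAt (fun w : E d × E d => ‖w.2‖ ^ 2) _ w :=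
      (hasStrictFDerivAt_norm_sq w.2).hasFDerivAt.comp w hasFDerivAt_snd
    have hN' := ((hasFDerivAt_const (1 : ℝ) w).sub h1).sub h2
    have hN'' : fderiv ℝ N w = _ := hN'.fderiv
    rw [(hWd.const_mul _).fderiv, hN'']
    simp [real_inner_comm]

namespace IsKernel

variable {W : E d × E d → ℝ}

theorem hasCompactSupport (hW : IsKernel W) : HasCompactSupport W :=
  HasCompactSupport.intro (isCompact_closedBall 0 1) fun w hw =>
    hW.zero_of_lt w (by simpa using hw)

theorem fderiv_zero_of_lt (hW : IsKernel W) (w : E d × E d) (hw : 1 < ‖w‖) :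
    fderiv ℝ W w = 0 := by
  have : W =ᶠ[𝓝 w] fun _ => 0 := by
    filter_upwards [(isOpen_lt continuous_const continuous_norm).mem_nhds hw] with w' hw'
    exact hW.zero_of_lt w' hw'
  rw [this.fderiv_eq]
  simp

/-- The rotation field is divergence free and annihilates W, so the integrand is the divergence of G
W times the field. In coordinates, the factor y_i does not depend on p_i, nor p_i on y_i, and each
term integrates to zero. -/
theorem integral_rot_eq (hW : IsKernel W) {G : E d × E d → ℝ} (hG : ContDiff ℝ 1 G) :
    ∫ w, fderiv ℝ G w (w.2, -w.1) * W w = 0 := by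
  have hW1 : ContDiff ℝ 1 W := hW.smooth.of_le (by exact_mod_cast le_top)
  set ψ : E d × E d → ℝ := fun w => G w * W w with hψ_def
  have hψ : ContDiff ℝ 1 ψ := hG.mul hW1
  have hs : HasCompactSupport ψ := hW.hasCompactSupport.mul_left
  have key : ∀ w : E d × E d, fderiv ℝ G w (w.2, -w.1) * W w =
      ∑ i, (w.2 i * fderiv ℝ ψ w (EuclideanSpace.single i 1, 0) -
        w.1 i * fderiv ℝ ψ w (0, EuclideanSpace.single i 1)) := by
    intro w
    have h : ((w.2, -w.1) : E d × E d) = ∑ i, (w.2 i • ((EuclideanSpace.single i 1, 0) : E d × E d)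
        - w.1 i • ((0, EuclideanSpace.single i 1) : E d × E d)) := by
      ext j <;> simp [Prod.fst_sum, Prod.snd_sum, Pi.single_apply]
    have h2 : fderiv ℝ ψ w (w.2, -w.1) = fderiv ℝ G w (w.2, -w.1) * W w := by
      rw [hψ_def, fderiv_fun_mul (hG.differentiable one_ne_zero w)
        (hW1.differentiable one_ne_zero w)]
      simp [hW.rot w, mul_comm]
    rw [← h2, h, map_sum]
    simp_rw [map_sub, map_smul, smul_eq_mul]
  have hi : ∀ (c : E d × E d → ℝ), Continuous c → ∀ u : E d × E d,
      Integrable fun z => c z * fderiv ℝ ψ z u := by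
    intro c hc u
    refine Continuous.integrable_of_hasCompactSupport
      (hc.mul ((hψ.continuous_fderiv one_ne_zero).clm_apply continuous_const)) ?_
    exact (hs.fderiv_apply' fun _ => u).mul_left
  have c1 : ∀ i : Fin d, ContDiff ℝ 1 fun w : E d × E d => w.1 i := fun i => by fun_prop
  have c2 : ∀ i : Fin d, ContDiff ℝ 1 fun w : E d × E d => w.2 i := fun i => by fun_prop
  simp_rw [key]
  rw [integral_finsetSum]
  · refine Finset.sum_eq_zero fun i _ => ?_
    rw [integral_sub (hi _ (c2 i).continuous _) (hi _ (c1 i).continuous _),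
      integral_mul_fderiv_eq_zero volume (c2 i) hψ hs, integral_mul_fderiv_eq_zero volume (c1 i) hψ hs,
      sub_zero]
    · intro w
      let l : E d × E d →L[ℝ] ℝ := (EuclideanSpace.proj i).comp (ContinuousLinearMap.fst ℝ (E d) (E d))
      change fderiv ℝ l w _ = 0
      rw [l.fderiv]
      simp [l]
    · intro w
      let l : E d × E d →L[ℝ] ℝ := (EuclideanSpace.proj i).comp (ContinuousLinearMap.snd ℝ (E d) (E d))
      change fderiv ℝ l w _ = 0
      rw [l.fderiv]
      simp [l]
  · exact fun i _ => (hi _ (c2 i).continuous _).sub (hi _ (c1 i).continuous _)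

theorem integral_fderiv_mul_eq (hW : IsKernel W) {G : E d × E d → ℝ} (hG : ContDiff ℝ 1 G)
    (u : E d × E d) : ∫ w, (fderiv ℝ G w u * W w + G w * fderiv ℝ W w u) = 0 := by
  have hW1 : ContDiff ℝ 1 W := hW.smooth.of_le (by exact_mod_cast le_top)
  rw [← integral_fderiv_eq_zero volume (hG.mul hW1) hW.hasCompactSupport.mul_left u]
  refine integral_congr_ae (Eventually.of_forall fun w => ?_)
  simp only
  rw [fderiv_fun_mul (hG.differentiable one_ne_zero w) (hW1.differentiable one_ne_zero w)]
  simp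
  ring

end IsKernel

/-! ### The representation formula along kinetic paths. -/

/-- The point reached from `z` at parameter `ζ = (τ, p, y)`, backwards in time by `τ²`. -/
def path (z ζ : Z d) : Z d :=
  (z.1 - ζ.1 ^ 2, z.2.1 - ζ.1 ^ 2 • z.2.2 + ζ.1 ^ 3 • ζ.2.1,
    z.2.2 - ζ.1 • ((3 / 2 : ℝ) • ζ.2.1 + ζ.2.2))

theorem contDiff_path (z : Z d) : ContDiff ℝ 1 (path z) := by
  unfold path
  fun_prop

theorem continuous_path : Continuous fun q : Z d × Z d => path q.1 q.2 := by
  unfold path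
  fun_prop

theorem hasFDerivAt_path_snd (z : Z d) (τ : ℝ) (w u : E d × E d) {Φ : Z d → ℝ}
    (hΦ : ContDiff ℝ 1 Φ) :
    fderiv ℝ (fun w => Φ (path z (τ, w))) w u =
      fderiv ℝ Φ (path z (τ, w)) (0, τ ^ 3 • u.1, -(τ • ((3 / 2 : ℝ) • u.1 + u.2))) := by
  have hd : DifferentiableAt ℝ (fun w => Φ (path z (τ, w))) w := by
    have : ContDiff ℝ 1 (fun w : E d × E d => Φ (path z (τ, w))) :=
      hΦ.comp ((contDiff_path z).comp (contDiff_const.prodMk contDiff_id))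
    exact this.differentiable one_ne_zero w
  have h1 : HasDerivAt (fun s : ℝ => w + s • u) u 0 := by
    simpa using ((hasDerivAt_id (0 : ℝ)).smul_const u).const_add w
  have h2 : HasDerivAt (fun s : ℝ => path z (τ, w + s • u))
      (0, τ ^ 3 • u.1, -(τ • ((3 / 2 : ℝ) • u.1 + u.2))) 0 := by
    have e1 : HasDerivAt (fun s : ℝ => (w + s • u).1) u.1 0 := by
      simpa using ((hasDerivAt_id (0 : ℝ)).smul_const u.1).const_add w.1
    have e2 : HasDerivAt (fun s : ℝ => (w + s • u).2) u.2 0 := by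
      simpa using ((hasDerivAt_id (0 : ℝ)).smul_const u.2).const_add w.2
    have e3 : HasDerivAt (fun s : ℝ => z.2.2 - τ • ((3 / 2 : ℝ) • (w + s • u).1 + (w + s • u).2))
        (-(τ • ((3 / 2 : ℝ) • u.1 + u.2))) 0 :=
      (((e1.const_smul (3 / 2 : ℝ)).add e2).const_smul τ).const_sub z.2.2
    have e4 : HasDerivAt (fun s : ℝ => z.2.1 - τ ^ 2 • z.2.2 + τ ^ 3 • (w + s • u).1)
        (τ ^ 3 • u.1) 0 := (e1.const_smul (τ ^ 3)).const_add (z.2.1 - τ ^ 2 • z.2.2)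
    exact (hasDerivAt_const (0 : ℝ) (z.1 - τ ^ 2)).prodMk (e4.prodMk e3)
  have hw : w + (0 : ℝ) • u = w := by simp
  have h3 := HasFDerivAt.comp_hasDerivAt (x := (0 : ℝ)) (f := fun s : ℝ => path z (τ, w + s • u))
    (l := Φ) (l' := fderiv ℝ Φ (path z (τ, w))) (by
      simp only [hw]
      exact (hΦ.differentiable one_ne_zero _).hasFDerivAt) h2
  have h4 := HasFDerivAt.comp_hasDerivAt (x := (0 : ℝ)) (f := fun s : ℝ => w + s • u)
    (l := fun w => Φ (path z (τ, w))) (l' := fderiv ℝ (fun w => Φ (path z (τ, w))) w) (by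
      simp only [hw]
      exact hd.hasFDerivAt) h1
  exact h4.unique h3

theorem hasDerivAt_path_fst (z : Z d) (τ : ℝ) (w : E d × E d) {Φ : Z d → ℝ}
    (hΦ : ContDiff ℝ 1 Φ) :
    HasDerivAt (fun τ => Φ (path z (τ, w)))
      (fderiv ℝ Φ (path z (τ, w)) (-(2 * τ), -((2 * τ) • z.2.2) + (3 * τ ^ 2) • w.1,
        -((3 / 2 : ℝ) • w.1 + w.2))) τ := by
  have h2 : HasDerivAt (fun τ : ℝ => path z (τ, w))
      (-(2 * τ), -((2 * τ) • z.2.2) + (3 * τ ^ 2) • w.1, -((3 / 2 : ℝ) • w.1 + w.2)) τ := by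
    have e2 : HasDerivAt (fun τ : ℝ => τ ^ 2) (2 * τ) τ := by
      simpa using hasDerivAt_pow 2 τ
    have e3 : HasDerivAt (fun τ : ℝ => τ ^ 3) (3 * τ ^ 2) τ := by
      simpa using hasDerivAt_pow 3 τ
    have e1 : HasDerivAt (fun τ : ℝ => τ • ((3 / 2 : ℝ) • w.1 + w.2)) ((3 / 2 : ℝ) • w.1 + w.2) τ := by
      simpa using (hasDerivAt_id τ).smul_const ((3 / 2 : ℝ) • w.1 + w.2)
    have e4 : HasDerivAt (fun τ : ℝ => z.2.1 - τ ^ 2 • z.2.2 + τ ^ 3 • w.1)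
        (-((2 * τ) • z.2.2) + (3 * τ ^ 2) • w.1) τ :=
      ((e2.smul_const z.2.2).const_sub z.2.1).add (e3.smul_const w.1)
    exact (e2.const_sub _).prodMk (e4.prodMk (e1.const_sub _))
  exact (hΦ.differentiable one_ne_zero _).hasFDerivAt.comp_hasDerivAt τ h2

/-- The set of parameters `ζ = (τ, p, y)`. -/
def slab (d : ℕ) : Set (Z d) := Ioo (0 : ℝ) 1 ×ˢ univ

theorem measurableSet_slab : MeasurableSet (slab d) := measurableSet_Ioo.prod MeasurableSet.univ

theorem integrableOn_slab {Q : Z d → ℝ} (hQ : Continuous Q) (h0 : ∀ ζ : Z d, 1 < ‖ζ.2‖ → Q ζ = 0) :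
    IntegrableOn Q (slab d) := by
  have h1 : IntegrableOn Q (Icc (0 : ℝ) 1 ×ˢ Metric.closedBall (0 : E d × E d) 1) :=
    hQ.continuousOn.integrableOn_compact (isCompact_Icc.prod (isCompact_closedBall _ _))
  have h2 : IntegrableOn Q (Ioo (0 : ℝ) 1 ×ˢ Metric.closedBall (0 : E d × E d) 1) :=
    h1.mono_set (prod_mono Ioo_subset_Icc_self Subset.rfl)
  refine h2.of_forall_sdiff_eq_zero measurableSet_slab fun ζ hζ => h0 ζ ?_
  have h3 := hζ.1.1
  by_contra! h
  exact hζ.2 ⟨h3, by simpa using h⟩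

/-- The integrand of the representation formula. -/
def repIntegrand (W : E d × E d → ℝ) (g : Z d → ℝ) (F : Fin d → Z d → ℝ) (z ζ : Z d) : ℝ :=
  ∑ i, F i (path z ζ) * (2 * fderiv ℝ W ζ.2 (0, EuclideanSpace.single i 1)) +
    ∑ i, dV i g (path z ζ) * ((4 * ζ.2.2 i - ζ.2.1 i / 2) * W ζ.2) +
      (transport g (path z ζ) - ∑ i, dV i (F i) (path z ζ)) * (2 * ζ.1 * W ζ.2)

theorem continuous_repIntegrand {W : E d × E d → ℝ} (hW : IsKernel W) {g : Z d → ℝ}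
    {F : Fin d → Z d → ℝ} (hg : ContDiff ℝ 1 g) (hF : ∀ i, ContDiff ℝ 1 (F i)) :
    Continuous fun q : Z d × Z d => repIntegrand W g F q.1 q.2 := by
  have hW1 : ContDiff ℝ 1 W := hW.smooth.of_le (by exact_mod_cast le_top)
  have hp := continuous_path (d := d)
  have h1 : Continuous fun q : Z d × Z d => fderiv ℝ W q.2.2 :=
    (hW1.continuous_fderiv one_ne_zero).comp (by fun_prop)
  have h2 := fun i => (hF i).continuous.comp hp
  have h3 := fun i => (continuous_dV hg i).comp hp
  have h4 := (continuous_transport hg).comp hp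
  have h5 := fun i => (continuous_dV (hF i) i).comp hp
  have h6 := hW1.continuous
  simp only [Function.comp_def] at h2 h3 h4 h5
  unfold repIntegrand
  refine ((continuous_finsetSum _ fun i _ => (h2 i).mul (continuous_const.mul
    (h1.clm_apply continuous_const))).add (continuous_finsetSum _ fun i _ => (h3 i).mul ?_)).add
    ((h4.sub (continuous_finsetSum _ fun i _ => h5 i)).mul ?_)
  · fun_prop
  · fun_prop

theorem repIntegrand_eq_zero {W : E d × E d → ℝ} (hW : IsKernel W) {g : Z d → ℝ}
    {F : Fin d → Z d → ℝ} {z ζ : Z d} (hζ : 1 < ‖ζ.2‖) : repIntegrand W g F z ζ = 0 := by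
  simp [repIntegrand, hW.zero_of_lt _ hζ, hW.fderiv_zero_of_lt _ hζ]

/-- Differentiating in y through the path produces -τ∇_v, so the terms 2F·∇_y W and -2τW ∇_v·F
cancel after integration by parts: F enters for free. The position derivative that remains is a
rotational derivative, of zero mean against W. -/
theorem integral_repIntegrand_slice {W : E d × E d → ℝ} (hW : IsKernel W) {g : Z d → ℝ}
    {F : Fin d → Z d → ℝ} (hg : ContDiff ℝ 1 g) (hF : ∀ i, ContDiff ℝ 1 (F i)) (z : Z d)
    {τ : ℝ} (hτ : 0 < τ) :
    ∫ w, repIntegrand W g F z (τ, w) = -∫ w : E d × E d,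
      fderiv ℝ g (path z (τ, w)) (-(2 * τ), -((2 * τ) • z.2.2) + (3 * τ ^ 2) • w.1,
        -((3 / 2 : ℝ) • w.1 + w.2)) * W w := by
  have hW1 : ContDiff ℝ 1 W := hW.smooth.of_le (by exact_mod_cast le_top)
  have hpτ : ContDiff ℝ 1 fun w : E d × E d => path z (τ, w) :=
    (contDiff_path z).comp (contDiff_const.prodMk contDiff_id)
  have hG : ContDiff ℝ 1 fun w : E d × E d => g (path z (τ, w)) := hg.comp hpτ
  have hΦ : ∀ i, ContDiff ℝ 1 fun w : E d × E d => F i (path z (τ, w)) := fun i => (hF i).comp hpτ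
  have i1 : Integrable fun w => repIntegrand W g F z (τ, w) := by
    refine Continuous.integrable_of_hasCompactSupport
      ((continuous_repIntegrand hW hg hF).comp (continuous_const.prodMk
        (continuous_const.prodMk continuous_id))) ?_
    exact HasCompactSupport.intro (isCompact_closedBall 0 1) fun w hw =>
      repIntegrand_eq_zero hW (by simpa using hw)
  have i2 : Integrable fun w : E d × E d =>
      fderiv ℝ g (path z (τ, w)) (-(2 * τ), -((2 * τ) • z.2.2) + (3 * τ ^ 2) • w.1,
        -((3 / 2 : ℝ) • w.1 + w.2)) * W w := by
    refine Continuous.integrable_of_hasCompactSupport (Continuous.mul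
      (((hg.continuous_fderiv one_ne_zero).comp hpτ.continuous).clm_apply (by fun_prop))
      hW1.continuous) hW.hasCompactSupport.mul_left
  have i3 : Integrable fun w : E d × E d =>
      fderiv ℝ (fun w => g (path z (τ, w))) w (w.2, -w.1) * W w := by
    refine Continuous.integrable_of_hasCompactSupport (Continuous.mul
      ((hG.continuous_fderiv one_ne_zero).clm_apply (by fun_prop))
      hW1.continuous) hW.hasCompactSupport.mul_left
  have i4 : ∀ i, Integrable fun w : E d × E d =>
      fderiv ℝ (fun w => F i (path z (τ, w))) w (0, EuclideanSpace.single i 1) * W w +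
        F i (path z (τ, w)) * fderiv ℝ W w (0, EuclideanSpace.single i 1) := by
    intro i
    refine Continuous.integrable_of_hasCompactSupport
      ((((hΦ i).continuous_fderiv one_ne_zero).clm_apply continuous_const).mul hW1.continuous |>.add
      ((hΦ i).continuous.mul ((hW1.continuous_fderiv one_ne_zero).clm_apply continuous_const))) ?_
    exact hW.hasCompactSupport.mul_left.add
      (hW.hasCompactSupport.fderiv_apply' fun _ => _).mul_left
  rw [eq_neg_iff_add_eq_zero, ← integral_add i1 i2]
  have key : ∀ w : E d × E d, repIntegrand W g F z (τ, w) +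
      fderiv ℝ g (path z (τ, w)) (-(2 * τ), -((2 * τ) • z.2.2) + (3 * τ ^ 2) • w.1,
        -((3 / 2 : ℝ) • w.1 + w.2)) * W w =
      -(2 * τ⁻¹) * (fderiv ℝ (fun w => g (path z (τ, w))) w (w.2, -w.1) * W w) +
      ∑ i, 2 * (fderiv ℝ (fun w => F i (path z (τ, w))) w (0, EuclideanSpace.single i 1) * W w +
        F i (path z (τ, w)) * fderiv ℝ W w (0, EuclideanSpace.single i 1)) := by
    intro w
    -- With v' the velocity at the path point, subtracting -2τ(∂_t + v'·∇_x) leaves the position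
    -- direction -2τ²y. This is -2/τ times the image (τ³y, -τ(3y/2 - p)) of the rotation field, up
    -- to velocity. The remaining velocity direction is -(4y - p/2). The coefficient 3/2 in `path`
    -- is what cancels p from the position direction.
    have hv : fderiv ℝ g (path z (τ, w)) (-(2 * τ), -((2 * τ) • z.2.2) + (3 * τ ^ 2) • w.1,
        -((3 / 2 : ℝ) • w.1 + w.2)) = -(2 * τ) * transport g (path z (τ, w))
          - (2 * τ⁻¹) * fderiv ℝ g (path z (τ, w)) (0, τ ^ 3 • w.2, -(τ • ((3 / 2 : ℝ) • w.2 + -w.1)))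
          - ∑ i, dV i g (path z (τ, w)) * (4 * w.2 i - w.1 i / 2) := by
      have hs : ∑ i, dV i g (path z (τ, w)) * (4 * w.2 i - w.1 i / 2) =
          fderiv ℝ g (path z (τ, w)) (0, 0, (4 : ℝ) • w.2 - (1 / 2 : ℝ) • w.1) := by
        have : ((0, 0, (4 : ℝ) • w.2 - (1 / 2 : ℝ) • w.1) : Z d) =
            ∑ i, (4 * w.2 i - w.1 i / 2) • ev i := by
          ext j
          · simp [Prod.fst_sum, ev]
          · simp [Prod.fst_sum, Prod.snd_sum, ev]
          · simp [Prod.snd_sum, ev, Pi.single_apply]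
            ring
        rw [this, map_sum]
        simp_rw [map_smul, smul_eq_mul, dV, mul_comm]
      have hτ' : τ ≠ 0 := hτ.ne'
      have hvec : ((-(2 * τ), -((2 * τ) • z.2.2) + (3 * τ ^ 2) • w.1,
          -((3 / 2 : ℝ) • w.1 + w.2)) : Z d) = (-(2 * τ)) • (1, (path z (τ, w)).2.2, 0) -
          (2 * τ⁻¹) • (0, τ ^ 3 • w.2, -(τ • ((3 / 2 : ℝ) • w.2 + -w.1))) -
          (0, 0, (4 : ℝ) • w.2 - (1 / 2 : ℝ) • w.1) := by
        ext j
        · simp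
        · simp [path]
          field_simp
          ring
        · simp [path]
          field_simp
          ring
      rw [hs, transport, hvec, map_sub, map_sub, map_smul, map_smul, smul_eq_mul, smul_eq_mul]
    have hF' : ∀ i, fderiv ℝ (F i) (path z (τ, w))
        (0, τ ^ 3 • (0 : E d), -(τ • ((3 / 2 : ℝ) • (0 : E d) + EuclideanSpace.single i 1))) =
        -τ * dV i (F i) (path z (τ, w)) := by
      intro i
      rw [dV, ← smul_eq_mul, ← map_smul]
      simp [ev]
    simp_rw [hasFDerivAt_path_snd z τ w _ hg, fun i => hasFDerivAt_path_snd z τ w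
      (0, EuclideanSpace.single i 1) (hF i), hv, hF', repIntegrand]
    have e1 : ∑ i, dV i g (path z (τ, w)) * ((4 * w.2 i - w.1 i / 2) * W w) =
        (∑ i, dV i g (path z (τ, w)) * (4 * w.2 i - w.1 i / 2)) * W w := by
      simp_rw [Finset.sum_mul, mul_assoc]
    have e2 : ∑ i, 2 * (-τ * dV i (F i) (path z (τ, w)) * W w +
        F i (path z (τ, w)) * fderiv ℝ W w (0, EuclideanSpace.single i 1)) =
        ∑ i, F i (path z (τ, w)) * (2 * fderiv ℝ W w (0, EuclideanSpace.single i 1)) -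
        (∑ i, dV i (F i) (path z (τ, w))) * (2 * τ * W w) := by
      rw [Finset.sum_mul, ← Finset.sum_sub_distrib]
      exact Finset.sum_congr rfl fun i _ => by ring
    rw [e1, e2]
    ring
  simp_rw [key]
  rw [integral_add (i3.const_mul _) (integrable_finsetSum _ fun i _ => (i4 i).const_mul _),
    integral_const_mul, hW.integral_rot_eq hG, integral_finsetSum _ fun i _ => (i4 i).const_mul _]
  simp_rw [integral_const_mul, fun i => hW.integral_fderiv_mul_eq (hΦ i) (0, EuclideanSpace.single i 1)]
  simp

/-- Averaging the fundamental theorem of calculus along the paths `τ ↦ path z (τ, p, y)`. -/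
theorem representation {W : E d × E d → ℝ} (hW : IsKernel W) {g : Z d → ℝ}
    {F : Fin d → Z d → ℝ} (hg : ContDiff ℝ 1 g) (hF : ∀ i, ContDiff ℝ 1 (F i)) (z : Z d)
    (hz : ∀ z' : Z d, z'.1 = z.1 - 1 → g z' = 0) :
    g z = ∫ ζ in slab d, repIntegrand W g F z ζ := by
  have hW1 : ContDiff ℝ 1 W := hW.smooth.of_le (by exact_mod_cast le_top)
  set D : Z d → ℝ := fun ζ => fderiv ℝ g (path z ζ) (-(2 * ζ.1), -((2 * ζ.1) • z.2.2) +
    (3 * ζ.1 ^ 2) • ζ.2.1, -((3 / 2 : ℝ) • ζ.2.1 + ζ.2.2)) with hD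
  have hDc : Continuous D :=
    ((hg.continuous_fderiv one_ne_zero).comp (contDiff_path z).continuous).clm_apply (by fun_prop)
  have hDi : IntegrableOn (fun ζ => D ζ * W ζ.2) (slab d) :=
    integrableOn_slab (hDc.mul (hW1.continuous.comp continuous_snd)) fun ζ hζ => by
      simp [hW.zero_of_lt _ hζ]
  have hQi : IntegrableOn (repIntegrand W g F z) (slab d) :=
    integrableOn_slab ((continuous_repIntegrand hW hg hF).comp (continuous_const.prodMk
      continuous_id)) fun ζ hζ => repIntegrand_eq_zero hW hζ
  have hvol : (volume : Measure (Z d)) = (volume : Measure ℝ).prod volume := rfl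
  -- At τ = 1 the path has gone back one unit of time, where g vanishes; only the value at τ = 0,
  -- which is g z, survives.
  have hFTC : ∀ w : E d × E d, ∫ τ in Ioo (0 : ℝ) 1, D (τ, w) * W w = -(g z * W w) := by
    intro w
    rw [integral_mul_const, ← integral_Ioc_eq_integral_Ioo, ← intervalIntegral.integral_of_le zero_le_one,
      intervalIntegral.integral_eq_sub_of_hasDerivAt
        (fun τ _ => hasDerivAt_path_fst z τ w hg)
        ((hDc.comp (continuous_id.prodMk continuous_const)).intervalIntegrable _ _),
      hz _ (by simp [path])]
    simp [path]
  rw [slab, hvol] at hDi hQi ⊢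
  rw [setIntegral_prod _ hQi]
  simp only [Measure.restrict_univ]
  rw [setIntegral_congr_fun measurableSet_Ioo
    (g := fun τ => -∫ w, D (τ, w) * W w) (fun τ hτ => integral_repIntegrand_slice hW hg hF z hτ.1)]
  rw [integral_neg, integral_integral_swap (f := fun τ w => D (τ, w) * W w)]
  · simp_rw [hFTC, integral_neg, integral_const_mul, hW.integral_eq]
    simp
  · rw [IntegrableOn, ← Measure.prod_restrict, Measure.restrict_univ] at hDi
    exact hDi

/-! ### Averages along paths: change of variables and Young's inequality. -/

theorem lintegral_comp_const_add_smul {a : ℝ} (ha : 0 < a) (c : E d) {f : E d → ℝ≥0∞}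
    (hf : Measurable f) :
    ENNReal.ofReal (a ^ d) * ∫⁻ y, f (c + a • y) = ∫⁻ y, f y := by
  have h1 : ∫⁻ y, f (c + y) ∂(Measure.map (a • ·) (volume : Measure (E d))) =
      ∫⁻ y, f (c + a • y) :=
    lintegral_map (hf.comp (measurable_const_add c)) (measurable_const_smul a)
  rw [← h1, Measure.map_addHaar_smul _ ha.ne', lintegral_smul_measure,
    lintegral_add_left_eq_self f c, smul_eq_mul, ← mul_assoc, finrank_euclideanSpace_fin,
    ← ENNReal.ofReal_mul (by positivity), abs_of_pos (by positivity),
    mul_inv_cancel₀ (by positivity)]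
  simp

theorem measurePreserving_path (ζ : Z d) : MeasurePreserving fun z : Z d => path z ζ := by
  have h := measurePreserving_shear (d := d) (-ζ.1 ^ 2)
    (-(ζ.1 • ((3 / 2 : ℝ) • ζ.2.1 + ζ.2.2)))
    (c := fun _ v => -(ζ.1 ^ 2 • v) + ζ.1 ^ 3 • ζ.2.1) (by
      simp only [Function.uncurry_def]
      fun_prop)
  convert h using 1
  ext z : 1
  simp only [path, sub_eq_add_neg, add_assoc]

/-- At fixed z the change of variables is triangular: y is scaled by τ into v, p by τ³ into x, and τ
↦ t - τ² is injective on (0, 1) with derivative of size 2τ. The Jacobian 2τ^(4d+1) dominates the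
weight. -/
theorem lintegral_path_mul_le (z : Z d) {Ψ : Z d → ℝ≥0∞} (hΨ : Measurable Ψ) :
    ∫⁻ ζ in slab d, Ψ (path z ζ) * ENNReal.ofReal (ζ.1 ^ (4 * d + 1)) ≤ ∫⁻ z, Ψ z := by
  have hvol : (volume : Measure (Z d)) = (volume : Measure ℝ).prod volume := rfl
  have hvol2 : (volume : Measure (E d × E d)) = (volume : Measure (E d)).prod volume := rfl
  have hpath : Measurable (path z) := (contDiff_path z).continuous.measurable
  have hm : Measurable fun ζ : Z d => Ψ (path z ζ) * ENNReal.ofReal (ζ.1 ^ (4 * d + 1)) :=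
    (hΨ.comp hpath).mul (by fun_prop)
  set Θ : ℝ → ℝ≥0∞ := fun t => ∫⁻ w : E d × E d, Ψ (t, w) with hΘ
  have hΘm : Measurable Θ := hΨ.lintegral_prod_right'
  have inner : ∀ τ ∈ Ioo (0 : ℝ) 1,
      ∫⁻ w : E d × E d, Ψ (path z (τ, w)) * ENNReal.ofReal (τ ^ (4 * d + 1)) =
        ENNReal.ofReal τ * Θ (z.1 - τ ^ 2) := by
    intro τ hτ
    have hτ0 := hτ.1
    have e : ENNReal.ofReal (τ ^ (4 * d + 1)) = ENNReal.ofReal τ *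
        (ENNReal.ofReal ((τ ^ 3) ^ d) * ENNReal.ofReal (τ ^ d)) := by
      rw [← ENNReal.ofReal_mul (by positivity), ← ENNReal.ofReal_mul (by positivity)]
      congr 1
      ring
    have m1 : ∀ p : E d, Measurable fun y : E d => Ψ (path z (τ, p, y)) := fun p =>
      hΨ.comp (hpath.comp (by fun_prop))
    have m2 : Measurable fun w : E d × E d => Ψ (path z (τ, w)) := hΨ.comp (hpath.comp (by fun_prop))
    have s1 : ∀ p : E d, ENNReal.ofReal (τ ^ d) * ∫⁻ y, Ψ (path z (τ, p, y)) =
        ∫⁻ v, Ψ (z.1 - τ ^ 2, (z.2.1 - τ ^ 2 • z.2.2) + τ ^ 3 • p, v) := by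
      intro p
      have m3 : Measurable fun v : E d =>
          Ψ (z.1 - τ ^ 2, (z.2.1 - τ ^ 2 • z.2.2) + τ ^ 3 • p, v) := hΨ.comp (by fun_prop)
      rw [← lintegral_comp_const_add_smul hτ0 (z.2.2 - τ • (3 / 2 : ℝ) • p) m3,
        ← lintegral_neg_eq_self (fun y : E d => Ψ (z.1 - τ ^ 2,
          (z.2.1 - τ ^ 2 • z.2.2) + τ ^ 3 • p, z.2.2 - τ • (3 / 2 : ℝ) • p + τ • y))]
      congr 1
      refine lintegral_congr fun y => ?_
      simp only [path]
      congr 3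
      module
    rw [lintegral_mul_const _ m2, hvol2, lintegral_prod _ m2.aemeasurable, e, mul_comm, mul_assoc,
      mul_assoc, ← lintegral_const_mul _ (m2.lintegral_prod_right')]
    simp_rw [s1]
    congr 1
    have m4 : Measurable fun x : E d => ∫⁻ v, Ψ (z.1 - τ ^ 2, x, v) := by
      have : Measurable fun q : E d × E d => Ψ (z.1 - τ ^ 2, q) := hΨ.comp (by fun_prop)
      exact this.lintegral_prod_right'
    rw [lintegral_comp_const_add_smul (pow_pos hτ0 3) _ m4, hΘ]
    simp only
    have m5 : Measurable fun q : E d × E d => Ψ (z.1 - τ ^ 2, q) := hΨ.comp (by fun_prop)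
    rw [hvol2, lintegral_prod _ m5.aemeasurable]
  rw [hvol, slab, ← Measure.prod_restrict, Measure.restrict_univ, lintegral_prod _ hm.aemeasurable,
    setLIntegral_congr_fun measurableSet_Ioo inner, lintegral_prod _ hΨ.aemeasurable]
  have hinj : InjOn (fun τ : ℝ => z.1 - τ ^ 2) (Ioo 0 1) := by
    intro a ha b hb hab
    have : a ^ 2 = b ^ 2 := by simpa using hab
    exact (pow_left_inj₀ ha.1.le hb.1.le two_ne_zero).1 this
  have hder : ∀ τ ∈ Ioo (0 : ℝ) 1,
      HasDerivWithinAt (fun τ : ℝ => z.1 - τ ^ 2) (-(2 * τ)) (Ioo 0 1) τ := by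
    intro τ _
    have := (hasDerivAt_pow 2 τ).const_sub z.1
    simpa using this.hasDerivWithinAt
  calc ∫⁻ τ in Ioo (0 : ℝ) 1, ENNReal.ofReal τ * Θ (z.1 - τ ^ 2)
      ≤ ∫⁻ τ in Ioo (0 : ℝ) 1, ENNReal.ofReal |-(2 * τ)| * Θ (z.1 - τ ^ 2) := by
        refine setLIntegral_mono' measurableSet_Ioo fun τ hτ => ?_
        gcongr
        rw [abs_neg, abs_of_pos (by linarith [hτ.1])]
        linarith [hτ.1]
    _ = ∫⁻ t in (fun τ : ℝ => z.1 - τ ^ 2) '' Ioo 0 1, Θ t :=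
        (lintegral_image_eq_lintegral_abs_deriv_mul measurableSet_Ioo hder hinj Θ).symm
    _ ≤ ∫⁻ t, Θ t := setLIntegral_le_lintegral _ _

/-- The parameters `(τ, p, y)` with `|p|, |y| ≤ 1`. -/
def block (d : ℕ) : Set (Z d) := Ioo (0 : ℝ) 1 ×ˢ Metric.closedBall 0 1

theorem measurableSet_block : MeasurableSet (block d) :=
  measurableSet_Ioo.prod Metric.isClosed_closedBall.measurableSet

theorem block_subset_slab : block d ⊆ slab d := prod_mono Subset.rfl (subset_univ _)

/-- The average of `Ψ` over the paths issued from `z`. -/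
def pathAvg (Ψ : Z d → ℝ≥0∞) (z : Z d) : ℝ≥0∞ := ∫⁻ ζ in block d, Ψ (path z ζ)

theorem lintegral_block_rpow {a : ℝ} (ha : a < 1) :
    ∫⁻ ζ in block d, ENNReal.ofReal (ζ.1 ^ (-a)) =
      ENNReal.ofReal (1 - a)⁻¹ * volume (Metric.closedBall (0 : E d × E d) 1) := by
  have hvol : (volume : Measure (Z d)) = (volume : Measure ℝ).prod volume := rfl
  have hi : IntervalIntegrable (fun x : ℝ => x ^ (-a)) volume 0 1 :=
    intervalIntegral.intervalIntegrable_rpow' (by linarith)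
  have h1 : ∫⁻ τ in Ioo (0 : ℝ) 1, ENNReal.ofReal (τ ^ (-a)) = ENNReal.ofReal (1 - a)⁻¹ := by
    rw [← ofReal_integral_eq_lintegral_ofReal, ← integral_Ioc_eq_integral_Ioo,
      ← intervalIntegral.integral_of_le zero_le_one, integral_rpow (Or.inl (by linarith))]
    · rw [Real.one_rpow, Real.zero_rpow (by linarith), neg_add_eq_sub, sub_zero, one_div]
    · exact ((intervalIntegrable_iff_integrableOn_Ioo_of_le zero_le_one).1 hi)
    · exact (ae_restrict_mem measurableSet_Ioo).mono fun τ hτ => Real.rpow_nonneg hτ.1.le _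
  rw [block, hvol, ← Measure.prod_restrict, lintegral_prod _ (by fun_prop)]
  simp only [lintegral_const, Measure.restrict_apply_univ]
  rw [lintegral_mul_const _ (by fun_prop), h1]

theorem measurable_pathAvg {Ψ : Z d → ℝ≥0∞} (hΨ : Measurable Ψ) : Measurable (pathAvg Ψ) := by
  have : Measurable fun q : Z d × Z d => Ψ (path q.1 q.2) := hΨ.comp continuous_path.measurable
  exact this.lintegral_prod_right'

/-- Young's inequality for the averages along paths, with the explicit norm of the kernel. -/
theorem lintegral_pathAvg_rpow_le {Ψ : Z d → ℝ≥0∞} (hΨ : Measurable Ψ) {p a : ℝ} (hp : 2 ≤ p)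
    (ha : a = (4 * d + 1) * ((p - 2) / (p + 2))) (ha1 : a < 1) :
    ∫⁻ z, pathAvg Ψ z ^ p ≤
      (ENNReal.ofReal (1 - a)⁻¹ * volume (Metric.closedBall (0 : E d × E d) 1)) ^ (1 + p / 2) *
        (∫⁻ z, Ψ z ^ (2 : ℝ)) ^ (p / 2) := by
  set I := ENNReal.ofReal (1 - a)⁻¹ * volume (Metric.closedBall (0 : E d × E d) 1) with hI
  set N := ∫⁻ z, Ψ z ^ (2 : ℝ) with hN
  have hp0 : 0 < p := by linarith
  have hb : 0 ≤ 1 / 2 - 1 / p := by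
    rw [sub_nonneg]
    exact one_div_le_one_div_of_le two_pos hp
  have hΨ2 : Measurable fun z => Ψ z ^ (2 : ℝ) := hΨ.pow_const 2
  have hpm : ∀ z, Measurable fun ζ : Z d => Ψ (path z ζ) := fun z =>
    hΨ.comp (contDiff_path z).continuous.measurable
  have hpm2 : ∀ z, Measurable fun ζ : Z d => Ψ (path z ζ) ^ (2 : ℝ) := fun z => (hpm z).pow_const _
  -- As in the proof of Young's inequality, Ψ is factored with Hölder exponents 1/p, 1/2 and 1/2 -
  -- 1/p. The third factor is bounded uniformly in z through the Jacobian weight, and the first will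
  -- be integrated in z.
  have pt : ∀ z, pathAvg Ψ z ^ p ≤
      (∫⁻ ζ in block d, Ψ (path z ζ) ^ (2 : ℝ) * ENNReal.ofReal (ζ.1 ^ (-a))) *
        (I ^ (p / 2) * N ^ (p / 2 - 1)) := by
    intro z
    have holder := ENNReal.lintegral_prod_norm_pow_le (μ := volume.restrict (block d))
      (Finset.univ : Finset (Fin 3))
      (f := ![fun ζ => Ψ (path z ζ) ^ (2 : ℝ) * ENNReal.ofReal (ζ.1 ^ (-a)),
        fun ζ => ENNReal.ofReal (ζ.1 ^ (-a)),
        fun ζ => Ψ (path z ζ) ^ (2 : ℝ) * ENNReal.ofReal (ζ.1 ^ (4 * d + 1))])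
      (p := ![1 / p, 1 / 2, 1 / 2 - 1 / p]) (by
        intro i _
        fin_cases i
        · exact ((hpm2 z).mul (by fun_prop)).aemeasurable
        · exact Measurable.aemeasurable (by simp; fun_prop)
        · exact ((hpm2 z).mul (by fun_prop)).aemeasurable)
      (by simp [Fin.sum_univ_three]; ring)
      (by
        intro i _
        fin_cases i
        · simpa using hp0.le
        · simp
        · simpa using hb)
    simp only [Fin.prod_univ_three, Matrix.cons_val_zero, Matrix.cons_val_one, Matrix.cons_val] at holder
    have heq : ∀ ζ ∈ block d, (Ψ (path z ζ) ^ (2 : ℝ) * ENNReal.ofReal (ζ.1 ^ (-a))) ^ (1 / p) *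
        ENNReal.ofReal (ζ.1 ^ (-a)) ^ (1 / 2 : ℝ) *
        (Ψ (path z ζ) ^ (2 : ℝ) * ENNReal.ofReal (ζ.1 ^ (4 * d + 1))) ^ (1 / 2 - 1 / p) =
        Ψ (path z ζ) := by
      intro ζ hζ
      have hτ : 0 < ζ.1 := hζ.1.1
      have hx0 : ENNReal.ofReal ζ.1 ≠ 0 := by simpa using hτ
      have hxt : ENNReal.ofReal ζ.1 ≠ ⊤ := ENNReal.ofReal_ne_top
      rw [← Real.rpow_natCast, ← ENNReal.ofReal_rpow_of_pos hτ, ← ENNReal.ofReal_rpow_of_pos hτ,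
        ENNReal.mul_rpow_of_nonneg _ _ (by positivity), ENNReal.mul_rpow_of_nonneg _ _ hb,
        ← ENNReal.rpow_mul, ← ENNReal.rpow_mul, ← ENNReal.rpow_mul, ← ENNReal.rpow_mul,
        ← ENNReal.rpow_mul]
      have : ∀ A B C D G : ℝ≥0∞, A * B * C * (D * G) = (A * D) * (B * C * G) := by
        intros; ring
      rw [this, ← ENNReal.rpow_add_of_nonneg _ _ (by positivity) (by positivity),
        ← ENNReal.rpow_add _ _ hx0 hxt, ← ENNReal.rpow_add _ _ hx0 hxt]
      have e1 : 2 * (1 / p) + 2 * (1 / 2 - 1 / p) = 1 := by ring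
      -- Cancellation of the powers of τ in the three factors; this is what fixes a.
      have e2 : -a * (1 / p) + -a * (1 / 2) + ((4 * d + 1 : ℕ) : ℝ) * (1 / 2 - 1 / p) = 0 := by
        rw [ha]
        push_cast
        field_simp
        ring
      rw [e1, e2]
      simp
    rw [setLIntegral_congr_fun measurableSet_block heq] at holder
    have h3 : ∫⁻ ζ in block d, Ψ (path z ζ) ^ (2 : ℝ) * ENNReal.ofReal (ζ.1 ^ (4 * d + 1)) ≤ N :=
      (lintegral_mono_set block_subset_slab).trans (lintegral_path_mul_le z hΨ2)
    rw [lintegral_block_rpow ha1, ← hI] at holder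
    calc pathAvg Ψ z ^ p ≤ ((∫⁻ ζ in block d, Ψ (path z ζ) ^ (2 : ℝ) *
          ENNReal.ofReal (ζ.1 ^ (-a))) ^ (1 / p) * I ^ (1 / 2 : ℝ) * N ^ (1 / 2 - 1 / p)) ^ p := by
          refine ENNReal.rpow_le_rpow (holder.trans ?_) hp0.le
          gcongr
      _ = _ := by
          rw [ENNReal.mul_rpow_of_nonneg _ _ hp0.le, ENNReal.mul_rpow_of_nonneg _ _ hp0.le,
            ← ENNReal.rpow_mul, ← ENNReal.rpow_mul, ← ENNReal.rpow_mul, mul_assoc,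
            one_div_mul_cancel hp0.ne', ENNReal.rpow_one]
          congr 3
          · ring
          · field_simp
  have hm2 : Measurable fun q : Z d × Z d =>
      Ψ (path q.1 q.2) ^ (2 : ℝ) * ENNReal.ofReal (q.2.1 ^ (-a)) :=
    (hΨ2.comp continuous_path.measurable).mul (by fun_prop)
  calc ∫⁻ z, pathAvg Ψ z ^ p
      ≤ ∫⁻ z, (∫⁻ ζ in block d, Ψ (path z ζ) ^ (2 : ℝ) * ENNReal.ofReal (ζ.1 ^ (-a))) *
        (I ^ (p / 2) * N ^ (p / 2 - 1)) := lintegral_mono pt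
    _ = (∫⁻ z, ∫⁻ ζ in block d, Ψ (path z ζ) ^ (2 : ℝ) * ENNReal.ofReal (ζ.1 ^ (-a))) *
        (I ^ (p / 2) * N ^ (p / 2 - 1)) := lintegral_mul_const _ hm2.lintegral_prod_right'
    _ = (N * I) * (I ^ (p / 2) * N ^ (p / 2 - 1)) := by
        -- For fixed parameters ζ the map z ↦ `path z ζ` preserves the measure, so the integral in z
        -- is N for every ζ.
        rw [lintegral_lintegral_swap hm2.aemeasurable]
        congr 1
        have : ∀ ζ : Z d, ∫⁻ z, Ψ (path z ζ) ^ (2 : ℝ) * ENNReal.ofReal (ζ.1 ^ (-a)) =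
            N * ENNReal.ofReal (ζ.1 ^ (-a)) := by
          intro ζ
          have h5 : Measurable fun z => Ψ (path z ζ) ^ (2 : ℝ) :=
            hΨ2.comp (measurePreserving_path ζ).measurable
          rw [lintegral_mul_const _ h5]
          congr 1
          exact (measurePreserving_path ζ).lintegral_comp hΨ2
        simp_rw [this]
        rw [lintegral_const_mul _ (by fun_prop), lintegral_block_rpow ha1]
    _ = _ := by
        have h1 : I ^ (1 + p / 2) = I * I ^ (p / 2) := by
          rw [ENNReal.rpow_add_of_nonneg _ _ zero_le_one (by positivity), ENNReal.rpow_one]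
        have h2 : N ^ (p / 2) = N * N ^ (p / 2 - 1) := by
          have : p / 2 = 1 + (p / 2 - 1) := by ring
          conv_lhs => rw [this]
          rw [ENNReal.rpow_add_of_nonneg _ _ zero_le_one (by linarith), ENNReal.rpow_one]
        rw [h1, h2]
        ring

/-- With ε = 2 + 1/d - p, one has 1 - a = 4dε/(p+2), so the kernel integral is O(1/ε). It enters
with the power 1/p + 1/2 ≤ 1, and since its bound is at least one the rate 1/ε is kept. The constant
5 comes from p + 2 ≤ 5. -/
theorem exists_pathAvg_bound (hd : 0 < d) : ∃ C : ℝ, 0 < C ∧ ∀ (Ψ : Z d → ℝ≥0∞), Measurable Ψ →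
    ∀ p : ℝ, 2 ≤ p → p < 2 + 1 / (d : ℝ) →
      (∫⁻ z, pathAvg Ψ z ^ p) ^ (1 / p) ≤
        ENNReal.ofReal (C * (2 + 1 / (d : ℝ) - p)⁻¹) * (∫⁻ z, Ψ z ^ (2 : ℝ)) ^ (1 / 2 : ℝ) := by
  set b : ℝ := volume.real (Metric.closedBall (0 : E d × E d) 1) with hb
  have hb0 : 0 ≤ b := measureReal_nonneg
  refine ⟨5 * (b + 1), by positivity, fun Ψ hΨ p hp hp2 => ?_⟩
  have hd1 : (1 : ℝ) ≤ d := by exact_mod_cast hd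
  have hd0 : (0 : ℝ) < d := by linarith
  set ε := 2 + 1 / (d : ℝ) - p with hε
  have hε0 : 0 < ε := by linarith
  have hdinv : 1 / (d : ℝ) ≤ 1 := by rw [div_le_one hd0]; exact hd1
  have hε1 : ε ≤ 1 := by linarith
  have hp0 : 0 < p := by linarith
  set a : ℝ := (4 * d + 1) * ((p - 2) / (p + 2)) with ha
  have h1a : 1 - a = 4 * d * ε / (p + 2) := by
    rw [ha, hε]
    field_simp
    ring
  have ha1 : a < 1 := by
    have : 0 < 1 - a := by rw [h1a]; positivity
    linarith
  have main := lintegral_pathAvg_rpow_le hΨ hp ha ha1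
  have hI : ENNReal.ofReal (1 - a)⁻¹ * volume (Metric.closedBall (0 : E d × E d) 1) ≤
      ENNReal.ofReal (5 * (b + 1) * ε⁻¹) := by
    rw [← ofReal_measureReal (isCompact_closedBall _ _).measure_lt_top.ne,
      ← ENNReal.ofReal_mul (by rw [h1a]; positivity)]
    refine ENNReal.ofReal_le_ofReal ?_
    rw [h1a, inv_div, ← hb, div_mul_eq_mul_div, ← div_eq_mul_inv,
      div_le_div_iff₀ (by positivity) hε0]
    have : (p + 2) * b * ε ≤ 5 * (b + 1) * ε := by
      gcongr
      · linarith
      · linarith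
    have h4 : 5 * (b + 1) * ε * 1 ≤ 5 * (b + 1) * ε * (4 * d) := by
      gcongr
      linarith
    linarith
  have hC1 : (1 : ℝ≥0∞) ≤ ENNReal.ofReal (5 * (b + 1) * ε⁻¹) := by
    rw [ENNReal.one_le_ofReal]
    have : 1 ≤ ε⁻¹ := (one_le_inv₀ hε0).2 hε1
    nlinarith
  calc (∫⁻ z, pathAvg Ψ z ^ p) ^ (1 / p)
      ≤ ((ENNReal.ofReal (5 * (b + 1) * ε⁻¹)) ^ (1 + p / 2) *
        (∫⁻ z, Ψ z ^ (2 : ℝ)) ^ (p / 2)) ^ (1 / p) := by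
        refine ENNReal.rpow_le_rpow (main.trans ?_) (by positivity)
        gcongr
    _ = (ENNReal.ofReal (5 * (b + 1) * ε⁻¹)) ^ (1 / p + 1 / 2) *
        (∫⁻ z, Ψ z ^ (2 : ℝ)) ^ (1 / 2 : ℝ) := by
        rw [ENNReal.mul_rpow_of_nonneg _ _ (by positivity), ← ENNReal.rpow_mul, ← ENNReal.rpow_mul]
        congr 2
        · field_simp
        · field_simp
    _ ≤ _ := by
        gcongr
        refine (ENNReal.rpow_le_rpow_of_exponent_le hC1 ?_).trans_eq (ENNReal.rpow_one _)
        have : 1 / p ≤ 1 / 2 := one_div_le_one_div_of_le two_pos hp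
        linarith

/-! ### Smooth sub-solutions: gain of integrability. -/

/-- Boundedness, support and Lipschitz bounds with constant `L` for a kernel on the unit ball. -/
structure KernelBound (L : ℝ) (κ : E d × E d → ℝ) : Prop where
  bound : ∀ w, |κ w| ≤ L
  zero_of_lt : ∀ w, 1 < ‖w‖ → κ w = 0
  lip : ∀ w w', |κ w - κ w'| ≤ L * ‖w - w'‖

theorem KernelBound.mono {L L' : ℝ} {κ : E d × E d → ℝ} (h : KernelBound L κ) (hL : L ≤ L') :
    KernelBound L' κ where
  bound w := (h.bound w).trans hL
  zero_of_lt := h.zero_of_lt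
  lip w w' := (h.lip w w').trans (by gcongr)

theorem exists_kernelBound {κ : E d × E d → ℝ} (hκ : ContDiff ℝ 1 κ)
    (h0 : ∀ w, 1 < ‖w‖ → κ w = 0) : ∃ L, 0 ≤ L ∧ KernelBound L κ := by
  have hs : HasCompactSupport κ :=
    HasCompactSupport.intro (isCompact_closedBall 0 1) fun w hw => h0 w (by simpa using hw)
  obtain ⟨C, hC⟩ := hκ.lipschitzWith_of_hasCompactSupport hs one_ne_zero
  obtain ⟨M, hM⟩ := hs.exists_bound_of_continuous hκ.continuous
  refine ⟨max C M, C.2.trans (le_max_left _ _), fun w => (hM w).trans (le_max_right _ _), h0,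
    fun w w' => ?_⟩
  rw [← Real.dist_eq, ← dist_eq_norm]
  refine (hC.dist_le_mul w w').trans ?_
  gcongr
  exact le_max_left _ _

/-- The difference is bounded both by 2L and by L‖θ‖, and it vanishes unless one of the two points
lies in the unit ball. -/
theorem KernelBound.abs_sub_le {L : ℝ} {κ : E d × E d → ℝ} (h : KernelBound L κ)
    (θ w : E d × E d) : |κ (w - θ) - κ w| ≤ 2 * L * min 1 ‖θ‖ *
      ((Metric.closedBall (0 : E d × E d) 1).indicator 1 w +
        (Metric.closedBall (0 : E d × E d) 1).indicator 1 (w - θ)) := by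
  have hL : 0 ≤ L := (abs_nonneg _).trans (h.bound 0)
  have h1 : |κ (w - θ) - κ w| ≤ 2 * L * min 1 ‖θ‖ := by
    rcases le_total 1 ‖θ‖ with hθ | hθ
    · rw [min_eq_left hθ]
      calc |κ (w - θ) - κ w| ≤ |κ (w - θ)| + |κ w| := abs_sub _ _
        _ ≤ 2 * L * 1 := by linarith [h.bound (w - θ), h.bound w]
    · rw [min_eq_right hθ]
      have := h.lip (w - θ) w
      rw [sub_sub_cancel_left, norm_neg] at this
      nlinarith [norm_nonneg θ]
  have h2 : 0 ≤ 2 * L * min 1 ‖θ‖ := by positivity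
  by_cases hw : w ∈ Metric.closedBall (0 : E d × E d) 1
  · rw [indicator_of_mem hw]
    refine h1.trans (le_mul_of_one_le_right h2 ?_)
    simp only [Pi.one_apply, le_add_iff_nonneg_right]
    exact indicator_nonneg (fun _ _ => zero_le_one) _
  · by_cases hw' : w - θ ∈ Metric.closedBall (0 : E d × E d) 1
    · rw [indicator_of_notMem hw, indicator_of_mem hw']
      simpa using h1
    · rw [h.zero_of_lt w (by simpa using hw), h.zero_of_lt (w - θ) (by simpa using hw')]
      simp [indicator_of_notMem hw, indicator_of_notMem hw']

/-- The common bound of the three kernels of the representation formula. -/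
structure IsKernelBound (W : E d × E d → ℝ) (L : ℝ) : Prop where
  pos : 0 < L
  flux : ∀ i, KernelBound L fun w => 2 * fderiv ℝ W w (0, EuclideanSpace.single i 1)
  drift : ∀ i, KernelBound L fun w => (4 * w.2 i - w.1 i / 2) * W w
  mass : KernelBound L fun w => 2 * W w

theorem IsKernel.exists_isKernelBound {W : E d × E d → ℝ} (hW : IsKernel W) :
    ∃ L, IsKernelBound W L := by
  have hW1 : ContDiff ℝ 1 W := hW.smooth.of_le (by exact_mod_cast le_top)
  have hW2 : ContDiff ℝ 1 (fderiv ℝ W) :=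
    hW.smooth.fderiv_right (m := 1) (WithTop.coe_le_coe.2 le_top)
  have h1 : ∀ i : Fin d, ∃ L, 0 ≤ L ∧
      KernelBound L fun w => 2 * fderiv ℝ W w (0, EuclideanSpace.single i 1) := fun i =>
    exists_kernelBound (contDiff_const.mul (hW2.clm_apply contDiff_const)) fun w hw => by
      simp [hW.fderiv_zero_of_lt w hw]
  have h2 : ∀ i : Fin d, ∃ L, 0 ≤ L ∧ KernelBound L fun w => (4 * w.2 i - w.1 i / 2) * W w :=
    fun i => exists_kernelBound (ContDiff.mul (by fun_prop) hW1) fun w hw => by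
      simp [hW.zero_of_lt w hw]
  obtain ⟨L3, hL3, h3⟩ := exists_kernelBound (κ := fun w => 2 * W w) (contDiff_const.mul hW1)
    fun w hw => by simp [hW.zero_of_lt w hw]
  choose L1 hL1 h1 using h1
  choose L2 hL2 h2 using h2
  have s1 : 0 ≤ ∑ i, L1 i := Finset.sum_nonneg fun i _ => hL1 i
  have s2 : 0 ≤ ∑ i, L2 i := Finset.sum_nonneg fun i _ => hL2 i
  refine ⟨∑ i, L1 i + ∑ i, L2 i + L3 + 1, by positivity, fun i => (h1 i).mono ?_,
    fun i => (h2 i).mono ?_, h3.mono (by linarith)⟩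
  · have := Finset.single_le_sum (fun i _ => hL1 i) (Finset.mem_univ i)
    linarith
  · have := Finset.single_le_sum (fun i _ => hL2 i) (Finset.mem_univ i)
    linarith

/-- Smooth compactly supported sub-solutions of `𝒯 g ≤ ∇_v · F + H`, living in a time window of
length one, for which `H` also dominates the flux `F` and the velocity gradient of `g`. -/
structure SmoothSub (t₀ : ℝ) (g : Z d → ℝ) (F : Fin d → Z d → ℝ) (H : Z d → ℝ) : Prop where
  smooth : ContDiff ℝ 1 g
  compact : HasCompactSupport g
  smooth_flux : ∀ i, ContDiff ℝ 1 (F i)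
  compact_flux : ∀ i, HasCompactSupport (F i)
  window : ∀ z, g z ≠ 0 → t₀ - 1 < z.1 ∧ z.1 ≤ t₀
  measurable : Measurable H
  nonneg : ∀ z, 0 ≤ H z
  flux_le : ∀ i z, |F i z| ≤ H z
  grad_le : ∀ i z, |dV i g z| ≤ H z
  sub : ∀ z, transport g z - ∑ i, dV i (F i) z ≤ H z

theorem ofReal_integral_le_lintegral {α : Type*} [MeasurableSpace α] {μ : Measure α} {f : α → ℝ}
    (hf : Integrable f μ) : ENNReal.ofReal (∫ x, f x ∂μ) ≤ ∫⁻ x, ENNReal.ofReal (f x) ∂μ := by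
  calc ENNReal.ofReal (∫ x, f x ∂μ) ≤ ENNReal.ofReal (∫ x, max (f x) 0 ∂μ) :=
        ENNReal.ofReal_le_ofReal (integral_mono hf hf.pos_part fun x => le_max_left _ _)
    _ = ∫⁻ x, ENNReal.ofReal (max (f x) 0) ∂μ :=
        ofReal_integral_eq_lintegral_ofReal hf.pos_part (Eventually.of_forall fun x =>
          le_max_right _ _)
    _ = ∫⁻ x, ENNReal.ofReal (f x) ∂μ := by simp [ENNReal.ofReal_max]

namespace SmoothSub

variable {t₀ : ℝ} {g H : Z d → ℝ} {F : Fin d → Z d → ℝ} {W : E d × E d → ℝ} {L : ℝ}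

theorem eq_zero_of_sub_one (h : SmoothSub t₀ g F H) {z z' : Z d} (hz : z.1 ≤ t₀)
    (hz' : z'.1 = z.1 - 1) : g z' = 0 := by
  by_contra hne
  have := (h.window z' hne).1
  linarith

theorem integrableOn_repIntegrand (h : SmoothSub t₀ g F H) (hW : IsKernel W) (z : Z d) :
    IntegrableOn (repIntegrand W g F z) (slab d) :=
  integrableOn_slab ((continuous_repIntegrand hW h.smooth h.smooth_flux).comp
    (continuous_const.prodMk continuous_id)) fun _ hζ => repIntegrand_eq_zero hW hζ

theorem repIntegrand_le (h : SmoothSub t₀ g F H) (hW : IsKernel W) (hL : IsKernelBound W L)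
    (z ζ : Z d) (hζ : ζ ∈ slab d) :
    repIntegrand W g F z ζ ≤ (2 * d + 1) * L * H (path z ζ) := by
  have hτ : 0 < ζ.1 ∧ ζ.1 < 1 := hζ.1
  have hL0 := hL.pos
  have hH := h.nonneg (path z ζ)
  have h1 : ∀ i, F i (path z ζ) * (2 * fderiv ℝ W ζ.2 (0, EuclideanSpace.single i 1)) ≤
      L * H (path z ζ) := fun i => by
    refine (le_abs_self _).trans ?_
    rw [abs_mul, mul_comm]
    exact mul_le_mul ((hL.flux i).bound ζ.2) (h.flux_le i _) (abs_nonneg _) hL0.le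
  have h2 : ∀ i, dV i g (path z ζ) * ((4 * ζ.2.2 i - ζ.2.1 i / 2) * W ζ.2) ≤
      L * H (path z ζ) := fun i => by
    refine (le_abs_self _).trans ?_
    rw [abs_mul, mul_comm]
    exact mul_le_mul ((hL.drift i).bound ζ.2) (h.grad_le i _) (abs_nonneg _) hL0.le
  -- The defect has an upper bound only. This suffices because its weight 2τW is nonnegative and at
  -- most L.
  have h3 : (transport g (path z ζ) - ∑ i, dV i (F i) (path z ζ)) * (2 * ζ.1 * W ζ.2) ≤
      L * H (path z ζ) := by
    have hW0 := hW.nonneg ζ.2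
    have h4 := (le_abs_self _).trans (hL.mass.bound ζ.2)
    have h5 : 2 * ζ.1 * W ζ.2 ≤ L := by nlinarith
    have h6 : 0 ≤ 2 * ζ.1 * W ζ.2 := by have := hτ.1; positivity
    calc _ ≤ H (path z ζ) * (2 * ζ.1 * W ζ.2) := mul_le_mul_of_nonneg_right (h.sub _) h6
      _ ≤ H (path z ζ) * L := mul_le_mul_of_nonneg_left h5 hH
      _ = _ := mul_comm _ _
  calc repIntegrand W g F z ζ ≤ ∑ _i : Fin d, L * H (path z ζ) + ∑ _i : Fin d, L * H (path z ζ) +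
        L * H (path z ζ) :=
        add_le_add (add_le_add (Finset.sum_le_sum fun i _ => h1 i)
          (Finset.sum_le_sum fun i _ => h2 i)) h3
    _ = _ := by simp; ring

/-- Up to time t₀ the window condition makes g vanish one unit of time earlier, as the
representation formula requires; after t₀ there is nothing to prove. Only parameters in `block`
contribute, since the kernels vanish outside the unit ball. -/
theorem ofReal_le_pathAvg (h : SmoothSub t₀ g F H) (hW : IsKernel W) (hL : IsKernelBound W L)
    (z : Z d) : ENNReal.ofReal (g z) ≤ ENNReal.ofReal ((2 * d + 1) * L) *
      pathAvg (fun z => ENNReal.ofReal (H z)) z := by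
  rcases lt_or_ge t₀ z.1 with hz | hz
  · have : g z = 0 := by
      by_contra hne
      exact (h.window z hne).2.not_gt hz
    simp [this]
  have hL0 := hL.pos
  have hpm : Measurable fun ζ : Z d => ENNReal.ofReal (H (path z ζ)) :=
    (h.measurable.comp (contDiff_path z).continuous.measurable).ennreal_ofReal
  rw [representation hW h.smooth h.smooth_flux z fun z' hz' => h.eq_zero_of_sub_one hz hz']
  refine (ofReal_integral_le_lintegral (h.integrableOn_repIntegrand hW z)).trans ?_
  rw [pathAvg, ← lintegral_const_mul _ hpm, ← lintegral_indicator measurableSet_slab,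
    ← lintegral_indicator measurableSet_block]
  refine lintegral_mono fun ζ => ?_
  by_cases hζ : ζ ∈ slab d
  · rw [indicator_of_mem hζ]
    by_cases hζ2 : ζ ∈ block d
    · rw [indicator_of_mem hζ2, ← ENNReal.ofReal_mul (by positivity)]
      exact ENNReal.ofReal_le_ofReal (h.repIntegrand_le hW hL z ζ hζ)
    · have h1 : 1 < ‖ζ.2‖ := by
        by_contra! h1
        exact hζ2 ⟨hζ.1, by simpa using h1⟩
      simp [repIntegrand_eq_zero hW h1]
  · simp [indicator_of_notMem hζ]

end SmoothSub

/-- Gain of integrability for smooth sub-solutions. -/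
theorem exists_smooth_integrability_bound (hd : 0 < d) : ∃ C : ℝ, 0 < C ∧ ∀ (t₀ : ℝ)
    (g H : Z d → ℝ) (F : Fin d → Z d → ℝ), SmoothSub t₀ g F H → ∀ p : ℝ, 2 ≤ p →
      p < 2 + 1 / (d : ℝ) →
      (∫⁻ z, ENNReal.ofReal (g z) ^ p) ^ (1 / p) ≤
        ENNReal.ofReal (C * (2 + 1 / (d : ℝ) - p)⁻¹) *
          (∫⁻ z, ENNReal.ofReal (H z) ^ (2 : ℝ)) ^ (1 / 2 : ℝ) := by
  obtain ⟨W, hW⟩ := exists_isKernel d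
  obtain ⟨L, hL⟩ := hW.exists_isKernelBound
  obtain ⟨C, hC, hY⟩ := exists_pathAvg_bound hd
  have hL0 := hL.pos
  refine ⟨(2 * d + 1) * L * C, by positivity, fun t₀ g H F h p hp hp2 => ?_⟩
  have hp0 : 0 < p := by linarith
  have hHm := h.measurable.ennreal_ofReal
  calc (∫⁻ z, ENNReal.ofReal (g z) ^ p) ^ (1 / p)
      ≤ (∫⁻ z, (ENNReal.ofReal ((2 * d + 1) * L) *
          pathAvg (fun z => ENNReal.ofReal (H z)) z) ^ p) ^ (1 / p) := by
        gcongr with z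
        exact h.ofReal_le_pathAvg hW hL z
    _ = ENNReal.ofReal ((2 * d + 1) * L) *
          (∫⁻ z, pathAvg (fun z => ENNReal.ofReal (H z)) z ^ p) ^ (1 / p) := by
        simp_rw [ENNReal.mul_rpow_of_nonneg _ _ hp0.le]
        rw [lintegral_const_mul _ ((measurable_pathAvg hHm).pow_const p),
          ENNReal.mul_rpow_of_nonneg _ _ (by positivity), ← ENNReal.rpow_mul,
          mul_one_div_cancel hp0.ne', ENNReal.rpow_one]
    _ ≤ ENNReal.ofReal ((2 * d + 1) * L) * (ENNReal.ofReal (C * (2 + 1 / (d : ℝ) - p)⁻¹) *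
          (∫⁻ z, ENNReal.ofReal (H z) ^ (2 : ℝ)) ^ (1 / 2 : ℝ)) := by
        gcongr
        exact hY _ hHm p hp hp2
    _ = _ := by
        rw [← mul_assoc, ← ENNReal.ofReal_mul (by positivity), mul_assoc ((2 * d + 1) * L)]

/-! ### Smooth sub-solutions: increments in position. -/

theorem lintegral_min_le {a : ℝ} (ha : 0 ≤ a) :
    ∫⁻ τ in Ioo (0 : ℝ) 1, ENNReal.ofReal (min 1 ((τ ^ 3)⁻¹ * a ^ 3)) ≤
      ENNReal.ofReal (3 / 2 * a) := by
  rcases ha.eq_or_lt with rfl | ha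
  · simp
  -- The integral is split at τ = a: the bound 1 contributes a below, and the tail of a³τ⁻³
  -- contributes a/2 above.
  have h1 : ∫⁻ τ in Ioc (0 : ℝ) a, ENNReal.ofReal (min 1 ((τ ^ 3)⁻¹ * a ^ 3)) ≤
      ENNReal.ofReal a := by
    calc _ ≤ ∫⁻ τ in Ioc (0 : ℝ) a, 1 := by
          refine lintegral_mono fun τ => ?_
          exact ENNReal.ofReal_le_one.2 (min_le_left _ _)
      _ = _ := by simp
  have h2 : ∫⁻ τ in Ioi a, ENNReal.ofReal (min 1 ((τ ^ 3)⁻¹ * a ^ 3)) ≤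
      ENNReal.ofReal (a / 2) := by
    have hi : IntegrableOn (fun τ : ℝ => a ^ 3 * τ ^ (-3 : ℝ)) (Ioi a) :=
      (integrableOn_Ioi_rpow_of_lt (by norm_num) ha).const_mul _
    calc _ ≤ ∫⁻ τ in Ioi a, ENNReal.ofReal (a ^ 3 * τ ^ (-3 : ℝ)) := by
          refine setLIntegral_mono' measurableSet_Ioi fun τ hτ => ENNReal.ofReal_le_ofReal ?_
          have hτ0 : 0 < τ := ha.trans hτ
          rw [Real.rpow_neg hτ0.le, mul_comm]
          exact (min_le_right _ _).trans_eq (by norm_cast)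
      _ = ENNReal.ofReal (∫ τ in Ioi a, a ^ 3 * τ ^ (-3 : ℝ)) := by
          rw [ofReal_integral_eq_lintegral_ofReal hi]
          exact (ae_restrict_mem measurableSet_Ioi).mono fun τ hτ =>
            mul_nonneg (by positivity) (Real.rpow_nonneg (ha.trans hτ).le _)
      _ = ENNReal.ofReal (a / 2) := by
          rw [integral_const_mul, integral_Ioi_rpow_of_lt (by norm_num) ha]
          congr 1
          have : a ^ (-3 + 1 : ℝ) = (a ^ 2)⁻¹ := by
            rw [← Real.rpow_natCast, ← Real.rpow_neg ha.le]
            norm_num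
          rw [this]
          field_simp
          norm_num
  calc _ ≤ ∫⁻ τ in Ioc (0 : ℝ) a ∪ Ioi a, ENNReal.ofReal (min 1 ((τ ^ 3)⁻¹ * a ^ 3)) := by
        refine lintegral_mono_set fun τ hτ => ?_
        rw [Ioc_union_Ioi_eq_Ioi ha.le]
        exact hτ.1
    _ ≤ ENNReal.ofReal a + ENNReal.ofReal (a / 2) :=
        (lintegral_union_le _ _ _).trans (add_le_add h1 h2)
    _ = _ := by
        rw [← ENNReal.ofReal_add (by positivity) (by positivity)]
        congr 1
        ring

/-- Translation in the position variable. -/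
def shiftX (k : E d) (z : Z d) : Z d := (z.1, z.2.1 + k, z.2.2)

/-- The change of parameters that compensates a translation in position. -/
def shiftParam (k : E d) (τ : ℝ) : E d × E d := ((τ ^ 3)⁻¹ • k, -((3 / 2 : ℝ) • (τ ^ 3)⁻¹ • k))

theorem measurable_shiftParam (k : E d) : Measurable (shiftParam k) := by
  unfold shiftParam
  fun_prop

/-- Lowering p by τ⁻³k absorbs the translation of the position, and raising y by (3/2)τ⁻³k leaves
(3/2)p + y, hence the velocity, unchanged. -/
theorem path_shiftX (k : E d) (z : Z d) {τ : ℝ} (hτ : τ ≠ 0) (w : E d × E d) :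
    path (shiftX k z) (τ, w - shiftParam k τ) = path z (τ, w) := by
  ext j
  · simp [path, shiftX]
  · simp [path, shiftX, shiftParam]
    field_simp
    ring
  · simp [path, shiftX, shiftParam]
    ring

theorem norm_shiftParam_le (k : E d) {τ : ℝ} (hτ : 0 < τ) :
    ‖shiftParam k τ‖ ≤ 3 / 2 * ((τ ^ 3)⁻¹ * ‖k‖) := by
  have h : 0 ≤ (τ ^ 3)⁻¹ := by positivity
  have hk := mul_nonneg h (norm_nonneg k)
  simp only [shiftParam, Prod.norm_def, norm_neg, norm_smul, Real.norm_eq_abs, abs_of_nonneg h]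
  rw [abs_of_pos (by norm_num)]
  exact max_le (by linarith) le_rfl

/-- Since |m| = 2m⁺ - m and m has zero integral, only m⁺ contributes, and m⁺ is at most the positive
part of H. -/
theorem lintegral_abs_le_of_integral_eq_zero {α : Type*} [MeasurableSpace α] {μ : Measure α}
    {m H : α → ℝ} (hm : Integrable m μ) (h0 : ∫ x, m x ∂μ = 0) (hle : ∀ x, m x ≤ H x) :
    ∫⁻ x, ENNReal.ofReal |m x| ∂μ ≤ 2 * ∫⁻ x, ENNReal.ofReal (H x) ∂μ := by
  have e : ∀ x, |m x| = 2 * max (m x) 0 - m x := fun x => by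
    rcases le_total (m x) 0 with h | h
    · rw [abs_of_nonpos h, max_eq_right h]; ring
    · rw [abs_of_nonneg h, max_eq_left h]; ring
  calc ∫⁻ x, ENNReal.ofReal |m x| ∂μ = ENNReal.ofReal (∫ x, |m x| ∂μ) :=
        (ofReal_integral_eq_lintegral_ofReal hm.abs (Eventually.of_forall fun x =>
          abs_nonneg _)).symm
    _ = ENNReal.ofReal (2 * ∫ x, max (m x) 0 ∂μ) := by
        simp_rw [e]
        rw [integral_sub (hm.pos_part.const_mul 2) hm, h0, sub_zero, integral_const_mul]
    _ = 2 * ENNReal.ofReal (∫ x, max (m x) 0 ∂μ) := by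
        rw [ENNReal.ofReal_mul two_pos.le]
        simp
    _ = 2 * ∫⁻ x, ENNReal.ofReal (max (m x) 0) ∂μ := by
        rw [ofReal_integral_eq_lintegral_ofReal hm.pos_part (Eventually.of_forall fun x =>
          le_max_right _ _)]
    _ ≤ _ := by
        refine mul_le_mul' le_rfl (lintegral_mono fun x => ?_)
        rw [ENNReal.ofReal_max, ENNReal.ofReal_zero]
        exact max_le (ENNReal.ofReal_le_ofReal (hle x)) zero_le

namespace SmoothSub

variable {t₀ : ℝ} {g H : Z d → ℝ} {F : Fin d → Z d → ℝ} {W : E d × E d → ℝ} {L : ℝ}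

/-- The sum of the absolute values of the fields in the representation formula. -/
def total (g : Z d → ℝ) (F : Fin d → Z d → ℝ) (z : Z d) : ℝ :=
  ∑ i, |F i z| + ∑ i, |dV i g z| + |transport g z - ∑ i, dV i (F i) z|

theorem continuous_defect (h : SmoothSub t₀ g F H) :
    Continuous fun z => transport g z - ∑ i, dV i (F i) z :=
  (continuous_transport h.smooth).sub
    (continuous_finsetSum _ fun i _ => continuous_dV (h.smooth_flux i) i)

theorem continuous_total (h : SmoothSub t₀ g F H) : Continuous (total g F) :=
  ((continuous_finsetSum _ fun i _ => (h.smooth_flux i).continuous.abs).add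
    (continuous_finsetSum _ fun i _ => (continuous_dV h.smooth i).abs)).add h.continuous_defect.abs

/-- The defect 𝒯g - ∇_v·F has no lower bound, but it is a divergence of compactly supported fields.
Its integral vanishes, and its negative part has the same mass as its positive part. -/
theorem lintegral_total_le (h : SmoothSub t₀ g F H) :
    ∫⁻ z, ENNReal.ofReal (total g F z) ≤
      ENNReal.ofReal (2 * d + 2) * ∫⁻ z, ENNReal.ofReal (H z) := by
  have hT : Integrable (transport g) := (continuous_transport h.smooth).integrable_of_hasCompactSupport
    h.compact.transport
  have hD : ∀ i, Integrable (dV i (F i)) := fun i =>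
    (continuous_dV (h.smooth_flux i) i).integrable_of_hasCompactSupport ((h.compact_flux i).dV i)
  have hm : Integrable fun z => transport g z - ∑ i, dV i (F i) z :=
    hT.sub (integrable_finsetSum _ fun i _ => hD i)
  have h0 : ∫ z, (transport g z - ∑ i, dV i (F i) z) = 0 := by
    rw [integral_sub hT (integrable_finsetSum _ fun i _ => hD i),
      integral_transport_eq_zero h.smooth h.compact, integral_finsetSum _ fun i _ => hD i]
    simp [integral_dV_eq_zero (h.smooth_flux _) (h.compact_flux _)]
  have h1 := lintegral_abs_le_of_integral_eq_zero hm h0 h.sub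
  have hle : ∀ z, total g F z ≤ 2 * d * H z + |transport g z - ∑ i, dV i (F i) z| := fun z => by
    have a1 : ∑ i, |F i z| ≤ ∑ _i : Fin d, H z := Finset.sum_le_sum fun i _ => h.flux_le i z
    have a2 : ∑ i, |dV i g z| ≤ ∑ _i : Fin d, H z := Finset.sum_le_sum fun i _ => h.grad_le i z
    simp only [Finset.sum_const, Finset.card_univ, Fintype.card_fin, nsmul_eq_mul] at a1 a2
    simp only [total]
    linarith
  calc ∫⁻ z, ENNReal.ofReal (total g F z)
      ≤ ∫⁻ z, (ENNReal.ofReal (2 * d) * ENNReal.ofReal (H z) +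
        ENNReal.ofReal |transport g z - ∑ i, dV i (F i) z|) := by
        refine lintegral_mono fun z => (ENNReal.ofReal_le_ofReal (hle z)).trans ?_
        rw [← ENNReal.ofReal_mul (by positivity)]
        exact ENNReal.ofReal_add_le
    _ = ENNReal.ofReal (2 * d) * (∫⁻ z, ENNReal.ofReal (H z)) +
        ∫⁻ z, ENNReal.ofReal |transport g z - ∑ i, dV i (F i) z| := by
        rw [lintegral_add_left (h.measurable.ennreal_ofReal.const_mul _),
          lintegral_const_mul _ h.measurable.ennreal_ofReal]
    _ ≤ ENNReal.ofReal (2 * d) * (∫⁻ z, ENNReal.ofReal (H z)) +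
        2 * ∫⁻ z, ENNReal.ofReal (H z) := by gcongr
    _ = _ := by
        rw [← add_mul, ENNReal.ofReal_add (by positivity) (by positivity)]
        simp

/-- After the change of parameters both integrands are evaluated at the same path point. The fields
therefore coincide, and only the kernels vary. -/
theorem abs_repIntegrand_sub_le (hL : IsKernelBound W L) (k : E d) (z : Z d)
    {τ : ℝ} (hτ : τ ∈ Ioo (0 : ℝ) 1) (w : E d × E d) :
    |repIntegrand W g F (shiftX k z) (τ, w - shiftParam k τ) - repIntegrand W g F z (τ, w)| ≤
      total g F (path z (τ, w)) * (2 * L * min 1 ‖shiftParam k τ‖ *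
      ((Metric.closedBall (0 : E d × E d) 1).indicator 1 w +
        (Metric.closedBall (0 : E d × E d) 1).indicator 1 (w - shiftParam k τ))) := by
  set θ := shiftParam k τ
  set Δ := 2 * L * min 1 ‖θ‖ *
      ((Metric.closedBall (0 : E d × E d) 1).indicator 1 w +
        (Metric.closedBall (0 : E d × E d) 1).indicator 1 (w - θ)) with hΔ
  have hL0 := hL.pos
  have hΔ0 : 0 ≤ Δ := (abs_nonneg _).trans (hL.mass.abs_sub_le θ w)
  simp only [repIntegrand, path_shiftX k z hτ.1.ne', θ, total]
  set q := path z (τ, w)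
  set m := transport g q - ∑ i, dV i (F i) q
  have e : ∀ a b c a' b' c' : ℝ, a + b + c - (a' + b' + c') = (a - a') + (b - b') + (c - c') := by
    intros; ring
  rw [e, ← Finset.sum_sub_distrib, ← Finset.sum_sub_distrib, add_mul, add_mul, Finset.sum_mul,
    Finset.sum_mul]
  refine (abs_add_le _ _).trans (add_le_add ((abs_add_le _ _).trans (add_le_add
    ((Finset.abs_sum_le_sum_abs _ _).trans (Finset.sum_le_sum fun i _ => ?_))
    ((Finset.abs_sum_le_sum_abs _ _).trans (Finset.sum_le_sum fun i _ => ?_)))) ?_)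
  · rw [← mul_sub, abs_mul]
    exact mul_le_mul_of_nonneg_left ((hL.flux i).abs_sub_le θ w) (abs_nonneg _)
  · rw [← mul_sub, abs_mul]
    exact mul_le_mul_of_nonneg_left ((hL.drift i).abs_sub_le θ w) (abs_nonneg _)
  · rw [← mul_sub, abs_mul]
    refine mul_le_mul_of_nonneg_left ?_ (abs_nonneg _)
    have h1 := hL.mass.abs_sub_le θ w
    have h2 : 2 * τ * W (w - θ) - 2 * τ * W w = τ * (2 * W (w - θ) - 2 * W w) := by ring
    rw [h2, abs_mul, abs_of_pos hτ.1]
    calc τ * |2 * W (w - θ) - 2 * W w| ≤ 1 * |2 * W (w - θ) - 2 * W w| := by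
          gcongr
          exact hτ.2.le
      _ ≤ Δ := by rw [one_mul]; exact h1

end SmoothSub

namespace SmoothSub

variable {t₀ : ℝ} {g H : Z d → ℝ} {F : Fin d → Z d → ℝ} {W : E d × E d → ℝ} {L : ℝ}

/-- The change of parameters depends on τ; it is made at fixed τ, by translation invariance in w,
which is why the integral is kept iterated. -/
theorem shiftX_sub_eq (h : SmoothSub t₀ g F H) (hW : IsKernel W) (k : E d) {z : Z d}
    (hz : z.1 ≤ t₀) : g (shiftX k z) - g z = ∫ τ in Ioo (0 : ℝ) 1, ∫ w,
      (repIntegrand W g F (shiftX k z) (τ, w - shiftParam k τ) - repIntegrand W g F z (τ, w)) := by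
  have hvol : (volume : Measure (Z d)) = (volume : Measure ℝ).prod volume := rfl
  have hi : ∀ z : Z d, ∀ τ : ℝ, Integrable fun w => repIntegrand W g F z (τ, w) := by
    intro z τ
    refine Continuous.integrable_of_hasCompactSupport
      ((continuous_repIntegrand hW h.smooth h.smooth_flux).comp (continuous_const.prodMk
        (continuous_const.prodMk continuous_id))) ?_
    exact HasCompactSupport.intro (isCompact_closedBall 0 1) fun w hw =>
      repIntegrand_eq_zero hW (by simpa using hw)
  have hr : ∀ z : Z d, z.1 ≤ t₀ → g z = ∫ τ in Ioo (0 : ℝ) 1, ∫ w, repIntegrand W g F z (τ, w) := by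
    intro z hz
    have hQ := h.integrableOn_repIntegrand hW z
    rw [representation hW h.smooth h.smooth_flux z fun z' hz' => h.eq_zero_of_sub_one hz hz']
    rw [slab, hvol] at hQ ⊢
    rw [setIntegral_prod _ hQ]
    simp only [Measure.restrict_univ]
  have hri : ∀ z : Z d, Integrable (fun τ : ℝ => ∫ w, repIntegrand W g F z (τ, w))
      (volume.restrict (Ioo (0 : ℝ) 1)) := by
    intro z
    have hQ := h.integrableOn_repIntegrand hW z
    rw [slab, hvol, IntegrableOn, ← Measure.prod_restrict, Measure.restrict_univ] at hQ
    exact hQ.integral_prod_left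
  have hs : ∀ τ : ℝ, ∫ w, repIntegrand W g F (shiftX k z) (τ, w - shiftParam k τ) =
      ∫ w, repIntegrand W g F (shiftX k z) (τ, w) := fun τ =>
    integral_sub_right_eq_self (fun w => repIntegrand W g F (shiftX k z) (τ, w)) (shiftParam k τ)
  simp_rw [fun τ : ℝ => integral_sub ((hi (shiftX k z) τ).comp_sub_right (shiftParam k τ)) (hi z τ), hs]
  rw [integral_sub (hri _) (hri _), ← hr z hz, ← hr (shiftX k z) hz]

/-- The size of the variation of the kernels under the change of parameters `shiftParam`. -/
def shiftWeight (k : E d) (ζ : Z d) : ℝ≥0∞ :=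
  ENNReal.ofReal (min 1 ‖shiftParam k ζ.1‖) *
    ((Metric.closedBall (0 : E d × E d) 1).indicator 1 ζ.2 +
      (Metric.closedBall (0 : E d × E d) 1).indicator 1 (ζ.2 - shiftParam k ζ.1))

theorem measurable_shiftWeight (k : E d) : Measurable (shiftWeight k) := by
  have h1 : Measurable fun ζ : Z d => shiftParam k ζ.1 :=
    (measurable_shiftParam k).comp measurable_fst
  have h2 : Measurable ((Metric.closedBall (0 : E d × E d) 1).indicator (1 : E d × E d → ℝ≥0∞)) :=
    measurable_one.indicator Metric.isClosed_closedBall.measurableSet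
  exact (measurable_const.min h1.norm).ennreal_ofReal.mul
    ((h2.comp measurable_snd).add (h2.comp (measurable_snd.sub h1)))

/-- At fixed τ the two indicators have total mass twice the volume of the unit ball. What is left is
the integral of min(1, |k|/τ³) in τ, and this is the origin of the exponent 1/3. -/
theorem lintegral_shiftWeight_le (k : E d) :
    ∫⁻ ζ in slab d, shiftWeight k ζ ≤
      ENNReal.ofReal (9 / 2 * volume.real (Metric.closedBall (0 : E d × E d) 1) *
        ‖k‖ ^ (1 / 3 : ℝ)) := by
  have hvol : (volume : Measure (Z d)) = (volume : Measure ℝ).prod volume := rfl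
  set b := volume.real (Metric.closedBall (0 : E d × E d) 1) with hb
  have hb0 : 0 ≤ b := measureReal_nonneg
  have h2 : Measurable ((Metric.closedBall (0 : E d × E d) 1).indicator (1 : E d × E d → ℝ≥0∞)) :=
    measurable_one.indicator Metric.isClosed_closedBall.measurableSet
  have hB : ∫⁻ w, (Metric.closedBall (0 : E d × E d) 1).indicator (1 : E d × E d → ℝ≥0∞) w =
      ENNReal.ofReal b := by
    rw [lintegral_indicator_one Metric.isClosed_closedBall.measurableSet, hb,
      ofReal_measureReal (isCompact_closedBall _ _).measure_lt_top.ne]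
  have inner : ∀ τ : ℝ, ∫⁻ w, shiftWeight k (τ, w) =
      ENNReal.ofReal (min 1 ‖shiftParam k τ‖) * ENNReal.ofReal (2 * b) := by
    intro τ
    have h3 : Measurable fun w : E d × E d => (Metric.closedBall (0 : E d × E d) 1).indicator
        (1 : E d × E d → ℝ≥0∞) w + (Metric.closedBall (0 : E d × E d) 1).indicator
        (1 : E d × E d → ℝ≥0∞) (w - shiftParam k τ) :=
      h2.add (h2.comp (measurable_id.sub_const _))
    simp only [shiftWeight]
    rw [lintegral_const_mul _ h3, lintegral_add_left h2,
      lintegral_sub_right_eq_self ((Metric.closedBall (0 : E d × E d) 1).indicator 1), hB,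
      ← ENNReal.ofReal_add hb0 hb0, two_mul]
  -- With this a the ratio ‖k‖/τ³ becomes (a/τ)³, as in `lintegral_min_le`.
  set a := ‖k‖ ^ (1 / 3 : ℝ) with ha
  have ha0 : 0 ≤ a := by positivity
  have ha3 : a ^ 3 = ‖k‖ := by
    rw [ha, ← Real.rpow_natCast, ← Real.rpow_mul (norm_nonneg k)]
    norm_num
  rw [slab, hvol, ← Measure.prod_restrict, Measure.restrict_univ,
    lintegral_prod _ (measurable_shiftWeight k).aemeasurable]
  calc ∫⁻ τ in Ioo (0 : ℝ) 1, ∫⁻ w, shiftWeight k (τ, w)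
      = ∫⁻ τ in Ioo (0 : ℝ) 1, ENNReal.ofReal (min 1 ‖shiftParam k τ‖) *
          ENNReal.ofReal (2 * b) := by simp_rw [inner]
    _ ≤ ∫⁻ τ in Ioo (0 : ℝ) 1, ENNReal.ofReal (min 1 ((τ ^ 3)⁻¹ * a ^ 3)) *
          ENNReal.ofReal (3 * b) := by
        refine setLIntegral_mono' measurableSet_Ioo fun τ hτ => ?_
        rw [← ENNReal.ofReal_mul (by positivity), ← ENNReal.ofReal_mul (by
          have := hτ.1; positivity), ha3]
        refine ENNReal.ofReal_le_ofReal ?_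
        have h3 := norm_shiftParam_le k hτ.1
        have h4 : 0 ≤ (τ ^ 3)⁻¹ * ‖k‖ := by have := hτ.1; positivity
        have h5 : min 1 ‖shiftParam k τ‖ ≤ 3 / 2 * min 1 ((τ ^ 3)⁻¹ * ‖k‖) := by
          rcases le_total 1 ((τ ^ 3)⁻¹ * ‖k‖) with h6 | h6
          · rw [min_eq_left h6]
            exact (min_le_left _ _).trans (by norm_num)
          · rw [min_eq_right h6]
            exact (min_le_right _ _).trans h3
        nlinarith
    _ = (∫⁻ τ in Ioo (0 : ℝ) 1, ENNReal.ofReal (min 1 ((τ ^ 3)⁻¹ * a ^ 3))) *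
          ENNReal.ofReal (3 * b) := lintegral_mul_const _ (by fun_prop)
    _ ≤ ENNReal.ofReal (3 / 2 * a) * ENNReal.ofReal (3 * b) := by
        gcongr
        exact lintegral_min_le ha0
    _ = _ := by
        rw [← ENNReal.ofReal_mul (by positivity)]
        congr 1
        ring

theorem enorm_shiftX_sub_le (h : SmoothSub t₀ g F H) (hW : IsKernel W) (hL : IsKernelBound W L)
    (k : E d) (z : Z d) : ‖g (shiftX k z) - g z‖ₑ ≤ ENNReal.ofReal (2 * L) *
      ∫⁻ ζ in slab d, ENNReal.ofReal (total g F (path z ζ)) * shiftWeight k ζ := by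
  rcases lt_or_ge t₀ z.1 with hz | hz
  · have h0 : ∀ z' : Z d, z'.1 = z.1 → g z' = 0 := fun z' hz' => by
      by_contra hne
      exact (h.window z' hne).2.not_gt (hz' ▸ hz)
    rw [h0 z rfl, h0 (shiftX k z) rfl]
    simp
  have hvol : (volume : Measure (Z d)) = (volume : Measure ℝ).prod volume := rfl
  have hL0 := hL.pos
  have hm : Measurable fun ζ => ENNReal.ofReal (total g F (path z ζ)) * shiftWeight k ζ :=
    (h.continuous_total.measurable.comp (contDiff_path z).continuous.measurable).ennreal_ofReal.mul
      (measurable_shiftWeight k)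
  rw [h.shiftX_sub_eq hW k hz, slab, hvol, ← Measure.prod_restrict, Measure.restrict_univ,
    lintegral_prod _ hm.aemeasurable, ← lintegral_const_mul _ hm.lintegral_prod_right']
  refine (enorm_integral_le_lintegral_enorm _).trans
    (setLIntegral_mono' measurableSet_Ioo fun τ hτ => ?_)
  refine (enorm_integral_le_lintegral_enorm _).trans ?_
  have hm2 : Measurable fun w => ENNReal.ofReal (total g F (path z (τ, w))) * shiftWeight k (τ, w) :=
    hm.comp measurable_prodMk_left
  rw [← lintegral_const_mul _ hm2]
  refine lintegral_mono fun w => ?_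
  rw [Real.enorm_eq_ofReal_abs]
  refine (ENNReal.ofReal_le_ofReal (abs_repIntegrand_sub_le hL k z hτ w)).trans_eq ?_
  have hT : 0 ≤ total g F (path z (τ, w)) := by
    unfold total
    positivity
  have hc : ∀ w : E d × E d, ENNReal.ofReal
      ((Metric.closedBall (0 : E d × E d) 1).indicator (1 : E d × E d → ℝ) w) =
      (Metric.closedBall (0 : E d × E d) 1).indicator (1 : E d × E d → ℝ≥0∞) w := fun w => by
    by_cases hw : w ∈ Metric.closedBall (0 : E d × E d) 1 <;> simp [hw]
  have hi : ∀ w : E d × E d, 0 ≤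
      (Metric.closedBall (0 : E d × E d) 1).indicator (1 : E d × E d → ℝ) w :=
    indicator_nonneg fun _ _ => zero_le_one
  simp only [shiftWeight]
  rw [ENNReal.ofReal_mul hT, ENNReal.ofReal_mul (by positivity), ENNReal.ofReal_mul (by positivity),
    ENNReal.ofReal_add (hi _) (hi _), hc, hc]
  ring

/-- The weight depends on ζ alone and z ↦ `path z ζ` preserves the measure, so the double integral
splits into the L¹ norm of the fields times the mass of the weight. -/
theorem lintegral_shiftX_sub_le (h : SmoothSub t₀ g F H) (hW : IsKernel W)
    (hL : IsKernelBound W L) (k : E d) :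
    ∫⁻ z, ‖g (shiftX k z) - g z‖ₑ ≤ ENNReal.ofReal (2 * L) *
      ((ENNReal.ofReal (2 * d + 2) * ∫⁻ z, ENNReal.ofReal (H z)) *
      ENNReal.ofReal (9 / 2 * volume.real (Metric.closedBall (0 : E d × E d) 1) *
        ‖k‖ ^ (1 / 3 : ℝ))) := by
  have ht : Measurable fun z => ENNReal.ofReal (total g F z) :=
    h.continuous_total.measurable.ennreal_ofReal
  have hm : Measurable fun q : Z d × Z d =>
      ENNReal.ofReal (total g F (path q.1 q.2)) * shiftWeight k q.2 :=
    (ht.comp continuous_path.measurable).mul ((measurable_shiftWeight k).comp measurable_snd)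
  calc ∫⁻ z, ‖g (shiftX k z) - g z‖ₑ
      ≤ ∫⁻ z, ENNReal.ofReal (2 * L) *
        ∫⁻ ζ in slab d, ENNReal.ofReal (total g F (path z ζ)) * shiftWeight k ζ :=
        lintegral_mono fun z => h.enorm_shiftX_sub_le hW hL k z
    _ = ENNReal.ofReal (2 * L) *
        ∫⁻ z, ∫⁻ ζ in slab d, ENNReal.ofReal (total g F (path z ζ)) * shiftWeight k ζ :=
        lintegral_const_mul _ hm.lintegral_prod_right'
    _ = ENNReal.ofReal (2 * L) * ∫⁻ ζ in slab d,
        (∫⁻ z, ENNReal.ofReal (total g F z)) * shiftWeight k ζ := by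
        rw [lintegral_lintegral_swap hm.aemeasurable]
        congr 1
        refine lintegral_congr fun ζ => ?_
        have h5 : Measurable fun z => ENNReal.ofReal (total g F (path z ζ)) :=
          ht.comp (measurePreserving_path ζ).measurable
        rw [lintegral_mul_const _ h5]
        congr 1
        exact (measurePreserving_path ζ).lintegral_comp ht
    _ ≤ _ := by
        rw [lintegral_const_mul _ (measurable_shiftWeight k)]
        gcongr
        · exact h.lintegral_total_le
        · exact lintegral_shiftWeight_le k

end SmoothSub

/-- Fractional regularity in position for smooth sub-solutions, in terms of `L¹` increments. -/
theorem exists_smooth_increment_bound (d : ℕ) : ∃ C : ℝ, 0 < C ∧ ∀ (t₀ : ℝ)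
    (g H : Z d → ℝ) (F : Fin d → Z d → ℝ), SmoothSub t₀ g F H → ∀ k : E d,
      ∫⁻ z, ‖g (shiftX k z) - g z‖ₑ ≤ ENNReal.ofReal (C * ‖k‖ ^ (1 / 3 : ℝ)) *
        ∫⁻ z, ENNReal.ofReal (H z) := by
  obtain ⟨W, hW⟩ := exists_isKernel d
  obtain ⟨L, hL⟩ := hW.exists_isKernelBound
  have hL0 := hL.pos
  set b := volume.real (Metric.closedBall (0 : E d × E d) 1) with hb
  have hb0 : 0 ≤ b := measureReal_nonneg
  refine ⟨2 * L * (2 * d + 2) * (9 / 2 * (b + 1)), by positivity, fun t₀ g H F h k => ?_⟩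
  refine (h.lintegral_shiftX_sub_le hW hL k).trans ?_
  have e : ∀ A B C D : ℝ≥0∞, A * (B * C * D) = A * B * D * C := by
    intros; ring
  rw [e, ← ENNReal.ofReal_mul (by positivity), ← ENNReal.ofReal_mul (by positivity)]
  gcongr ?_ * _
  refine ENNReal.ofReal_le_ofReal ?_
  have : 0 ≤ ‖k‖ ^ (1 / 3 : ℝ) := by positivity
  calc 2 * L * (2 * d + 2) * (9 / 2 * b * ‖k‖ ^ (1 / 3 : ℝ))
      ≤ 2 * L * (2 * d + 2) * (9 / 2 * (b + 1) * ‖k‖ ^ (1 / 3 : ℝ)) := by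
        gcongr
        linarith
    _ = _ := by ring

/-! ### The kinetic group and mollification along it. -/

/-- The left translations of the kinetic group; they commute with `𝒯` and `∇_v`. -/
def act (ζ z : Z d) : Z d := (ζ.1 + z.1, ζ.2.1 + z.2.1 + z.1 • ζ.2.2, ζ.2.2 + z.2.2)

/-- The element of the kinetic group that maps `z` to `z'`. -/
def relPos (z' z : Z d) : Z d :=
  (z'.1 - z.1, z'.2.1 - z.2.1 - z.1 • (z'.2.2 - z.2.2), z'.2.2 - z.2.2)

theorem act_relPos (z' z : Z d) : act (relPos z' z) z = z' := by
  ext j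
  · simp [act, relPos]
  · simp [act, relPos]; ring
  · simp [act, relPos]

theorem relPos_act (ζ z : Z d) : relPos (act ζ z) z = ζ := by
  ext j
  · simp [act, relPos]
  · simp [act, relPos]; ring
  · simp [act, relPos]

theorem continuous_act : Continuous fun q : Z d × Z d => act q.1 q.2 := by
  unfold act
  fun_prop

theorem contDiff_relPos : ContDiff ℝ ((⊤ : ℕ∞) : WithTop ℕ∞) fun q : Z d × Z d => relPos q.1 q.2 := by
  unfold relPos
  fun_prop

theorem continuous_relPos : Continuous fun q : Z d × Z d => relPos q.1 q.2 :=
  contDiff_relPos.continuous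

/-- `ζ ↦ act ζ z` as a homeomorphism. -/
def actHomeomorph (z : Z d) : Z d ≃ₜ Z d where
  toFun ζ := act ζ z
  invFun z' := relPos z' z
  left_inv ζ := relPos_act ζ z
  right_inv z' := act_relPos z' z
  continuous_toFun := continuous_act.comp (continuous_id.prodMk continuous_const)
  continuous_invFun := continuous_relPos.comp (continuous_id.prodMk continuous_const)

theorem measurePreserving_act_left (ζ : Z d) : MeasurePreserving (act ζ) := by
  have h := measurePreserving_shear (d := d) ζ.1 ζ.2.2
    (c := fun t _ => ζ.2.1 + t • ζ.2.2) (by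
      simp only [Function.uncurry_def]
      fun_prop)
  convert h using 1
  ext z : 1
  simp only [act]
  ext j
  · simp [add_comm]
  · simp; ring
  · simp [add_comm]

theorem measurePreserving_act_right (z : Z d) : MeasurePreserving fun ζ => act ζ z := by
  have h := measurePreserving_shear (d := d) z.1 z.2.2
    (c := fun _ w => z.2.1 + z.1 • w) (by
      simp only [Function.uncurry_def]
      fun_prop)
  convert h using 1
  ext ζ : 1
  simp only [act, add_assoc]

/-- Mollification along the kinetic group. -/
def moll (ρ u : Z d → ℝ) (z : Z d) : ℝ := ∫ z', u z' * ρ (relPos z' z)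

theorem moll_eq_integral_act (ρ u : Z d → ℝ) (z : Z d) :
    moll ρ u z = ∫ ζ, u (act ζ z) * ρ ζ := by
  have h := (measurePreserving_act_right z).integral_comp
    (actHomeomorph z).toMeasurableEquiv.measurableEmbedding (fun z' => u z' * ρ (relPos z' z))
  simp only [relPos_act] at h
  exact h.symm

/-- Smooth probability densities supported in the ball of radius `ε`. -/
structure IsMollifier (ε : ℝ) (ρ : Z d → ℝ) : Prop where
  smooth : ContDiff ℝ ((⊤ : ℕ∞) : WithTop ℕ∞) ρ
  nonneg : ∀ ζ, 0 ≤ ρ ζ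
  zero_of_lt : ∀ ζ, ε < ‖ζ‖ → ρ ζ = 0
  integral_eq : ∫ ζ, ρ ζ = 1

theorem exists_isMollifier {ε : ℝ} (hε : 0 < ε) : ∃ ρ : Z d → ℝ, IsMollifier ε ρ := by
  let b : ContDiffBump (0 : Z d) := ⟨ε / 2, ε, by linarith, by linarith⟩
  refine ⟨b.normed volume, b.contDiff_normed, b.nonneg_normed, fun ζ hζ => ?_, b.integral_normed⟩
  have h1 : ζ ∉ Function.support (b.normed (volume : Measure (Z d))) := by
    rw [b.support_normed_eq]
    simpa using hζ.le
  simpa using h1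

namespace IsMollifier

variable {ε : ℝ} {ρ : Z d → ℝ}

theorem hasCompactSupport (hρ : IsMollifier ε ρ) : HasCompactSupport ρ :=
  HasCompactSupport.intro (isCompact_closedBall 0 ε) fun ζ hζ =>
    hρ.zero_of_lt ζ (by simpa using hζ)

theorem contDiff_kernel (hρ : IsMollifier ε ρ) :
    ContDiff ℝ ((⊤ : ℕ∞) : WithTop ℕ∞) fun q : Z d × Z d => ρ (relPos q.1 q.2) :=
  hρ.smooth.comp contDiff_relPos

theorem contDiff_kernel_left (hρ : IsMollifier ε ρ) (z : Z d) :
    ContDiff ℝ ((⊤ : ℕ∞) : WithTop ℕ∞) fun z' : Z d => ρ (relPos z' z) :=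
  hρ.contDiff_kernel.comp (contDiff_id.prodMk contDiff_const)

theorem contDiff_kernel_right (hρ : IsMollifier ε ρ) (z' : Z d) :
    ContDiff ℝ ((⊤ : ℕ∞) : WithTop ℕ∞) fun z : Z d => ρ (relPos z' z) :=
  hρ.contDiff_kernel.comp (contDiff_const.prodMk contDiff_id)

theorem tsupport_kernel_subset (hρ : IsMollifier ε ρ) (z : Z d) :
    tsupport (fun z' => ρ (relPos z' z)) ⊆ {z' | ‖relPos z' z‖ ≤ ε} := by
  refine closure_minimal (fun z' hz' => ?_) ?_
  · by_contra h
    exact hz' (hρ.zero_of_lt _ (by simpa using h))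
  · exact isClosed_le (continuous_relPos.comp (continuous_id.prodMk continuous_const)).norm
      continuous_const

theorem kernel_eq_zero (hρ : IsMollifier ε ρ) {S : Set (Z d)} {z z' : Z d} (hz : z ∈ S)
    (hz' : z' ∉ (fun q : Z d × Z d => act q.1 q.2) '' (Metric.closedBall 0 ε ×ˢ S)) :
    ρ (relPos z' z) = 0 := by
  refine hρ.zero_of_lt _ ?_
  by_contra! h
  exact hz' ⟨(relPos z' z, z), ⟨by simpa using h, hz⟩, act_relPos z' z⟩

theorem isCompact_image_act {S : Set (Z d)} (hS : IsCompact S) (ε : ℝ) :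
    IsCompact ((fun q : Z d × Z d => act q.1 q.2) '' (Metric.closedBall 0 ε ×ˢ S)) :=
  ((isCompact_closedBall _ _).prod hS).image continuous_act

theorem hasCompactSupport_kernel (hρ : IsMollifier ε ρ) (z : Z d) :
    HasCompactSupport fun z' => ρ (relPos z' z) :=
  HasCompactSupport.intro (isCompact_image_act (isCompact_singleton (x := z)) ε) fun _ hz' =>
    hρ.kernel_eq_zero (mem_singleton z) hz'

/-- `relPos` is not a difference, so this is not an additive convolution. Smoothness follows by
viewing z as a parameter of the kernel and evaluating the parametrized convolution at the origin;
the supports stay in a fixed compact set while z varies in a ball. -/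
theorem contDiff_moll (hρ : IsMollifier ε ρ) {u : Z d → ℝ} (hu : LocallyIntegrable u) :
    ContDiff ℝ ((⊤ : ℕ∞) : WithTop ℕ∞) (moll ρ u) := by
  have h : moll ρ u = fun z => (MeasureTheory.convolution u (fun ξ => ρ (relPos (-ξ) z))
      (ContinuousLinearMap.mul ℝ ℝ) volume) ((fun _ => 0) z) := by
    ext z
    simp [moll, convolution]
  rw [contDiff_iff_contDiffAt]
  intro z₀
  have hS := isCompact_image_act (isCompact_closedBall z₀ 1) ε
  have key : ContDiffOn ℝ ((⊤ : ℕ∞) : WithTop ℕ∞) (moll ρ u) (Metric.ball z₀ 1) := by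
    rw [h]
    refine contDiffOn_convolution_right_with_param_comp (ContinuousLinearMap.mul ℝ ℝ)
      (g := fun z ξ => ρ (relPos (-ξ) z)) contDiffOn_const
      Metric.isOpen_ball hS.neg (fun z ξ hz hξ => ?_) hu ?_
    · exact hρ.kernel_eq_zero (Metric.ball_subset_closedBall hz) (by simpa using hξ)
    · exact (hρ.contDiff_kernel.comp (contDiff_snd.neg.prodMk contDiff_fst)).contDiffOn
  exact key.contDiffAt (Metric.ball_mem_nhds _ one_pos)

theorem fderiv_moll_apply (hρ : IsMollifier ε ρ) {u : Z d → ℝ} (hu : LocallyIntegrable u)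
    (z w : Z d) :
    fderiv ℝ (moll ρ u) z w = ∫ z', u z' * fderiv ℝ (fun z => ρ (relPos z' z)) z w := by
  set K := (fun q : Z d × Z d => act q.1 q.2) '' (Metric.closedBall 0 ε ×ˢ Metric.closedBall z 1)
    with hK
  have hKc : IsCompact K := isCompact_image_act (isCompact_closedBall z 1) ε
  let D : Z d → Z d → Z d →L[ℝ] ℝ := fun z z' => fderiv ℝ (fun z => ρ (relPos z' z)) z
  have hDc : Continuous fun q : Z d × Z d => D q.1 q.2 := by
    have h2 : ContDiff ℝ ((⊤ : ℕ∞) : WithTop ℕ∞) fun q : Z d × Z d => D q.1 q.2 :=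
      ContDiff.fderiv (f := fun (q : Z d × Z d) z => ρ (relPos q.2 z))
        (n := ((⊤ : ℕ∞) : WithTop ℕ∞))
        (hρ.contDiff_kernel.comp ((contDiff_snd.comp contDiff_fst).prodMk contDiff_snd))
        contDiff_fst (WithTop.coe_le_coe.2 le_top)
    exact h2.continuous
  obtain ⟨M, hM⟩ := ((isCompact_closedBall z 1).prod hKc).exists_bound_of_continuousOn
    hDc.continuousOn
  have hzero : ∀ x ∈ Metric.ball z 1, ∀ z' ∉ K, D x z' = 0 := by
    intro x hx z' hz'
    have : (fun z => ρ (relPos z' z)) =ᶠ[𝓝 x] fun _ => 0 := by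
      filter_upwards [Metric.isOpen_ball.mem_nhds hx] with y hy
      exact hρ.kernel_eq_zero (Metric.ball_subset_closedBall hy) hz'
    simp only [D]
    rw [this.fderiv_eq]
    simp
  have hmeas : AEStronglyMeasurable u volume := hu.aestronglyMeasurable
  have key : HasFDerivAt (moll ρ u) (∫ z', u z' • D z z') z := by
    refine hasFDerivAt_integral_of_dominated_of_fderiv_le
      (F := fun z z' => u z' * ρ (relPos z' z)) (F' := fun z z' => u z' • D z z')
      (bound := K.indicator fun z' => ‖u z'‖ * M) (Metric.ball_mem_nhds z one_pos) ?_ ?_ ?_ ?_ ?_ ?_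
    · exact Eventually.of_forall fun x =>
        hmeas.mul (hρ.contDiff_kernel_left x).continuous.aestronglyMeasurable
    · exact hu.integrable_smul_right_of_hasCompactSupport (hρ.contDiff_kernel_left z).continuous
        (hρ.hasCompactSupport_kernel z)
    · exact hmeas.smul (hDc.comp (continuous_const.prodMk continuous_id)).aestronglyMeasurable
    · refine Eventually.of_forall fun z' x hx => ?_
      by_cases hz' : z' ∈ K
      · rw [indicator_of_mem hz', norm_smul]
        gcongr
        exact hM (x, z') ⟨Metric.ball_subset_closedBall hx, hz'⟩
      · rw [indicator_of_notMem hz', hzero x hx z' hz']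
        simp
    · rw [integrable_indicator_iff hKc.measurableSet]
      exact ((hu.integrableOn_isCompact hKc).norm.mul_const M)
    · refine Eventually.of_forall fun z' x _ => ?_
      exact ((hρ.contDiff_kernel_right z').differentiable (by simp) x).hasFDerivAt.const_mul (u z')
  have hint : Integrable fun z' => u z' • D z z' := by
    refine hu.integrable_smul_right_of_hasCompactSupport
      (hDc.comp (continuous_const.prodMk continuous_id)) ?_
    exact HasCompactSupport.intro hKc fun z' hz' => hzero z (Metric.mem_ball_self one_pos) z' hz'
  rw [key.fderiv, ContinuousLinearMap.integral_apply hint]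
  simp [D]

end IsMollifier

theorem fderiv_comp_apply_of_line {X Y : Type*} [NormedAddCommGroup X] [NormedSpace ℝ X]
    [NormedAddCommGroup Y] [NormedSpace ℝ Y] {Φ : Y → ℝ} {P : X → Y} {z w : X} {a : Y}
    (hΦ : DifferentiableAt ℝ Φ (P z)) (hd : DifferentiableAt ℝ (fun z => Φ (P z)) z)
    (hP : HasDerivAt (fun s : ℝ => P (z + s • w)) a 0) :
    fderiv ℝ (fun z => Φ (P z)) z w = fderiv ℝ Φ (P z) a := by
  have h1 : HasDerivAt (fun s : ℝ => z + s • w) w 0 := by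
    simpa using ((hasDerivAt_id (0 : ℝ)).smul_const w).const_add z
  have hw : z + (0 : ℝ) • w = z := by simp
  have h3 := HasFDerivAt.comp_hasDerivAt (x := (0 : ℝ)) (f := fun s : ℝ => P (z + s • w))
    (l := Φ) (l' := fderiv ℝ Φ (P z)) (by
      simp only [hw]
      exact hΦ.hasFDerivAt) hP
  have h4 := HasFDerivAt.comp_hasDerivAt (x := (0 : ℝ)) (f := fun s : ℝ => z + s • w)
    (l := fun z => Φ (P z)) (l' := fderiv ℝ (fun z => Φ (P z)) z) (by
      simp only [hw]
      exact hd.hasFDerivAt) h1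
  exact h4.unique h3

theorem hasDerivAt_relPos_left (z z' w : Z d) :
    HasDerivAt (fun s : ℝ => relPos (z' + s • w) z) (w.1, w.2.1 - z.1 • w.2.2, w.2.2) 0 := by
  have e : (fun s : ℝ => relPos (z' + s • w) z) =
      fun s : ℝ => relPos z' z + s • ((w.1, w.2.1 - z.1 • w.2.2, w.2.2) : Z d) := by
    ext s j
    · simp [relPos]; ring
    · simp [relPos]; ring
    · simp [relPos]; ring
  rw [e]
  simpa using ((hasDerivAt_id (0 : ℝ)).smul_const
    ((w.1, w.2.1 - z.1 • w.2.2, w.2.2) : Z d)).const_add (relPos z' z)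

theorem hasDerivAt_relPos_right (z z' w : Z d) :
    HasDerivAt (fun s : ℝ => relPos z' (z + s • w))
      (-w.1, -w.2.1 - w.1 • (z'.2.2 - z.2.2) + z.1 • w.2.2, -w.2.2) 0 := by
  have e : (fun s : ℝ => relPos z' (z + s • w)) = fun s : ℝ => relPos z' z +
      s • ((-w.1, -w.2.1 - w.1 • (z'.2.2 - z.2.2) + z.1 • w.2.2, -w.2.2) : Z d) +
      s ^ 2 • ((0, w.1 • w.2.2, 0) : Z d) := by
    ext s j
    · simp [relPos]; ring
    · simp [relPos]; ring
    · simp [relPos]; ring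
  rw [e]
  have h1 := ((hasDerivAt_id (0 : ℝ)).smul_const
    ((-w.1, -w.2.1 - w.1 • (z'.2.2 - z.2.2) + z.1 • w.2.2, -w.2.2) : Z d)).const_add (relPos z' z)
  have h2 := (hasDerivAt_pow 2 (0 : ℝ)).smul_const ((0, w.1 • w.2.2, 0) : Z d)
  exact (h1.add h2).congr_deriv (by simp)

namespace IsMollifier

variable {ε : ℝ} {ρ : Z d → ℝ}

/-- Moving z along (1, v, 0) moves `relPos z' z` in the direction -(1, v', 0), and moving z' along
(1, v', 0) moves it in the opposite direction. Hence 𝒯 passes from one variable of the kernel to the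
other with no commutator. -/
theorem fderiv_kernel_transport (hρ : IsMollifier ε ρ) (z z' : Z d) :
    fderiv ℝ (fun z => ρ (relPos z' z)) z (1, z.2.2, 0) =
      -transport (fun z' => ρ (relPos z' z)) z' := by
  rw [transport, fderiv_comp_apply_of_line (P := fun z => relPos z' z)
      (hρ.smooth.differentiable (by simp) _)
      ((hρ.contDiff_kernel_right z').differentiable (by simp) z) (hasDerivAt_relPos_right z z' _),
    fderiv_comp_apply_of_line (P := fun z' => relPos z' z) (hρ.smooth.differentiable (by simp) _)
      ((hρ.contDiff_kernel_left z).differentiable (by simp) z') (hasDerivAt_relPos_left z z' _),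
    ← map_neg]
  congr 1
  ext j
  · simp
  · simp; ring
  · simp

theorem fderiv_kernel_dV (hρ : IsMollifier ε ρ) (i : Fin d) (z z' : Z d) :
    fderiv ℝ (fun z => ρ (relPos z' z)) z (ev i) = -dV i (fun z' => ρ (relPos z' z)) z' := by
  rw [dV, fderiv_comp_apply_of_line (P := fun z => relPos z' z)
      (hρ.smooth.differentiable (by simp) _)
      ((hρ.contDiff_kernel_right z').differentiable (by simp) z) (hasDerivAt_relPos_right z z' _),
    fderiv_comp_apply_of_line (P := fun z' => relPos z' z) (hρ.smooth.differentiable (by simp) _)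
      ((hρ.contDiff_kernel_left z).differentiable (by simp) z') (hasDerivAt_relPos_left z z' _),
    ← map_neg]
  congr 1
  ext j <;> simp [ev]

theorem transport_moll (hρ : IsMollifier ε ρ) {u : Z d → ℝ} (hu : LocallyIntegrable u) (z : Z d) :
    transport (moll ρ u) z = -∫ z', u z' * transport (fun z' => ρ (relPos z' z)) z' := by
  rw [transport, hρ.fderiv_moll_apply hu, ← integral_neg]
  simp_rw [hρ.fderiv_kernel_transport, mul_neg]

theorem dV_moll (hρ : IsMollifier ε ρ) {u : Z d → ℝ} (hu : LocallyIntegrable u) (i : Fin d)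
    (z : Z d) : dV i (moll ρ u) z = -∫ z', u z' * dV i (fun z' => ρ (relPos z' z)) z' := by
  rw [dV, hρ.fderiv_moll_apply hu, ← integral_neg]
  simp_rw [hρ.fderiv_kernel_dV, mul_neg]

end IsMollifier

theorem exists_act_mem {V K : Set (Z d)} (hV : IsOpen V) (hK : IsCompact K) (hKV : K ⊆ V) :
    ∃ ε > 0, ∀ z ∈ K, ∀ ζ : Z d, ‖ζ‖ ≤ ε → act ζ z ∈ V := by
  obtain ⟨u, v, hu, -, hu0, hv, huv⟩ := generalized_tube_lemma (isCompact_singleton (x := (0 : Z d)))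
    hK (hV.preimage continuous_act) (by
      rintro ⟨a, z⟩ ⟨ha, hz⟩
      rw [mem_singleton_iff] at ha
      subst ha
      simpa [act] using hKV hz)
  obtain ⟨ε, hε, hball⟩ := Metric.isOpen_iff.1 hu 0 (hu0 rfl)
  refine ⟨ε / 2, by positivity, fun z hz ζ hζ => ?_⟩
  have : (ζ, z) ∈ u ×ˢ v := ⟨hball (by simp; linarith), hv hz⟩
  exact huv this

/-- Composition in L² is strongly continuous along a continuous family of measure preserving maps,
and `act 0` is the identity. -/
theorem tendsto_eLpNorm_comp_act {u : Z d → ℝ} (hu : MemLp u 2 volume) :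
    Tendsto (fun ζ : Z d => eLpNorm (fun z => u (act ζ z) - u z) 2 volume) (𝓝 0) (𝓝 0) := by
  let G : Z d → C(Z d, Z d) := fun ζ => ⟨act ζ, continuous_act.comp (continuous_const.prodMk continuous_id)⟩
  have hG : Continuous G := by
    have : Continuous (ContinuousMap.curry ⟨fun q : Z d × Z d => act q.1 q.2, continuous_act⟩) :=
      ContinuousMap.continuous _
    exact this
  have hmp : ∀ ζ, MeasurePreserving (G ζ) (volume : Measure (Z d)) volume :=
    measurePreserving_act_left
  have h1 := Filter.Tendsto.compMeasurePreservingLp (p := 2) (E := ℝ) (l := 𝓝 (0 : Z d))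
    (f := fun _ => hu.toLp u) (f₀ := hu.toLp u) tendsto_const_nhds (hG.tendsto 0) hmp (hmp 0)
    (by simp)
  simp only [Lp.toLp_compMeasurePreserving] at h1
  rw [Lp.tendsto_Lp_iff_tendsto_eLpNorm''] at h1
  refine h1.congr fun ζ => ?_
  congr 1
  ext z
  simp [G, act]

/-- Mollifications converge in `L²`. -/
theorem exists_eLpNorm_moll_sub_le {u : Z d → ℝ} (hu : MemLp u 2 volume) (hum : Measurable u)
    {η : ℝ≥0∞} (hη : 0 < η) : ∃ δ > 0, ∀ ε ≤ δ, ∀ ρ : Z d → ℝ, IsMollifier ε ρ →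
      eLpNorm (fun z => moll ρ u z - u z) 2 volume ≤ η := by
  have hev := (tendsto_eLpNorm_comp_act hu).eventually (ge_mem_nhds hη)
  obtain ⟨δ, hδ, hball⟩ := Metric.eventually_nhds_iff_ball.1 hev
  refine ⟨δ / 2, by positivity, fun ε hε ρ hρ => ?_⟩
  have hloc : LocallyIntegrable u := hu.locallyIntegrable (by norm_num)
  have hρi : Integrable ρ := hρ.smooth.continuous.integrable_of_hasCompactSupport hρ.hasCompactSupport
  set ν : Measure (Z d) := volume.withDensity fun ζ => ENNReal.ofReal (ρ ζ) with hν
  have hρm : Measurable fun ζ => ENNReal.ofReal (ρ ζ) := hρ.smooth.continuous.measurable.ennreal_ofReal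
  have hνp : IsProbabilityMeasure ν := by
    refine ⟨?_⟩
    rw [hν, withDensity_apply _ MeasurableSet.univ, Measure.restrict_univ,
      ← ofReal_integral_eq_lintegral_ofReal hρi (Eventually.of_forall hρ.nonneg), hρ.integral_eq]
    simp
  have hm : Measurable fun q : Z d × Z d => ‖u (act q.2 q.1) - u q.1‖ₑ := by
    have : Measurable fun q : Z d × Z d => u (act q.2 q.1) :=
      hum.comp (continuous_act.comp continuous_swap).measurable
    exact (this.sub (hum.comp measurable_fst)).enorm
  -- Jensen's inequality for the probability measure ν = ρ dζ.
  have pt : ∀ z, ‖moll ρ u z - u z‖ₑ ^ (2 : ℝ) ≤ ∫⁻ ζ, ‖u (act ζ z) - u z‖ₑ ^ (2 : ℝ) ∂ν := by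
    intro z
    have i1 : Integrable fun ζ => u (act ζ z) * ρ ζ := by
      have h1 : Integrable fun z' => u z' * ρ (relPos z' z) :=
        hloc.integrable_smul_right_of_hasCompactSupport (hρ.contDiff_kernel_left z).continuous
          (hρ.hasCompactSupport_kernel z)
      have h2 := (measurePreserving_act_right z).integrable_comp_of_integrable h1
      simpa [Function.comp_def, relPos_act] using h2
    have e1 : moll ρ u z - u z = ∫ ζ, (u (act ζ z) - u z) * ρ ζ := by
      simp_rw [sub_mul]
      rw [moll_eq_integral_act, integral_sub i1 (hρi.const_mul _), integral_const_mul,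
        hρ.integral_eq, mul_one]
    have h1 : ‖moll ρ u z - u z‖ₑ ≤ ∫⁻ ζ, ‖u (act ζ z) - u z‖ₑ ∂ν := by
      have hmz : Measurable fun ζ => ‖u (act ζ z) - u z‖ₑ := hm.comp measurable_prodMk_left
      rw [e1, hν, lintegral_withDensity_eq_lintegral_mul _ hρm hmz]
      refine (enorm_integral_le_lintegral_enorm _).trans_eq (lintegral_congr fun ζ => ?_)
      rw [enorm_mul, Real.enorm_of_nonneg (hρ.nonneg ζ), mul_comm]
      rfl
    have hmz : Measurable fun ζ => u (act ζ z) - u z :=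
      (hum.comp (measurePreserving_act_right z).measurable).sub_const _
    have h2 := eLpNorm_le_eLpNorm_of_exponent_le (p := 1) (q := 2) (μ := ν) (by norm_num)
      hmz.aestronglyMeasurable
    rw [eLpNorm_one_eq_lintegral_enorm, eLpNorm_eq_lintegral_rpow_enorm_toReal (by simp) (by simp)] at h2
    calc _ ≤ ((∫⁻ ζ, ‖u (act ζ z) - u z‖ₑ ^ (2 : ℝ) ∂ν) ^ (1 / 2 : ℝ)) ^ (2 : ℝ) := by
          refine ENNReal.rpow_le_rpow (h1.trans ?_) (by norm_num)
          simpa using h2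
      _ = _ := by
          rw [← ENNReal.rpow_mul]
          norm_num
  have hω : ∀ ζ ∈ Metric.closedBall (0 : Z d) ε,
      ∫⁻ z, ‖u (act ζ z) - u z‖ₑ ^ (2 : ℝ) ≤ η ^ (2 : ℝ) := by
    intro ζ hζ
    have h1 := hball ζ (Metric.closedBall_subset_ball (by linarith) hζ)
    simp only [eLpNorm_eq_lintegral_rpow_enorm_toReal (p := 2) (by simp) (by simp)] at h1
    have h2 := ENNReal.rpow_le_rpow h1 (z := 2) (by norm_num)
    rw [← ENNReal.rpow_mul] at h2
    simpa using h2
  rw [eLpNorm_eq_lintegral_rpow_enorm_toReal (by simp) (by simp)]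
  simp only [ENNReal.toReal_ofNat]
  have main : ∫⁻ z, ‖moll ρ u z - u z‖ₑ ^ (2 : ℝ) ≤ η ^ (2 : ℝ) := by
    calc ∫⁻ z, ‖moll ρ u z - u z‖ₑ ^ (2 : ℝ)
        ≤ ∫⁻ z, ∫⁻ ζ, ‖u (act ζ z) - u z‖ₑ ^ (2 : ℝ) ∂ν := lintegral_mono pt
      _ = ∫⁻ ζ, (∫⁻ z, ‖u (act ζ z) - u z‖ₑ ^ (2 : ℝ)) ∂ν :=
          lintegral_lintegral_swap (hm.pow_const _).aemeasurable
      _ = ∫⁻ ζ, ENNReal.ofReal (ρ ζ) * ∫⁻ z, ‖u (act ζ z) - u z‖ₑ ^ (2 : ℝ) := by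
          have hm' : Measurable fun q : Z d × Z d => ‖u (act q.1 q.2) - u q.2‖ₑ ^ (2 : ℝ) :=
            (hm.comp measurable_swap).pow_const _
          have hm2 : Measurable fun ζ => ∫⁻ z, ‖u (act ζ z) - u z‖ₑ ^ (2 : ℝ) :=
            hm'.lintegral_prod_right'
          rw [hν, lintegral_withDensity_eq_lintegral_mul _ hρm hm2]
          rfl
      _ ≤ ∫⁻ ζ, ENNReal.ofReal (ρ ζ) * η ^ (2 : ℝ) := by
          refine lintegral_mono fun ζ => ?_
          by_cases hζ : ζ ∈ Metric.closedBall (0 : Z d) ε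
          · exact mul_le_mul' le_rfl (hω ζ hζ)
          · rw [hρ.zero_of_lt ζ (by simpa using hζ)]
            simp
      _ = η ^ (2 : ℝ) := by
          rw [lintegral_mul_const _ hρm,
            ← ofReal_integral_eq_lintegral_ofReal hρi (Eventually.of_forall hρ.nonneg),
            hρ.integral_eq]
          simp
  calc _ ≤ (η ^ (2 : ℝ)) ^ (1 / 2 : ℝ) := ENNReal.rpow_le_rpow main (by norm_num)
    _ = η := by
      rw [← ENNReal.rpow_mul]
      norm_num

/-! ### Strong convergence in L² of the mollified fields. -/

/-- Convergence in `L²`. -/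
structure L2Lim (un : ℕ → Z d → ℝ) (u : Z d → ℝ) : Prop where
  meas : ∀ n, AEStronglyMeasurable (un n) volume
  memLp : MemLp u 2 volume
  lim : Tendsto (fun n => eLpNorm (un n - u) 2 volume) atTop (𝓝 0)

namespace L2Lim

variable {un vn : ℕ → Z d → ℝ} {u v : Z d → ℝ}

theorem add (hu : L2Lim un u) (hv : L2Lim vn v) : L2Lim (fun n => un n + vn n) (u + v) where
  meas n := (hu.meas n).add (hv.meas n)
  memLp := hu.memLp.add hv.memLp
  lim := by
    refine tendsto_of_tendsto_of_tendsto_of_le_of_le tendsto_const_nhds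
      (by simpa using hu.lim.add hv.lim) (fun n => zero_le) fun n => ?_
    have : un n + vn n - (u + v) = (un n - u) + (vn n - v) := by ring
    simp only [this]
    exact eLpNorm_add_le ((hu.meas n).sub hu.memLp.1) ((hv.meas n).sub hv.memLp.1) (by norm_num)

theorem zero : L2Lim (fun _ => (0 : Z d → ℝ)) 0 where
  meas _ := aestronglyMeasurable_zero
  memLp := MemLp.zero
  lim := by simp

theorem sum {ι : Type*} (s : Finset ι) {un : ι → ℕ → Z d → ℝ} {u : ι → Z d → ℝ}
    (h : ∀ i ∈ s, L2Lim (un i) (u i)) : L2Lim (fun n => ∑ i ∈ s, un i n) (∑ i ∈ s, u i) := by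
  classical
  induction s using Finset.induction_on with
  | empty => simpa using zero
  | insert a s ha ih =>
    simp only [Finset.sum_insert ha]
    exact (h a (Finset.mem_insert_self _ _)).add
      (ih fun i hi => h i (Finset.mem_insert_of_mem hi))

theorem abs (hu : L2Lim un u) : L2Lim (fun n z => |un n z|) (fun z => |u z|) where
  meas n := (hu.meas n).norm
  memLp := hu.memLp.norm
  lim := by
    refine tendsto_of_tendsto_of_tendsto_of_le_of_le tendsto_const_nhds hu.lim
      (fun n => zero_le) fun n => ?_
    exact eLpNorm_mono fun z => by simpa using abs_abs_sub_abs_le_abs_sub (un n z) (u z)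

theorem mul_bounded (hu : L2Lim un u) {ψ : Z d → ℝ} (hψ : Continuous ψ)
    (hs : HasCompactSupport ψ) : L2Lim (fun n z => un n z * ψ z) (fun z => u z * ψ z) := by
  obtain ⟨M, hM⟩ := hs.exists_bound_of_continuous hψ
  have hM' : ∀ᵐ z, ‖ψ z‖ ≤ M := Eventually.of_forall hM
  have hM0 : 0 ≤ M := (norm_nonneg _).trans (hM 0)
  refine ⟨fun n => (hu.meas n).mul hψ.aestronglyMeasurable, ?_, ?_⟩
  · refine hu.memLp.of_le_mul (c := M) (hu.memLp.1.mul hψ.aestronglyMeasurable)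
      (Eventually.of_forall fun z => ?_)
    rw [norm_mul, mul_comm]
    gcongr
    exact hM z
  · have h0 : Tendsto (fun n => ENNReal.ofReal M * eLpNorm (un n - u) 2 volume) atTop (𝓝 0) := by
      simpa using ENNReal.Tendsto.const_mul hu.lim (Or.inr ENNReal.ofReal_ne_top)
    refine tendsto_of_tendsto_of_tendsto_of_le_of_le tendsto_const_nhds h0
      (fun n => zero_le) fun n => ?_
    refine eLpNorm_le_mul_eLpNorm_of_ae_le_mul (Eventually.of_forall fun z => ?_) 2
    simp only [Pi.sub_apply]
    rw [← sub_mul, norm_mul, mul_comm]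
    gcongr
    exact hM z

theorem eventually_memLp (hu : L2Lim un u) : ∀ᶠ n in atTop, MemLp (un n) 2 volume := by
  filter_upwards [hu.lim.eventually (gt_mem_nhds (zero_lt_one' ℝ≥0∞))] with n hn
  have h1 : MemLp (un n - u) 2 volume := ⟨(hu.meas n).sub hu.memLp.1, hn.trans ENNReal.one_lt_top⟩
  simpa using h1.add hu.memLp

theorem tendsto_eLpNorm (hu : L2Lim un u) :
    Tendsto (fun n => eLpNorm (un n) 2 volume) atTop (𝓝 (eLpNorm u 2 volume)) := by
  have hne := hu.memLp.eLpNorm_ne_top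
  refine tendsto_of_tendsto_of_tendsto_of_le_of_le
    (g := fun n => eLpNorm u 2 volume - eLpNorm (un n - u) 2 volume)
    (h := fun n => eLpNorm u 2 volume + eLpNorm (un n - u) 2 volume) ?_ ?_ (fun n => ?_) fun n => ?_
  · simpa using ENNReal.Tendsto.sub tendsto_const_nhds hu.lim (Or.inl hne)
  · simpa using hu.lim.const_add (eLpNorm u 2 volume)
  · simp only [tsub_le_iff_right]
    have e : u = un n - (un n - u) := by ring
    calc eLpNorm u 2 volume = eLpNorm (un n - (un n - u)) 2 volume := by rw [← e]
      _ ≤ _ := eLpNorm_sub_le (hu.meas n) ((hu.meas n).sub hu.memLp.1) (by norm_num)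
  · have e : un n = u + (un n - u) := by ring
    calc eLpNorm (un n) 2 volume = eLpNorm (u + (un n - u)) 2 volume := by rw [← e]
      _ ≤ _ := eLpNorm_add_le hu.memLp.1 ((hu.meas n).sub hu.memLp.1) (by norm_num)

theorem tendsto_integral_mul (hu : L2Lim un u) (hv : L2Lim vn v) :
    Tendsto (fun n => ∫ z, un n z * vn n z) atTop (𝓝 (∫ z, u z * v z)) := by
  -- The approximants are known to lie in L² only from some rank on, so the sequences are shifted
  -- before the inner product of L² is used.
  obtain ⟨N, hN⟩ := eventually_atTop.1 (hu.eventually_memLp.and hv.eventually_memLp)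
  rw [← tendsto_add_atTop_iff_nat N]
  have mu : ∀ n, MemLp (un (n + N)) 2 volume := fun n => (hN _ (Nat.le_add_left _ _)).1
  have mv : ∀ n, MemLp (vn (n + N)) 2 volume := fun n => (hN _ (Nat.le_add_left _ _)).2
  have hin : ∀ {a b : Z d → ℝ} (ha : MemLp a 2 volume) (hb : MemLp b 2 volume),
      ∫ z, a z * b z = inner ℝ (ha.toLp a) (hb.toLp b) := by
    intro a b ha hb
    rw [L2.inner_def]
    refine integral_congr_ae ?_
    filter_upwards [ha.coeFn_toLp, hb.coeFn_toLp] with z h1 h2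
    rw [h1, h2]
    simp [mul_comm]
  have l1 : Tendsto (fun n => (mu n).toLp (un (n + N))) atTop (𝓝 (hu.memLp.toLp u)) := by
    rw [Lp.tendsto_Lp_iff_tendsto_eLpNorm'']
    exact (tendsto_add_atTop_iff_nat N).2 hu.lim
  have l2 : Tendsto (fun n => (mv n).toLp (vn (n + N))) atTop (𝓝 (hv.memLp.toLp v)) := by
    rw [Lp.tendsto_Lp_iff_tendsto_eLpNorm'']
    exact (tendsto_add_atTop_iff_nat N).2 hv.lim
  simp_rw [hin hu.memLp hv.memLp, fun n => hin (mu n) (mv n)]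
  exact l1.inner l2

end L2Lim

/-- A sequence of mollifiers concentrating at the origin. -/
def mollSeq (d : ℕ) (n : ℕ) : Z d → ℝ :=
  (exists_isMollifier (d := d) (Nat.one_div_pos_of_nat (α := ℝ) (n := n))).choose

theorem isMollifier_mollSeq (d n : ℕ) : IsMollifier (1 / ((n : ℝ) + 1)) (mollSeq d n) :=
  (exists_isMollifier (d := d) (Nat.one_div_pos_of_nat (α := ℝ) (n := n))).choose_spec

theorem contDiff_moll_mollSeq {u : Z d → ℝ} (hu : MemLp u 2 volume) (n : ℕ) :
    ContDiff ℝ 1 (moll (mollSeq d n) u) :=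
  ((isMollifier_mollSeq d n).contDiff_moll (hu.locallyIntegrable (by norm_num))).of_le
    (by exact_mod_cast le_top)

theorem l2Lim_moll {u : Z d → ℝ} (hu : MemLp u 2 volume) (hum : Measurable u) :
    L2Lim (fun n => moll (mollSeq d n) u) u where
  meas n := (contDiff_moll_mollSeq hu n).continuous.aestronglyMeasurable
  memLp := hu
  lim := by
    rw [ENNReal.tendsto_nhds_zero]
    intro η hη
    obtain ⟨δ, hδ, h⟩ := exists_eLpNorm_moll_sub_le hu hum hη
    filter_upwards [(tendsto_one_div_add_atTop_nhds_zero_nat (𝕜 := ℝ)).eventually (ge_mem_nhds hδ)]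
      with n hn
    exact h _ hn _ (isMollifier_mollSeq d n)

/-! ### Weak sub-solutions, energy and Caccioppoli inequalities. -/

/-- Weak sub-solutions of `𝒯 f = ∇_v · F + h` in `V` with velocity gradient `g`, all the fields
being defined on the whole space. -/
structure WeakSub (V : Set (Z d)) (f h : Z d → ℝ) (g F : Fin d → Z d → ℝ) : Prop where
  isOpen : IsOpen V
  memLp_f : MemLp f 2 volume
  meas_f : Measurable f
  memLp_h : MemLp h 2 volume
  meas_h : Measurable h
  memLp_g : ∀ i, MemLp (g i) 2 volume
  meas_g : ∀ i, Measurable (g i)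
  memLp_F : ∀ i, MemLp (F i) 2 volume
  meas_F : ∀ i, Measurable (F i)
  nonneg : ∀ᵐ z, 0 ≤ f z
  grad : ∀ i φ, IsTest V φ → ∫ z, f z * dV i φ z = -∫ z, g i z * φ z
  sub : ∀ φ, IsTest V φ → (∀ z, 0 ≤ φ z) →
    -∫ z, f z * transport φ z ≤ -(∑ i, ∫ z, F i z * dV i φ z) + ∫ z, h z * φ z

namespace WeakSub

variable {V : Set (Z d)} {f h : Z d → ℝ} {g F : Fin d → Z d → ℝ}

theorem moll_nonneg (H : WeakSub V f h g F) (n : ℕ) (z : Z d) : 0 ≤ moll (mollSeq d n) f z :=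
  integral_nonneg_of_ae <| H.nonneg.mono fun _ hz' =>
    mul_nonneg hz' ((isMollifier_mollSeq d n).nonneg _)

/-- The mollified fields satisfy the equations pointwise on compact subsets. -/
theorem eventually_moll (H : WeakSub V f h g F) {K : Set (Z d)} (hK : IsCompact K) (hKV : K ⊆ V) :
    ∀ᶠ n in atTop, ∀ z ∈ K,
      (∀ i, dV i (moll (mollSeq d n) f) z = moll (mollSeq d n) (g i) z) ∧
      transport (moll (mollSeq d n) f) z ≤
        ∑ i, dV i (moll (mollSeq d n) (F i)) z + moll (mollSeq d n) h z := by
  obtain ⟨ε, hε, hact⟩ := exists_act_mem H.isOpen hK hKV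
  filter_upwards [(tendsto_one_div_add_atTop_nhds_zero_nat (𝕜 := ℝ)).eventually (ge_mem_nhds hε)]
    with n hn z hz
  have hρ := isMollifier_mollSeq d n
  -- For n large the kernel centred at a point of K is supported in V. It is then an admissible
  -- nonnegative test function, and the weak inequality tested with it is the pointwise inequality
  -- for the mollified fields.
  have htest : IsTest V fun z' => mollSeq d n (relPos z' z) := by
    refine ⟨hρ.contDiff_kernel_left z, hρ.hasCompactSupport_kernel z, fun z' hz' => ?_⟩
    have h1 := hρ.tsupport_kernel_subset z hz'
    have h2 := hact z hz (relPos z' z) (le_trans h1 hn)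
    rwa [act_relPos] at h2
  have lf := H.memLp_f.locallyIntegrable (by norm_num : (1 : ℝ≥0∞) ≤ 2)
  have lF := fun i => (H.memLp_F i).locallyIntegrable (by norm_num : (1 : ℝ≥0∞) ≤ 2)
  refine ⟨fun i => ?_, ?_⟩
  · rw [hρ.dV_moll lf, H.grad i _ htest, neg_neg]
    rfl
  · rw [hρ.transport_moll lf]
    refine (H.sub _ htest fun z' => hρ.nonneg _).trans_eq ?_
    simp_rw [fun i => hρ.dV_moll (lF i), Finset.sum_neg_distrib]
    rfl

/-- The energy inequality of `f`, tested against `f η`. -/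
theorem energy_inequality (H : WeakSub V f h g F) {η : Z d → ℝ} (hη : IsTest V η)
    (h0 : ∀ z, 0 ≤ η z) :
    ∑ i, ∫ z, F i z * (g i z * η z) ≤ -(∑ i, ∫ z, F i z * (f z * dV i η z)) +
      (∫ z, h z * (f z * η z)) + 1 / 2 * ∫ z, f z * (f z * transport η z) := by
  have hη1 : ContDiff ℝ 1 η := hη.smooth.of_le (by exact_mod_cast le_top)
  have Lf := l2Lim_moll H.memLp_f H.meas_f
  have Lh := l2Lim_moll H.memLp_h H.meas_h
  have Lg := fun i => l2Lim_moll (H.memLp_g i) (H.meas_g i)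
  have LF := fun i => l2Lim_moll (H.memLp_F i) (H.meas_F i)
  have ev : ∀ᶠ n in atTop,
      ∑ i, ∫ z, moll (mollSeq d n) (F i) z * (moll (mollSeq d n) (g i) z * η z) ≤
        -(∑ i, ∫ z, moll (mollSeq d n) (F i) z * (moll (mollSeq d n) f z * dV i η z)) +
        (∫ z, moll (mollSeq d n) h z * (moll (mollSeq d n) f z * η z)) +
        1 / 2 * ∫ z, moll (mollSeq d n) f z * (moll (mollSeq d n) f z * transport η z) := by
    filter_upwards [H.eventually_moll hη.compact hη.support] with n hn
    set fn := moll (mollSeq d n) f with hfn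
    set hhn := moll (mollSeq d n) h with hhhn
    set gn := fun i => moll (mollSeq d n) (g i) with hgn
    set Fn := fun i => moll (mollSeq d n) (F i) with hFn
    have cf : ContDiff ℝ 1 fn := contDiff_moll_mollSeq H.memLp_f n
    have ch : ContDiff ℝ 1 hhn := contDiff_moll_mollSeq H.memLp_h n
    have cg : ∀ i, ContDiff ℝ 1 (gn i) := fun i => contDiff_moll_mollSeq (H.memLp_g i) n
    have cF : ∀ i, ContDiff ℝ 1 (Fn i) := fun i => contDiff_moll_mollSeq (H.memLp_F i) n
    have df := cf.differentiable one_ne_zero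
    have dη := hη1.differentiable one_ne_zero
    have dF := fun i => (cF i).differentiable one_ne_zero
    have int : ∀ {a b : Z d → ℝ}, Continuous a → Continuous b → HasCompactSupport b →
        Integrable fun z => a z * b z := fun ha hb hs =>
      (ha.mul hb).integrable_of_hasCompactSupport hs.mul_left
    have sη := hη.compact
    have kη := hη1.continuous
    have kf := cf.continuous
    -- The integral of 𝒯(fₙ²η) vanishes; the factor 2 here is the source of the 1/2 in the energy
    -- inequality.
    have e1 : (∫ z, (2 * fn z * transport fn z) * η z) + ∫ z, fn z * (fn z * transport η z) = 0 := by
      have i1 : Integrable fun z => (2 * fn z * transport fn z) * η z :=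
        int ((continuous_const.mul kf).mul (continuous_transport cf)) kη sη
      have i2 : Integrable fun z => fn z * (fn z * transport η z) :=
        int kf (kf.mul (continuous_transport hη1)) sη.transport.mul_left
      rw [← integral_add i1 i2,
        ← integral_transport_eq_zero (cf.mul (cf.mul hη1)) (sη.mul_left.mul_left)]
      refine integral_congr_ae (Eventually.of_forall fun z => ?_)
      simp only
      have dp : DifferentiableAt ℝ (fun z => fn z * η z) z := (df z).mul (dη z)
      rw [transport_mul (df z) dp, transport_mul (df z) (dη z)]
      ring
    have e2 : ∀ i, (∫ z, (fn z * dV i (Fn i) z) * η z) + ((∫ z, (Fn i z * dV i fn z) * η z) +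
        ∫ z, Fn i z * (fn z * dV i η z)) = 0 := by
      intro i
      have k1 := continuous_dV (cF i) i
      have k2 := continuous_dV cf i
      have k3 := (cF i).continuous
      have i1 : Integrable fun z => (fn z * dV i (Fn i) z) * η z := int (kf.mul k1) kη sη
      have i2 : Integrable fun z => (Fn i z * dV i fn z) * η z := int (k3.mul k2) kη sη
      have i3 : Integrable fun z => Fn i z * (fn z * dV i η z) :=
        int k3 (kf.mul (continuous_dV hη1 i)) (sη.dV i).mul_left
      have i4 : Integrable fun z => (Fn i z * dV i fn z) * η z + Fn i z * (fn z * dV i η z) :=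
        i2.add i3
      rw [← integral_add i2 i3, ← integral_add i1 i4,
        ← integral_dV_eq_zero ((cF i).mul (cf.mul hη1)) (sη.mul_left.mul_left) i]
      refine integral_congr_ae (Eventually.of_forall fun z => ?_)
      simp only
      have dp : DifferentiableAt ℝ (fun z => fn z * η z) z := (df z).mul (dη z)
      rw [dV_mul (dF i z) dp, dV_mul (df z) (dη z)]
      ring
    have e3 : ∀ i, ∫ z, (Fn i z * dV i fn z) * η z = ∫ z, Fn i z * (gn i z * η z) := by
      intro i
      refine integral_congr_ae (Eventually.of_forall fun z => ?_)
      by_cases hz : z ∈ tsupport η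
      · simp only [(hn z hz).1 i, mul_assoc]
        rfl
      · simp [image_eq_zero_of_notMem_tsupport hz]
    -- The pointwise inequality is multiplied by fₙη. Its direction is preserved because f, and so
    -- its mollification, is nonnegative.
    have e4 : ∫ z, (fn z * transport fn z) * η z ≤
        (∑ i, ∫ z, (fn z * dV i (Fn i) z) * η z) + ∫ z, hhn z * (fn z * η z) := by
      have k1 := fun i => continuous_dV (cF i) i
      have i1 : ∀ i, Integrable fun z => (fn z * dV i (Fn i) z) * η z := fun i =>
        int (kf.mul (k1 i)) kη sη
      have i2 : Integrable fun z => ∑ i, (fn z * dV i (Fn i) z) * η z :=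
        integrable_finsetSum _ fun i _ => i1 i
      have i3 : Integrable fun z => hhn z * (fn z * η z) :=
        int ch.continuous (kf.mul kη) sη.mul_left
      rw [← integral_finsetSum _ fun i _ => i1 i, ← integral_add i2 i3]
      refine integral_mono (int (kf.mul (continuous_transport cf)) kη sη) (i2.add i3) fun z => ?_
      by_cases hz : z ∈ tsupport η
      · have h1 : transport fn z ≤ (∑ i, dV i (Fn i) z) + hhn z := (hn z hz).2
        have h2 : 0 ≤ fn z * η z := mul_nonneg (H.moll_nonneg n z) (h0 z)
        have h3 := mul_le_mul_of_nonneg_right h1 h2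
        have e5 : ∑ i, fn z * dV i (Fn i) z * η z = (∑ i, dV i (Fn i) z) * (fn z * η z) := by
          rw [Finset.sum_mul]
          exact Finset.sum_congr rfl fun i _ => by ring
        change fn z * transport fn z * η z ≤
          (∑ i, fn z * dV i (Fn i) z * η z) + hhn z * (fn z * η z)
        rw [e5]
        rw [add_mul] at h3
        linarith
      · simp [image_eq_zero_of_notMem_tsupport hz]
    have e6 : ∫ z, (2 * fn z * transport fn z) * η z = 2 * ∫ z, (fn z * transport fn z) * η z := by
      rw [← integral_const_mul]
      exact integral_congr_ae (Eventually.of_forall fun z => by ring)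
    have e7 : ∑ i, ∫ z, (fn z * dV i (Fn i) z) * η z =
        -(∑ i, ∫ z, Fn i z * (gn i z * η z)) - ∑ i, ∫ z, Fn i z * (fn z * dV i η z) := by
      rw [← Finset.sum_neg_distrib, ← Finset.sum_sub_distrib]
      refine Finset.sum_congr rfl fun i _ => ?_
      have := e2 i
      rw [e3 i] at this
      linarith
    linarith
  refine le_of_tendsto_of_tendsto ?_ ?_ ev
  · exact tendsto_finsetSum _ fun i _ =>
      (LF i).tendsto_integral_mul ((Lg i).mul_bounded hη1.continuous hη.compact)
  · refine Tendsto.add (Tendsto.add (Tendsto.neg ?_) ?_) (Tendsto.const_mul _ ?_)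
    · exact tendsto_finsetSum _ fun i _ => (LF i).tendsto_integral_mul
        (Lf.mul_bounded (continuous_dV hη1 i) (hη.compact.dV i))
    · exact Lh.tendsto_integral_mul (Lf.mul_bounded hη1.continuous hη.compact)
    · exact Lf.tendsto_integral_mul (Lf.mul_bounded (continuous_transport hη1) hη.compact.transport)

end WeakSub

/-- Ellipticity and growth bounds for the fields of a weak sub-solution with source `S`. -/
structure Elliptic (lam Lam : ℝ) (S h : Z d → ℝ) (g F : Fin d → Z d → ℝ) : Prop where
  memLp_S : MemLp S 2 volume
  coercive : ∀ᵐ z, lam * ∑ i, g i z ^ 2 ≤ ∑ i, F i z * g i z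
  flux_le : ∀ᵐ z, ∑ i, F i z ^ 2 ≤ Lam ^ 2 * ∑ i, g i z ^ 2
  source_le : ∀ᵐ z, h z ^ 2 ≤ 2 * Lam ^ 2 * ∑ i, g i z ^ 2 + 2 * S z ^ 2

theorem _root_.MeasureTheory.MemLp.integrable_mul_mul_of_hasCompactSupport {u v ψ : Z d → ℝ}
    (hu : MemLp u 2 volume) (hv : MemLp v 2 volume) (hψ : Continuous ψ)
    (hs : HasCompactSupport ψ) : Integrable fun z => u z * (v z * ψ z) := by
  obtain ⟨M, hM⟩ := hs.exists_bound_of_continuous hψ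
  have h := (hu.integrable_mul hv).mul_bdd (c := M) hψ.aestronglyMeasurable
    (Eventually.of_forall hM)
  simpa [mul_assoc] using h

/-- Pointwise form of the Caccioppoli inequality. -/
theorem caccioppoli_pointwise {lam Lam ε K₁ K₂ f h S φ τ : ℝ} {g F ψ : Fin d → ℝ} (hε : 0 < ε)
    (hφ0 : 0 ≤ φ) (hφ1 : φ ≤ 1) (hτ : τ ≤ K₂) (hK₂ : 0 ≤ K₂) (hψ : ∀ i, |ψ i| ≤ K₁)
    (h1 : lam * ∑ i, g i ^ 2 ≤ ∑ i, F i * g i) (h2 : ∑ i, F i ^ 2 ≤ Lam ^ 2 * ∑ i, g i ^ 2)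
    (h3 : h ^ 2 ≤ 2 * Lam ^ 2 * ∑ i, g i ^ 2 + 2 * S ^ 2) :
    (lam - 3 * ε * Lam ^ 2) * (φ ^ 2 * ∑ i, g i ^ 2) ≤
      ∑ i, F i * (g i * φ ^ 2) + ∑ i, F i * (f * (2 * φ * ψ i)) - h * (f * φ ^ 2) -
        1 / 2 * (f * (f * (2 * φ * τ))) + (d * K₁ ^ 2 / ε + 1 / (4 * ε) + K₂) * f ^ 2 +
        2 * ε * S ^ 2 := by
  set G := ∑ i, g i ^ 2 with hG
  have e1 : ∑ i, F i * (g i * φ ^ 2) = φ ^ 2 * ∑ i, F i * g i := by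
    rw [Finset.mul_sum]; exact Finset.sum_congr rfl fun i _ => by ring
  -- Young's inequality in each coordinate: the flux part carries φ² and a small factor ε, and the d
  -- coordinates together cost d K₁²/ε on f².
  have i1 : -(ε * φ ^ 2 * (Lam ^ 2 * G) + d * K₁ ^ 2 / ε * f ^ 2) ≤
      ∑ i, F i * (f * (2 * φ * ψ i)) := by
    have hp : ∀ i, -(ε * φ ^ 2 * F i ^ 2 + K₁ ^ 2 / ε * f ^ 2) ≤ F i * (f * (2 * φ * ψ i)) := by
      intro i
      have q : ψ i ^ 2 ≤ K₁ ^ 2 := by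
        rw [← sq_abs]; exact pow_le_pow_left₀ (abs_nonneg _) (hψ i) 2
      have q1 : ψ i ^ 2 / ε * f ^ 2 ≤ K₁ ^ 2 / ε * f ^ 2 := by gcongr
      have q2 : 0 ≤ (ε * φ * F i + f * ψ i) ^ 2 / ε := by positivity
      have q3 : (ε * φ * F i + f * ψ i) ^ 2 / ε =
          ε * φ ^ 2 * F i ^ 2 + F i * (f * (2 * φ * ψ i)) + ψ i ^ 2 / ε * f ^ 2 := by
        field_simp; ring
      linarith
    have hs := Finset.sum_le_sum fun i (_ : i ∈ Finset.univ) => hp i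
    rw [Finset.sum_neg_distrib, Finset.sum_add_distrib, ← Finset.mul_sum, Finset.sum_const,
      Finset.card_univ, Fintype.card_fin, nsmul_eq_mul] at hs
    have := mul_le_mul_of_nonneg_left h2 (by positivity : 0 ≤ ε * φ ^ 2)
    have e : d * K₁ ^ 2 / ε * f ^ 2 = d * (K₁ ^ 2 / ε * f ^ 2) := by ring
    linarith
  have hφ2 : φ ^ 2 ≤ 1 := by nlinarith
  have i2 : h * (f * φ ^ 2) ≤ ε * φ ^ 2 * (2 * Lam ^ 2 * G) + 2 * ε * S ^ 2 +
      1 / (4 * ε) * f ^ 2 := by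
    have q2 : 0 ≤ φ ^ 2 * ((2 * ε * h - f) ^ 2 / (4 * ε)) := by positivity
    have q3 : (2 * ε * h - f) ^ 2 / (4 * ε) = ε * h ^ 2 - h * f + 1 / (4 * ε) * f ^ 2 := by
      field_simp; ring
    rw [q3] at q2
    have q4 : φ ^ 2 * (1 / (4 * ε) * f ^ 2) ≤ 1 * (1 / (4 * ε) * f ^ 2) := by gcongr
    have q5 := mul_le_mul_of_nonneg_left h3 (by positivity : 0 ≤ ε * φ ^ 2)
    have q6 : φ ^ 2 * (2 * ε * S ^ 2) ≤ 1 * (2 * ε * S ^ 2) := by gcongr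
    nlinarith
  -- An upper bound on the transport derivative τ is enough, since it multiplies f²φ ≥ 0.
  have i3 : 1 / 2 * (f * (f * (2 * φ * τ))) ≤ K₂ * f ^ 2 := by
    have q : φ * τ ≤ K₂ := by
      calc φ * τ ≤ φ * K₂ := by gcongr
        _ ≤ 1 * K₂ := by gcongr
        _ = K₂ := one_mul _
    have := mul_le_mul_of_nonneg_right q (sq_nonneg f)
    nlinarith
  have i4 := mul_le_mul_of_nonneg_left h1 (sq_nonneg φ)
  rw [e1]
  nlinarith

/-- The Caccioppoli inequality. -/
theorem WeakSub.caccioppoli {V : Set (Z d)} {lam Lam ε K₁ K₂ : ℝ} {f h S φ : Z d → ℝ}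
    {g F : Fin d → Z d → ℝ} (H : WeakSub V f h g F) (hE : Elliptic lam Lam S h g F)
    (hφ : IsTest V φ) (hφ0 : ∀ z, 0 ≤ φ z) (hφ1 : ∀ z, φ z ≤ 1) (hε : 0 < ε) (hK₂ : 0 ≤ K₂)
    (hτ : ∀ z, transport φ z ≤ K₂) (hψ : ∀ i z, |dV i φ z| ≤ K₁) :
    (lam - 3 * ε * Lam ^ 2) * ∫ z, φ z ^ 2 * ∑ i, g i z ^ 2 ≤
      (d * K₁ ^ 2 / ε + 1 / (4 * ε) + K₂) * (∫ z, f z ^ 2) + 2 * ε * ∫ z, S z ^ 2 := by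
  have hφ' : ContDiff ℝ 1 φ := hφ.smooth.of_le (by exact_mod_cast le_top)
  have hd : ∀ z, DifferentiableAt ℝ φ z := fun z => hφ'.differentiable one_ne_zero z
  have e2 : (fun z => φ z ^ 2) = fun z => φ z * φ z := funext fun z => sq _
  have hη : IsTest V fun z => φ z ^ 2 := by
    refine ⟨hφ.smooth.pow 2, ?_, ?_⟩
    · rw [e2]; exact hφ.compact.mul_left
    · rw [e2]; exact (tsupport_mul_subset_left).trans hφ.support
  have hη' : ContDiff ℝ 1 fun z => φ z ^ 2 := hη.smooth.of_le (by exact_mod_cast le_top)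
  have et : ∀ z, transport (fun z => φ z ^ 2) z = 2 * φ z * transport φ z := fun z => by
    rw [e2, transport_mul (hd z) (hd z)]; ring
  have ed : ∀ i z, dV i (fun z => φ z ^ 2) z = 2 * φ z * dV i φ z := fun i z => by
    rw [e2, dV_mul (hd z) (hd z)]; ring
  -- The weight is φ², so that one factor φ accompanies ∇_v φ and the flux can be absorbed into
  -- φ²|g|².
  have key := H.energy_inequality hη fun z => sq_nonneg _
  have I1 : ∀ i, Integrable fun z => F i z * (g i z * φ z ^ 2) := fun i =>
    (H.memLp_F i).integrable_mul_mul_of_hasCompactSupport (H.memLp_g i) hη'.continuous hη.compact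
  have I2 : ∀ i, Integrable fun z => F i z * (f z * (2 * φ z * dV i φ z)) := fun i => by
    have := (H.memLp_F i).integrable_mul_mul_of_hasCompactSupport H.memLp_f
      (continuous_dV hη' i) (hη.compact.dV i)
    simpa only [ed] using this
  have I3 : Integrable fun z => h z * (f z * φ z ^ 2) :=
    H.memLp_h.integrable_mul_mul_of_hasCompactSupport H.memLp_f hη'.continuous hη.compact
  have I4 : Integrable fun z => f z * (f z * (2 * φ z * transport φ z)) := by
    have := H.memLp_f.integrable_mul_mul_of_hasCompactSupport H.memLp_f
      (continuous_transport hη') hη.compact.transport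
    simpa only [et] using this
  have I5 : Integrable fun z => φ z ^ 2 * ∑ i, g i z ^ 2 := by
    have : ∀ i, Integrable fun z => g i z * (g i z * φ z ^ 2) := fun i =>
      (H.memLp_g i).integrable_mul_mul_of_hasCompactSupport (H.memLp_g i) hη'.continuous hη.compact
    refine (integrable_finsetSum Finset.univ fun i _ => this i).congr
      (Eventually.of_forall fun z => ?_)
    simp only [Finset.mul_sum]
    exact Finset.sum_congr rfl fun i _ => by ring
  have If : Integrable fun z => f z ^ 2 := H.memLp_f.integrable_sq
  have IS : Integrable fun z => S z ^ 2 := hE.memLp_S.integrable_sq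
  have S1 := integrable_finsetSum Finset.univ fun i (_ : i ∈ Finset.univ) => I1 i
  have S2 := integrable_finsetSum Finset.univ fun i (_ : i ∈ Finset.univ) => I2 i
  have hint : (lam - 3 * ε * Lam ^ 2) * ∫ z, φ z ^ 2 * ∑ i, g i z ^ 2 ≤
      (∫ z, ∑ i, F i z * (g i z * φ z ^ 2)) + (∫ z, ∑ i, F i z * (f z * (2 * φ z * dV i φ z))) -
        (∫ z, h z * (f z * φ z ^ 2)) -
        1 / 2 * (∫ z, f z * (f z * (2 * φ z * transport φ z))) +
        (d * K₁ ^ 2 / ε + 1 / (4 * ε) + K₂) * (∫ z, f z ^ 2) + 2 * ε * ∫ z, S z ^ 2 := by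
    rw [← integral_const_mul, ← integral_const_mul, ← integral_const_mul, ← integral_const_mul,
      ← integral_add' S1 S2, ← integral_sub' (S1.add S2) I3,
      ← integral_sub' ((S1.add S2).sub I3) (I4.const_mul _),
      ← integral_add' (((S1.add S2).sub I3).sub (I4.const_mul _)) (If.const_mul _),
      ← integral_add' ((((S1.add S2).sub I3).sub (I4.const_mul _)).add (If.const_mul _))
        (IS.const_mul _)]
    refine integral_mono_ae (I5.const_mul _)
      (((((S1.add S2).sub I3).sub (I4.const_mul _)).add (If.const_mul _)).add
        (IS.const_mul _)) ?_
    filter_upwards [hE.coercive, hE.flux_le, hE.source_le] with z h1 h2 h3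
    exact caccioppoli_pointwise hε (hφ0 z) (hφ1 z) (hτ z) hK₂ (fun i => hψ i z) h1 h2 h3
  simp only [et, ed] at key
  rw [integral_finsetSum _ fun i _ => I1 i, integral_finsetSum _ fun i _ => I2 i] at hint
  linarith

/-! ### Kinetic cylinders and their cutoff functions. -/

/-- The closed cylinders, truncated at distance `η` from their final time. -/
def core (ρ η : ℝ) (z₀ : Z d) : Set (Z d) :=
  {z | -ρ ^ 2 ≤ z.1 - z₀.1 ∧ z.1 - z₀.1 ≤ -η ∧
    ‖z.2.1 - z₀.2.1 - (z.1 - z₀.1) • z₀.2.2‖ ≤ ρ ^ 3 ∧ ‖z.2.2 - z₀.2.2‖ ≤ ρ}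

/-- The interior of the kinetic cylinder. -/
def openCylinder (ρ : ℝ) (z₀ : Z d) : Set (Z d) :=
  {z | -ρ ^ 2 < z.1 - z₀.1 ∧ z.1 - z₀.1 < 0 ∧
    ‖z.2.1 - z₀.2.1 - (z.1 - z₀.1) • z₀.2.2‖ < ρ ^ 3 ∧ ‖z.2.2 - z₀.2.2‖ < ρ}

theorem isOpen_openCylinder (ρ : ℝ) (z₀ : Z d) : IsOpen (openCylinder ρ z₀) := by
  refine IsOpen.and ?_ (IsOpen.and ?_ (IsOpen.and ?_ ?_)) <;>
  exact isOpen_lt (by fun_prop) (by fun_prop)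

theorem openCylinder_subset (ρ : ℝ) (z₀ : Z d) : openCylinder ρ z₀ ⊆ cylinder ρ z₀ :=
  fun _ hz => ⟨hz.1, hz.2.1.le, hz.2.2⟩

theorem core_subset_openCylinder {a b η : ℝ} (z₀ : Z d) (ha : 0 ≤ a) (hab : a < b) (hη : 0 < η) :
    core a η z₀ ⊆ openCylinder b z₀ := by
  rintro z ⟨h1, h2, h3, h4⟩
  have := pow_lt_pow_left₀ hab ha two_ne_zero
  exact ⟨by linarith, by linarith, h3.trans_lt (pow_lt_pow_left₀ hab ha three_ne_zero),
    h4.trans_lt hab⟩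

theorem isCompact_core (ρ η : ℝ) (z₀ : Z d) : IsCompact (core ρ η z₀) := by
  have hK : IsCompact ((Icc (-ρ ^ 2) (-η)) ×ˢ (Metric.closedBall (0 : E d) (ρ ^ 3)) ×ˢ
      (Metric.closedBall (0 : E d) ρ)) :=
    isCompact_Icc.prod ((isCompact_closedBall _ _).prod (isCompact_closedBall _ _))
  have hc : Continuous fun y : Z d =>
    ((z₀.1 + y.1, z₀.2.1 + y.1 • z₀.2.2 + y.2.1, z₀.2.2 + y.2.2) : Z d) := by fun_prop
  refine (hK.image hc).of_isClosed_subset ?_ ?_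
  · refine IsClosed.and ?_ (IsClosed.and ?_ (IsClosed.and ?_ ?_)) <;>
    exact isClosed_le (by fun_prop) (by fun_prop)
  · rintro z ⟨h1, h2, h3, h4⟩
    refine ⟨(z.1 - z₀.1, z.2.1 - z₀.2.1 - (z.1 - z₀.1) • z₀.2.2, z.2.2 - z₀.2.2),
      ⟨⟨h1, h2⟩, by simpa using h3, by simpa using h4⟩, ?_⟩
    ext <;> simp

section SmoothTransition

open Real

theorem deriv_smoothTransition_nonneg (x : ℝ) : 0 ≤ deriv smoothTransition x :=
  smoothTransition.monotone.deriv_nonneg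

theorem deriv_smoothTransition_of_neg {x : ℝ} (hx : x < 0) : deriv smoothTransition x = 0 := by
  have : smoothTransition =ᶠ[𝓝 x] fun _ => 0 := by
    filter_upwards [gt_mem_nhds hx] with y hy
    exact smoothTransition.zero_of_nonpos hy.le
  rw [this.deriv_eq]; simp

theorem deriv_smoothTransition_of_one_lt {x : ℝ} (hx : 1 < x) : deriv smoothTransition x = 0 := by
  have : smoothTransition =ᶠ[𝓝 x] fun _ => 1 := by
    filter_upwards [lt_mem_nhds hx] with y hy
    exact smoothTransition.one_of_one_le hy.le
  rw [this.deriv_eq]; simp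

theorem exists_deriv_smoothTransition_le :
    ∃ M : ℝ, 1 ≤ M ∧ ∀ x, deriv smoothTransition x ≤ M := by
  have hc : Continuous (deriv smoothTransition) :=
    (smoothTransition.contDiff (n := 1)).continuous_deriv (by norm_num)
  have hs : HasCompactSupport (deriv smoothTransition) :=
    HasCompactSupport.intro (isCompact_Icc (a := (0 : ℝ)) (b := 1)) fun x hx => by
      by_cases h : x < 0
      · exact deriv_smoothTransition_of_neg h
      · refine deriv_smoothTransition_of_one_lt ?_
        by_contra h1
        exact hx ⟨not_lt.1 h, not_lt.1 h1⟩
  obtain ⟨M, hM⟩ := hs.exists_bound_of_continuous hc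
  exact ⟨max M 1, le_max_right _ _, fun x => ((le_abs_self _).trans (hM x)).trans (le_max_left _ _)⟩

theorem hasDerivAt_smoothTransition (x : ℝ) :
    HasDerivAt smoothTransition (deriv smoothTransition x) x :=
  ((smoothTransition.contDiff (n := 1)).differentiable one_ne_zero x).hasDerivAt

end SmoothTransition

/-- A cutoff function adapted to the cylinders of radii `a < b`. -/
def cutoff (a b η : ℝ) (z₀ : Z d) (z : Z d) : ℝ :=
  Real.smoothTransition ((z.1 - z₀.1 + b ^ 2) / (b ^ 2 - a ^ 2)) *
    Real.smoothTransition ((-(z.1 - z₀.1) - η / 2) / (η / 2)) *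
    Real.smoothTransition
      ((b ^ 6 - ‖z.2.1 - z₀.2.1 - (z.1 - z₀.1) • z₀.2.2‖ ^ 2) / (b ^ 6 - a ^ 6)) *
    Real.smoothTransition ((b ^ 2 - ‖z.2.2 - z₀.2.2‖ ^ 2) / (b ^ 2 - a ^ 2))

namespace cutoff

variable {a b η : ℝ} {z₀ : Z d}

/-- Squared norms in the arguments avoid the non-differentiability of the norm at the axis; this
explains the sixth powers of the radii. -/
theorem smooth : ContDiff ℝ ((⊤ : ℕ∞) : WithTop ℕ∞) (cutoff a b η z₀) := by
  have h : ContDiff ℝ ((⊤ : ℕ∞) : WithTop ℕ∞) Real.smoothTransition :=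
    Real.smoothTransition.contDiff
  have e1 : ContDiff ℝ ((⊤ : ℕ∞) : WithTop ℕ∞) fun z : Z d =>
      ‖z.2.1 - z₀.2.1 - (z.1 - z₀.1) • z₀.2.2‖ ^ 2 := ContDiff.norm_sq ℝ (by fun_prop)
  have e2 : ContDiff ℝ ((⊤ : ℕ∞) : WithTop ℕ∞) fun z : Z d => ‖z.2.2 - z₀.2.2‖ ^ 2 :=
    ContDiff.norm_sq ℝ (by fun_prop)
  refine ((ContDiff.mul ?_ ?_).mul ?_).mul ?_
  · exact h.comp (by fun_prop)
  · exact h.comp (by fun_prop)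
  · exact h.comp ((contDiff_const.sub e1).div_const _)
  · exact h.comp ((contDiff_const.sub e2).div_const _)

theorem nonneg (z : Z d) : 0 ≤ cutoff a b η z₀ z := by
  unfold cutoff
  have := Real.smoothTransition.nonneg
  exact mul_nonneg (mul_nonneg (mul_nonneg (this _) (this _)) (this _)) (this _)

theorem mul_le_one_of_mem {x y : ℝ} (hx : x ≤ 1) (hy0 : 0 ≤ y) (hy : y ≤ 1) : x * y ≤ 1 := by
  nlinarith

theorem le_one (z : Z d) : cutoff a b η z₀ z ≤ 1 := by
  unfold cutoff
  have h0 := Real.smoothTransition.nonneg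
  have h1 := Real.smoothTransition.le_one
  exact mul_le_one_of_mem (mul_le_one_of_mem (mul_le_one_of_mem (h1 _) (h0 _) (h1 _)) (h0 _) (h1 _))
    (h0 _) (h1 _)

theorem eq_one (ha : 0 < a) (hab : a < b) (hη : 0 < η) {z : Z d} (hz : z ∈ core a η z₀) :
    cutoff a b η z₀ z = 1 := by
  obtain ⟨h1, h2, h3, h4⟩ := hz
  have p2 := pow_lt_pow_left₀ hab ha.le two_ne_zero
  have p6 := pow_lt_pow_left₀ hab ha.le (by norm_num : 6 ≠ 0)
  have q3 := pow_le_pow_left₀ (norm_nonneg _) h3 2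
  have q4 := pow_le_pow_left₀ (norm_nonneg _) h4 2
  have one := @Real.smoothTransition.one_of_one_le
  unfold cutoff
  rw [one, one, one, one]
  · norm_num
  · rw [le_div_iff₀ (by linarith)]; linarith
  · rw [le_div_iff₀ (by linarith)]; nlinarith
  · rw [le_div_iff₀ (by linarith)]; linarith
  · rw [le_div_iff₀ (by linarith)]; linarith

theorem mem_core (ha : 0 < a) (hab : a < b) (hη : 0 < η) {z : Z d} (hz : cutoff a b η z₀ z ≠ 0) :
    z ∈ core b (η / 2) z₀ := by
  have p2 := pow_lt_pow_left₀ hab ha.le two_ne_zero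
  have p6 := pow_lt_pow_left₀ hab ha.le (by norm_num : 6 ≠ 0)
  have hb : 0 < b := ha.trans hab
  have pos : ∀ x, Real.smoothTransition x ≠ 0 → 0 < x := fun x hx => by
    by_contra h
    exact hx (Real.smoothTransition.zero_of_nonpos (not_lt.1 h))
  unfold cutoff at hz
  simp only [mul_ne_zero_iff] at hz
  obtain ⟨⟨⟨h1, h2⟩, h3⟩, h4⟩ := hz
  have h1 := (div_pos_iff_of_pos_right (by linarith)).1 (pos _ h1)
  have h2 := (div_pos_iff_of_pos_right (by linarith)).1 (pos _ h2)
  have h3 := (div_pos_iff_of_pos_right (by linarith)).1 (pos _ h3)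
  have h4 := (div_pos_iff_of_pos_right (by linarith)).1 (pos _ h4)
  refine ⟨by linarith, by linarith, ?_, ?_⟩
  · refine le_of_sq_le_sq ?_ (by positivity)
    rw [← pow_mul]; norm_num; linarith
  · exact le_of_sq_le_sq (by linarith) hb.le

/-- Only an upper bound is uniform in η: the factor switching off before the final time has a
nonpositive derivative, of size up to 1/η, which is dropped. The initial-time factor contributes
M/(b-a)² and the position factor 2M/(b-a)². Since 𝒯 moves the centred position ξ at speed v - v₀ and
not v, the bound does not involve v₀. -/
theorem transport_le {M : ℝ} (hM : ∀ x, deriv Real.smoothTransition x ≤ M) (ha : 0 < a)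
    (hab : a < b) (hη : 0 < η) (z : Z d) :
    transport (cutoff a b η z₀) z ≤ 3 * M / (b - a) ^ 2 := by
  have hb : 0 < b := ha.trans hab
  have p2 : (b - a) ^ 2 ≤ b ^ 2 - a ^ 2 := by nlinarith
  have hba : 0 < b - a := sub_pos.2 hab
  have p6 : (b - a) * b ^ 5 ≤ b ^ 6 - a ^ 6 := by
    have : a ^ 6 ≤ a * b ^ 5 := by
      rw [show a ^ 6 = a * a ^ 5 by ring]; gcongr
    nlinarith
  have p2' : 0 < b ^ 2 - a ^ 2 := lt_of_lt_of_le (by positivity) p2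
  have p6' : 0 < b ^ 6 - a ^ 6 := lt_of_lt_of_le (by positivity) p6
  have hM0 : 0 ≤ M := (deriv_smoothTransition_nonneg 0).trans (hM 0)
  set ξ := z.2.1 - z₀.2.1 - (z.1 - z₀.1) • z₀.2.2 with hξ
  set w := z.2.2 - z₀.2.2 with hw
  have hline : HasDerivAt (fun τ : ℝ => z + τ • ((1, z.2.2, 0) : Z d)) (1, z.2.2, 0) 0 := by
    simpa using ((hasDerivAt_id (0 : ℝ)).smul_const ((1, z.2.2, 0) : Z d)).const_add z
  have hd : HasDerivAt (fun τ : ℝ => cutoff a b η z₀ (z + τ • ((1, z.2.2, 0) : Z d)))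
      (transport (cutoff a b η z₀) z) 0 := by
    have h0 : HasFDerivAt (cutoff a b η z₀) (fderiv ℝ (cutoff a b η z₀) z)
        (z + (0 : ℝ) • ((1, z.2.2, 0) : Z d)) := by
      rw [zero_smul, add_zero]
      exact (smooth.differentiable (by simp) z).hasFDerivAt
    exact h0.comp_hasDerivAt 0 hline
  have e : (fun τ : ℝ => cutoff a b η z₀ (z + τ • ((1, z.2.2, 0) : Z d))) = fun τ =>
      Real.smoothTransition ((z.1 + τ - z₀.1 + b ^ 2) / (b ^ 2 - a ^ 2)) *
      Real.smoothTransition ((-(z.1 + τ - z₀.1) - η / 2) / (η / 2)) *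
      Real.smoothTransition ((b ^ 6 - ‖ξ + τ • w‖ ^ 2) / (b ^ 6 - a ^ 6)) *
      Real.smoothTransition ((b ^ 2 - ‖w‖ ^ 2) / (b ^ 2 - a ^ 2)) := by
    funext τ
    have : z.2.1 + τ • z.2.2 - z₀.2.1 - (z.1 + τ - z₀.1) • z₀.2.2 = ξ + τ • w := by
      rw [hξ, hw]; module
    simp [cutoff, this, hw]
  rw [e] at hd
  have g1 : HasDerivAt (fun τ : ℝ => (z.1 + τ - z₀.1 + b ^ 2) / (b ^ 2 - a ^ 2))
      (1 / (b ^ 2 - a ^ 2)) 0 :=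
    ((((hasDerivAt_id (0 : ℝ)).const_add z.1).sub_const z₀.1).add_const _).div_const _
  have g2 : HasDerivAt (fun τ : ℝ => (-(z.1 + τ - z₀.1) - η / 2) / (η / 2))
      (-1 / (η / 2)) 0 :=
    ((((hasDerivAt_id (0 : ℝ)).const_add z.1).sub_const z₀.1).neg.sub_const _).div_const _
  have g3 : HasDerivAt (fun τ : ℝ => (b ^ 6 - ‖ξ + τ • w‖ ^ 2) / (b ^ 6 - a ^ 6))
      (-(2 * inner ℝ ξ w) / (b ^ 6 - a ^ 6)) 0 := by
    have h0 : HasDerivAt (fun τ : ℝ => ξ + τ • w) w 0 := by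
      simpa using ((hasDerivAt_id (0 : ℝ)).smul_const w).const_add ξ
    have := ((h0.norm_sq.const_sub (b ^ 6)).div_const (b ^ 6 - a ^ 6))
    simpa using this
  have s1 := HasDerivAt.comp (0 : ℝ) (hasDerivAt_smoothTransition _) g1
  have s2 := HasDerivAt.comp (0 : ℝ) (hasDerivAt_smoothTransition _) g2
  have s3 := HasDerivAt.comp (0 : ℝ) (hasDerivAt_smoothTransition _) g3
  have hd' := ((s1.mul s2).mul s3).mul_const
    (Real.smoothTransition ((b ^ 2 - ‖w‖ ^ 2) / (b ^ 2 - a ^ 2)))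
  rw [hd.unique hd']
  simp only [Function.comp, Pi.mul_apply, add_zero, zero_smul]
  have n0 := Real.smoothTransition.nonneg
  have n1 := Real.smoothTransition.le_one
  set T1 := Real.smoothTransition ((z.1 - z₀.1 + b ^ 2) / (b ^ 2 - a ^ 2))
  set T2 := Real.smoothTransition ((-(z.1 - z₀.1) - η / 2) / (η / 2))
  set T3 := Real.smoothTransition ((b ^ 6 - ‖ξ‖ ^ 2) / (b ^ 6 - a ^ 6)) with hT3
  set T4 := Real.smoothTransition ((b ^ 2 - ‖w‖ ^ 2) / (b ^ 2 - a ^ 2)) with hT4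
  have a1 : 0 ≤ T1 ∧ T1 ≤ 1 := ⟨n0 _, n1 _⟩
  have a2 : 0 ≤ T2 ∧ T2 ≤ 1 := ⟨n0 _, n1 _⟩
  have a3 : 0 ≤ T3 ∧ T3 ≤ 1 := ⟨n0 _, n1 _⟩
  have a4 : 0 ≤ T4 ∧ T4 ≤ 1 := ⟨n0 _, n1 _⟩
  set D1 := deriv Real.smoothTransition ((z.1 - z₀.1 + b ^ 2) / (b ^ 2 - a ^ 2))
  set D2 := deriv Real.smoothTransition ((-(z.1 - z₀.1) - η / 2) / (η / 2))
  set D3 := deriv Real.smoothTransition ((b ^ 6 - ‖ξ‖ ^ 2) / (b ^ 6 - a ^ 6)) with hD3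
  have d1 : 0 ≤ D1 ∧ D1 ≤ M := ⟨deriv_smoothTransition_nonneg _, hM _⟩
  have d2 : 0 ≤ D2 ∧ D2 ≤ M := ⟨deriv_smoothTransition_nonneg _, hM _⟩
  have d3 : 0 ≤ D3 ∧ D3 ≤ M := ⟨deriv_smoothTransition_nonneg _, hM _⟩
  have b1 : D1 * (1 / (b ^ 2 - a ^ 2)) ≤ M / (b - a) ^ 2 := by
    rw [mul_one_div]
    exact div_le_div₀ hM0 d1.2 (by positivity) p2
  have b1' : 0 ≤ D1 * (1 / (b ^ 2 - a ^ 2)) := mul_nonneg d1.1 (by positivity)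
  have b2 : D2 * (-1 / (η / 2)) ≤ 0 :=
    mul_nonpos_of_nonneg_of_nonpos d2.1 (div_nonpos_of_nonpos_of_nonneg (by norm_num) (by linarith))
  -- Where the product does not vanish, |ξ| ≤ b³ and |w| ≤ b, so the numerator is at most 2b⁴. Then
  -- b⁶ - a⁶ ≥ (b-a)b⁵ and b ≥ b-a give 2/(b-a)².
  have b3 : D3 * (-(2 * inner ℝ ξ w) / (b ^ 6 - a ^ 6)) * T4 ≤ 2 * M / (b - a) ^ 2 := by
    by_cases hξb : ‖ξ‖ ≤ b ^ 3
    swap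
    · have : D3 = 0 := deriv_smoothTransition_of_neg (div_neg_of_neg_of_pos (by
        have := pow_lt_pow_left₀ (not_le.1 hξb) (by positivity) two_ne_zero
        rw [← pow_mul] at this; norm_num at this; linarith) p6')
      rw [this]; simp only [zero_mul]; positivity
    by_cases hwb : ‖w‖ ≤ b
    swap
    · have : T4 = 0 := Real.smoothTransition.zero_of_nonpos (div_nonpos_of_nonpos_of_nonneg (by
        have := pow_lt_pow_left₀ (not_le.1 hwb) (by positivity) two_ne_zero
        linarith) p2'.le)
      rw [this, mul_zero]; positivity
    have hin : -(2 * inner ℝ ξ w) ≤ 2 * b ^ 4 := by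
      have h1 := neg_abs_le (inner ℝ ξ w : ℝ)
      have h2 := abs_real_inner_le_norm ξ w
      have h3 : ‖ξ‖ * ‖w‖ ≤ b ^ 3 * b := by gcongr
      nlinarith
    have hq : -(2 * inner ℝ ξ w) / (b ^ 6 - a ^ 6) ≤ 2 / (b - a) ^ 2 := by
      calc -(2 * inner ℝ ξ w) / (b ^ 6 - a ^ 6) ≤ 2 * b ^ 4 / (b ^ 6 - a ^ 6) := by gcongr
        _ ≤ 2 * b ^ 4 / ((b - a) * b ^ 5) := by gcongr
        _ = 2 / ((b - a) * b) := by field_simp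
        _ ≤ 2 / (b - a) ^ 2 := by
          rw [sq]; gcongr; linarith
    have hq0 : 0 ≤ 2 / (b - a) ^ 2 := by positivity
    calc D3 * (-(2 * inner ℝ ξ w) / (b ^ 6 - a ^ 6)) * T4
        ≤ D3 * (2 / (b - a) ^ 2) * T4 := by
          have := d3.1; have := a4.1; gcongr
      _ ≤ M * (2 / (b - a) ^ 2) * 1 := by
          have := d3.2; have := a4.1; have := a4.2; gcongr
      _ = 2 * M / (b - a) ^ 2 := by ring
  have hK1 : 0 ≤ M / (b - a) ^ 2 := by positivity
  have hK2 : 0 ≤ 2 * M / (b - a) ^ 2 := by positivity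
  have c1 : D1 * (1 / (b ^ 2 - a ^ 2)) * T2 * T3 * T4 ≤ M / (b - a) ^ 2 := by
    calc D1 * (1 / (b ^ 2 - a ^ 2)) * T2 * T3 * T4
        ≤ M / (b - a) ^ 2 * 1 * 1 * 1 := by
          have := a2.1; have := a3.1; have := a4.1; have := a2.2; have := a3.2; have := a4.2
          gcongr
      _ = _ := by ring
  have c2 : D2 * (-1 / (η / 2)) * (T1 * T3 * T4) ≤ 0 :=
    mul_nonpos_of_nonpos_of_nonneg b2 (mul_nonneg (mul_nonneg a1.1 a3.1) a4.1)
  have c3 : D3 * (-(2 * inner ℝ ξ w) / (b ^ 6 - a ^ 6)) * T4 * (T1 * T2) ≤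
      2 * M / (b - a) ^ 2 := by
    have t0 : 0 ≤ T1 * T2 := mul_nonneg a1.1 a2.1
    calc D3 * (-(2 * inner ℝ ξ w) / (b ^ 6 - a ^ 6)) * T4 * (T1 * T2)
        ≤ 2 * M / (b - a) ^ 2 * (T1 * T2) := by gcongr
      _ ≤ 2 * M / (b - a) ^ 2 * 1 := by
        gcongr; exact mul_le_one_of_mem a1.2 a2.1 a2.2
      _ = _ := mul_one _
  have tot : 3 * M / (b - a) ^ 2 = M / (b - a) ^ 2 + 2 * M / (b - a) ^ 2 := by ring
  rw [tot]
  nlinarith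

/-- Only the last factor depends on the velocity, because the cylinder is slanted along v₀ and not
along v. -/
theorem abs_dV_le {M : ℝ} (hM : ∀ x, deriv Real.smoothTransition x ≤ M) (ha : 0 < a)
    (hab : a < b) (i : Fin d) (z : Z d) :
    |dV i (cutoff a b η z₀) z| ≤ 2 * M / (b - a) := by
  have hb : 0 < b := ha.trans hab
  have hba : 0 < b - a := sub_pos.2 hab
  have p2' : 0 < b ^ 2 - a ^ 2 := by nlinarith
  have hM0 : 0 ≤ M := (deriv_smoothTransition_nonneg 0).trans (hM 0)
  set w := z.2.2 - z₀.2.2 with hw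
  have hline : HasDerivAt (fun τ : ℝ => z + τ • (ev i : Z d)) (ev i) 0 := by
    simpa using ((hasDerivAt_id (0 : ℝ)).smul_const (ev i : Z d)).const_add z
  have hd : HasDerivAt (fun τ : ℝ => cutoff a b η z₀ (z + τ • (ev i : Z d)))
      (dV i (cutoff a b η z₀) z) 0 := by
    have h0 : HasFDerivAt (cutoff a b η z₀) (fderiv ℝ (cutoff a b η z₀) z)
        (z + (0 : ℝ) • (ev i : Z d)) := by
      rw [zero_smul, add_zero]
      exact (smooth.differentiable (by simp) z).hasFDerivAt
    exact h0.comp_hasDerivAt 0 hline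
  set P := Real.smoothTransition ((z.1 - z₀.1 + b ^ 2) / (b ^ 2 - a ^ 2)) *
    Real.smoothTransition ((-(z.1 - z₀.1) - η / 2) / (η / 2)) *
    Real.smoothTransition
      ((b ^ 6 - ‖z.2.1 - z₀.2.1 - (z.1 - z₀.1) • z₀.2.2‖ ^ 2) / (b ^ 6 - a ^ 6)) with hP
  have e : (fun τ : ℝ => cutoff a b η z₀ (z + τ • (ev i : Z d))) = fun τ => P *
      Real.smoothTransition ((b ^ 2 - ‖w + τ • EuclideanSpace.single i (1 : ℝ)‖ ^ 2) /
        (b ^ 2 - a ^ 2)) := by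
    funext τ
    have : z.2.2 + τ • EuclideanSpace.single i (1 : ℝ) - z₀.2.2 =
        w + τ • EuclideanSpace.single i (1 : ℝ) := by rw [hw]; abel
    simp only [cutoff, ev, Prod.fst_add, Prod.snd_add, Prod.smul_fst, Prod.smul_snd, smul_zero,
      add_zero, this, hP]
  rw [e] at hd
  have g3 : HasDerivAt (fun τ : ℝ => (b ^ 2 - ‖w + τ • EuclideanSpace.single i (1 : ℝ)‖ ^ 2) /
      (b ^ 2 - a ^ 2)) (-(2 * w i) / (b ^ 2 - a ^ 2)) 0 := by
    have h0 : HasDerivAt (fun τ : ℝ => w + τ • EuclideanSpace.single i (1 : ℝ))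
        (EuclideanSpace.single i 1) 0 := by
      simpa using ((hasDerivAt_id (0 : ℝ)).smul_const
        (EuclideanSpace.single i (1 : ℝ))).const_add w
    have := ((h0.norm_sq.const_sub (b ^ 2)).div_const (b ^ 2 - a ^ 2))
    simpa [EuclideanSpace.inner_single_right] using this
  have s3 := (HasDerivAt.comp (0 : ℝ) (hasDerivAt_smoothTransition _) g3).const_mul P
  rw [hd.unique s3]
  simp only [zero_smul, add_zero]
  have n0 := Real.smoothTransition.nonneg
  have n1 := Real.smoothTransition.le_one
  have P0 : 0 ≤ P := mul_nonneg (mul_nonneg (n0 _) (n0 _)) (n0 _)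
  have P1 : P ≤ 1 :=
    mul_le_one_of_mem (mul_le_one_of_mem (n1 _) (n0 _) (n1 _)) (n0 _) (n1 _)
  set D := deriv Real.smoothTransition ((b ^ 2 - ‖w‖ ^ 2) / (b ^ 2 - a ^ 2)) with hD
  have d3 : 0 ≤ D ∧ D ≤ M := ⟨deriv_smoothTransition_nonneg _, hM _⟩
  rw [abs_mul P, abs_mul D, abs_of_nonneg P0, abs_of_nonneg d3.1]
  by_cases hwb : ‖w‖ ≤ b
  swap
  · have : D = 0 := deriv_smoothTransition_of_neg (div_neg_of_neg_of_pos (by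
      have := pow_lt_pow_left₀ (not_le.1 hwb) (by positivity) two_ne_zero
      linarith) p2')
    rw [this]; simp only [zero_mul, mul_zero]; positivity
  have hwi : |w i| ≤ b := (PiLp.norm_apply_le w i).trans hwb
  have hq : |-(2 * w i) / (b ^ 2 - a ^ 2)| ≤ 2 / (b - a) := by
    rw [abs_div, abs_neg, abs_mul, abs_two, abs_of_pos p2', div_le_div_iff₀ p2' hba]
    nlinarith
  calc P * (D * |-(2 * w i) / (b ^ 2 - a ^ 2)|) ≤ 1 * (M * (2 / (b - a))) := by
        have := d3.1; have := d3.2; gcongr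
    _ = 2 * M / (b - a) := by ring

theorem tsupport_subset (ha : 0 < a) (hab : a < b) (hη : 0 < η) :
    tsupport (cutoff a b η z₀) ⊆ core b (η / 2) z₀ :=
  closure_minimal (fun _ hz => mem_core ha hab hη hz) (isCompact_core _ _ _).isClosed

theorem isTest {R : ℝ} (ha : 0 < a) (hab : a < b) (hbR : b < R) (hη : 0 < η) :
    IsTest (openCylinder R z₀) (cutoff a b η z₀) where
  smooth := smooth
  compact := (isCompact_core _ _ _).of_isClosed_subset (isClosed_tsupport _)
    (tsupport_subset ha hab hη)
  support := (tsupport_subset ha hab hη).trans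
    (core_subset_openCylinder z₀ (ha.trans hab).le hbR (by linarith))

end cutoff

/-! ### Localization of weak sub-solutions. -/

/-- The localized right-hand side: it controls all the terms of the equation satisfied by
`f φ`. -/
def locBound (φ f h : Z d → ℝ) (g F : Fin d → Z d → ℝ) (z : Z d) : ℝ :=
  (∑ i, (|F i z * φ z| + |F i z * dV i φ z| + |g i z * φ z| + |f z * dV i φ z|)) +
    |h z * φ z| + |f z * max (transport φ z) 0|

section LocBound

variable {φ f h : Z d → ℝ} {g F : Fin d → Z d → ℝ}

theorem locBound_nonneg (z : Z d) : 0 ≤ locBound φ f h g F z := by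
  unfold locBound; positivity

theorem le_locBound (i : Fin d) (z : Z d) :
    |F i z * φ z| ≤ locBound φ f h g F z ∧
      |g i z * φ z| + |f z * dV i φ z| ≤ locBound φ f h g F z := by
  have h1 := Finset.single_le_sum
    (f := fun i => |F i z * φ z| + |F i z * dV i φ z| + |g i z * φ z| + |f z * dV i φ z|)
    (fun i _ => by positivity) (Finset.mem_univ i)
  have h2 : |F i z * φ z| + |F i z * dV i φ z| + |g i z * φ z| + |f z * dV i φ z| ≤
      locBound φ f h g F z := by
    unfold locBound
    have := abs_nonneg (h z * φ z)
    have := abs_nonneg (f z * max (transport φ z) 0)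
    linarith
  have := abs_nonneg (F i z * φ z)
  have := abs_nonneg (F i z * dV i φ z)
  have := abs_nonneg (g i z * φ z)
  have := abs_nonneg (f z * dV i φ z)
  exact ⟨by linarith, by linarith⟩

theorem le_locBound_source (z : Z d) :
    |h z * φ z| + |f z * max (transport φ z) 0| + ∑ i, |F i z * dV i φ z| ≤
      locBound φ f h g F z := by
  have : ∑ i, |F i z * dV i φ z| ≤
      ∑ i, (|F i z * φ z| + |F i z * dV i φ z| + |g i z * φ z| + |f z * dV i φ z|) := by
    refine Finset.sum_le_sum fun i _ => ?_
    have := abs_nonneg (F i z * φ z)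
    have := abs_nonneg (g i z * φ z)
    have := abs_nonneg (f z * dV i φ z)
    linarith
  unfold locBound
  linarith

theorem dV_eq_zero_of_notMem {i : Fin d} {z : Z d} (hz : z ∉ tsupport φ) : dV i φ z = 0 := by
  rw [dV, image_eq_zero_of_notMem_tsupport fun h => hz (tsupport_fderiv_subset ℝ h)]; simp

theorem transport_eq_zero_of_notMem {z : Z d} (hz : z ∉ tsupport φ) : transport φ z = 0 := by
  rw [transport, image_eq_zero_of_notMem_tsupport fun h => hz (tsupport_fderiv_subset ℝ h)]; simp

theorem locBound_eq_zero_of_notMem {z : Z d} (hz : z ∉ tsupport φ) :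
    locBound φ f h g F z = 0 := by
  simp [locBound, image_eq_zero_of_notMem_tsupport hz, dV_eq_zero_of_notMem hz,
    transport_eq_zero_of_notMem hz]

theorem L2Lim.locBound {fn hn : ℕ → Z d → ℝ} {gn Fn : Fin d → ℕ → Z d → ℝ} (Lf : L2Lim fn f)
    (Lh : L2Lim hn h) (Lg : ∀ i, L2Lim (gn i) (g i)) (LF : ∀ i, L2Lim (Fn i) (F i))
    (hφ : ContDiff ℝ 1 φ) (hs : HasCompactSupport φ) :
    L2Lim (fun n => locBound φ (fn n) (hn n) (fun i => gn i n) (fun i => Fn i n))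
      (locBound φ f h g F) := by
  have hmax : HasCompactSupport fun z => max (transport φ z) 0 := by
    refine hs.transport.mono fun z hz => ?_
    contrapose! hz
    simp only [Function.mem_support, not_not] at hz ⊢
    simp [hz]
  have key := ((L2Lim.sum Finset.univ fun i _ =>
    ((((LF i).mul_bounded hφ.continuous hs).abs.add
      ((LF i).mul_bounded (continuous_dV hφ i) (hs.dV i)).abs).add
      ((Lg i).mul_bounded hφ.continuous hs).abs).add
      (Lf.mul_bounded (continuous_dV hφ i) (hs.dV i)).abs).add
    (Lh.mul_bounded hφ.continuous hs).abs).add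
    (Lf.mul_bounded ((continuous_transport hφ).max continuous_const) hmax).abs
  convert key using 1
  · funext n z
    simp [KineticFP.locBound]
  · funext z
    simp [KineticFP.locBound]

end LocBound

namespace WeakSub

variable {V : Set (Z d)} {f h : Z d → ℝ} {g F : Fin d → Z d → ℝ}

/-- By the product rule 𝒯(fₙφ) - ∇_v·(Fₙφ) ≤ hₙφ + fₙ𝒯φ - Fₙ·∇_vφ. Since fₙ ≥ 0, only the positive
part of 𝒯φ matters, and that part is bounded uniformly in the truncation at the final time. -/
theorem eventually_smoothSub (H : WeakSub V f h g F) {φ : Z d → ℝ} (hφ : IsTest V φ)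
    (h0 : ∀ z, 0 ≤ φ z) {t₀ : ℝ} (hw : ∀ z, φ z ≠ 0 → t₀ - 1 < z.1 ∧ z.1 ≤ t₀) :
    ∀ᶠ n in atTop, SmoothSub t₀ (fun z => moll (mollSeq d n) f z * φ z)
      (fun i z => moll (mollSeq d n) (F i) z * φ z)
      (locBound φ (moll (mollSeq d n) f) (moll (mollSeq d n) h)
        (fun i => moll (mollSeq d n) (g i)) fun i => moll (mollSeq d n) (F i)) := by
  have hφ1 : ContDiff ℝ 1 φ := hφ.smooth.of_le (by exact_mod_cast le_top)
  filter_upwards [H.eventually_moll hφ.compact hφ.support] with n hn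
  have cf := contDiff_moll_mollSeq H.memLp_f n
  have ch := contDiff_moll_mollSeq H.memLp_h n
  have cg := fun i => contDiff_moll_mollSeq (H.memLp_g i) n
  have cF := fun i => contDiff_moll_mollSeq (H.memLp_F i) n
  have hf0 := H.moll_nonneg n
  set fn := moll (mollSeq d n) f
  set hn' := moll (mollSeq d n) h
  set gn := fun i => moll (mollSeq d n) (g i)
  set Fn := fun i => moll (mollSeq d n) (F i)
  have hdφ : ∀ z, DifferentiableAt ℝ φ z := fun z => hφ1.differentiable one_ne_zero z
  have hdf : ∀ z, DifferentiableAt ℝ fn z := fun z => cf.differentiable one_ne_zero z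
  have hdF : ∀ i z, DifferentiableAt ℝ (Fn i) z := fun i z =>
    (cF i).differentiable one_ne_zero z
  refine ⟨cf.mul hφ1, hφ.compact.mul_left, fun i => (cF i).mul hφ1, fun i => hφ.compact.mul_left,
    fun z hz => hw z (right_ne_zero_of_mul hz), ?_, locBound_nonneg, fun i z =>
      (le_locBound (g := gn) (F := Fn) i z).1,
    fun i z => ?_, fun z => ?_⟩
  · have m1 := hφ1.continuous.measurable
    have m2 := fun i => (continuous_dV hφ1 i).measurable
    have m3 := (continuous_transport hφ1).measurable
    have m4 := cf.continuous.measurable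
    have m5 := ch.continuous.measurable
    have m6 := fun i => (cg i).continuous.measurable
    have m7 := fun i => (cF i).continuous.measurable
    unfold locBound
    refine ((Finset.measurable_fun_sum _ fun i _ => ?_).add ?_).add ?_
    · exact ((((m7 i).mul m1).abs.add ((m7 i).mul (m2 i)).abs).add ((m6 i).mul m1).abs).add
        (m4.mul (m2 i)).abs
    · exact (m5.mul m1).abs
    · exact (m4.mul (m3.max measurable_const)).abs
  · refine le_trans ?_ (le_locBound (g := gn) (F := Fn) i z).2
    rw [dV_mul (hdf z) (hdφ z)]
    by_cases hz : z ∈ tsupport φ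
    · rw [(hn z hz).1 i]
      calc |fn z * dV i φ z + φ z * gn i z| ≤ |fn z * dV i φ z| + |φ z * gn i z| := abs_add_le _ _
        _ = |gn i z * φ z| + |fn z * dV i φ z| := by rw [mul_comm (φ z), add_comm]
    · simp [image_eq_zero_of_notMem_tsupport hz, dV_eq_zero_of_notMem hz]
  · refine le_trans ?_ (le_locBound_source (g := gn) (F := Fn) z)
    rw [transport_mul (hdf z) (hdφ z)]
    by_cases hz : z ∈ tsupport φ
    · have e : ∑ i, dV i (fun z => Fn i z * φ z) z =
          ∑ i, Fn i z * dV i φ z + φ z * ∑ i, dV i (Fn i) z := by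
        rw [Finset.mul_sum, ← Finset.sum_add_distrib]
        exact Finset.sum_congr rfl fun i _ => dV_mul (hdF i z) (hdφ z) i
      have h1 := mul_le_mul_of_nonneg_left (hn z hz).2 (h0 z)
      have h2 : -∑ i, Fn i z * dV i φ z ≤ ∑ i, |Fn i z * dV i φ z| := by
        rw [← Finset.sum_neg_distrib]
        exact Finset.sum_le_sum fun i _ => neg_le_abs _
      have h3 : fn z * transport φ z ≤ |fn z * max (transport φ z) 0| := by
        refine le_trans ?_ (le_abs_self _)
        exact mul_le_mul_of_nonneg_left (le_max_left _ _) (hf0 z)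
      have h4 := le_abs_self (hn' z * φ z)
      rw [e]
      rw [mul_add] at h1
      linarith
    · have e : ∀ i, dV i (fun z => Fn i z * φ z) z = 0 := fun i => by
        rw [dV_mul (hdF i z) (hdφ z)]
        simp [image_eq_zero_of_notMem_tsupport hz, dV_eq_zero_of_notMem hz]
      have e0 : ∑ i, dV i (fun z => moll (mollSeq d n) (F i) z * φ z) z = 0 :=
        Finset.sum_eq_zero fun i _ => e i
      simp [e0, image_eq_zero_of_notMem_tsupport hz, dV_eq_zero_of_notMem hz,
        transport_eq_zero_of_notMem hz]

end WeakSub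

theorem L2Lim.exists_subseq_ae {un : ℕ → Z d → ℝ} {u : Z d → ℝ} (hu : L2Lim un u) :
    ∃ ns : ℕ → ℕ, StrictMono ns ∧ ∀ᵐ z, Tendsto (fun k => un (ns k) z) atTop (𝓝 (u z)) :=
  (tendstoInMeasure_of_tendsto_eLpNorm (by norm_num) hu.meas hu.memLp.1 hu.lim).exists_seq_tendsto_ae

theorem eLpNorm_le_of_tendsto_ae {q : ℝ≥0∞} {un : ℕ → Z d → ℝ} {u : Z d → ℝ} {an : ℕ → ℝ≥0∞}
    {a : ℝ≥0∞} (hm : ∀ n, AEStronglyMeasurable (un n) volume)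
    (hu : ∀ᵐ z, Tendsto (fun k => un k z) atTop (𝓝 (u z)))
    (hb : ∀ᶠ n in atTop, eLpNorm (un n) q volume ≤ an n) (ha : Tendsto an atTop (𝓝 a)) :
    eLpNorm u q volume ≤ a :=
  (Lp.eLpNorm_lim_le_liminf_eLpNorm hm u hu).trans
    ((liminf_le_liminf hb).trans ha.liminf_eq.le)

theorem measurePreserving_shiftX (k : E d) : MeasurePreserving (shiftX k : Z d → Z d) := by
  have := measurePreserving_shear (d := d) 0 0 (c := fun _ _ => k) measurable_const
  simp only [add_zero] at this
  exact this

theorem lintegral_ofReal_le_eLpNorm_two {H : Z d → ℝ} (hm : AEStronglyMeasurable H volume)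
    {W : Set (Z d)} (hW : ∀ z, z ∉ W → H z = 0) :
    ∫⁻ z, ENNReal.ofReal (H z) ≤ eLpNorm H 2 volume * volume W ^ (1 / 2 : ℝ) := by
  calc ∫⁻ z, ENNReal.ofReal (H z) ≤ ∫⁻ z, ‖H z‖ₑ := lintegral_mono fun z => by
        rw [← ofReal_norm]; exact ENNReal.ofReal_le_ofReal (le_abs_self _)
    _ = ∫⁻ z in W, ‖H z‖ₑ := (setLIntegral_eq_of_support_subset fun z hz => by
        by_contra h; exact hz (by simp [hW z h])).symm
    _ = eLpNorm H 1 (volume.restrict W) := eLpNorm_one_eq_lintegral_enorm.symm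
    _ ≤ eLpNorm H 2 (volume.restrict W) * (volume.restrict W) univ ^ (1 / (1 : ℝ≥0∞).toReal -
        1 / (2 : ℝ≥0∞).toReal) :=
      eLpNorm_le_eLpNorm_mul_rpow_measure_univ (by norm_num) hm.restrict
    _ ≤ eLpNorm H 2 volume * volume W ^ (1 / 2 : ℝ) := by
      rw [Measure.restrict_apply_univ, show 1 / (1 : ℝ≥0∞).toReal - 1 / (2 : ℝ≥0∞).toReal =
        (1 / 2 : ℝ) by norm_num]
      gcongr
      exact Measure.restrict_le_self

theorem lintegral_ofReal_sq_eq {H : Z d → ℝ} (h0 : ∀ z, 0 ≤ H z) :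
    (∫⁻ z, ENNReal.ofReal (H z) ^ (2 : ℝ)) ^ (1 / 2 : ℝ) = eLpNorm H 2 volume := by
  rw [eLpNorm_eq_lintegral_rpow_enorm_toReal (by norm_num) (by norm_num)]
  simp only [ENNReal.toReal_ofNat]
  congr 2
  funext z
  rw [Real.enorm_eq_ofReal (h0 z)]

/-- Gain of integrability for localized weak sub-solutions. -/
theorem exists_integrability_bound (hd : 0 < d) : ∃ C : ℝ, 0 < C ∧ ∀ (V : Set (Z d))
    (f h : Z d → ℝ) (g F : Fin d → Z d → ℝ), WeakSub V f h g F → ∀ φ, IsTest V φ →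
    (∀ z, 0 ≤ φ z) → ∀ t₀, (∀ z, φ z ≠ 0 → t₀ - 1 < z.1 ∧ z.1 ≤ t₀) → ∀ p : ℝ, 2 ≤ p →
      p < 2 + 1 / (d : ℝ) → eLpNorm (fun z => f z * φ z) (ENNReal.ofReal p) volume ≤
        ENNReal.ofReal (C * (2 + 1 / (d : ℝ) - p)⁻¹) *
          eLpNorm (locBound φ f h g F) 2 volume := by
  obtain ⟨C, hC, hb⟩ := exists_smooth_integrability_bound hd
  refine ⟨C, hC, fun V f h g F H φ hφ h0 t₀ hw p hp hp2 => ?_⟩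
  have hφ1 : ContDiff ℝ 1 φ := hφ.smooth.of_le (by exact_mod_cast le_top)
  have Lf := l2Lim_moll H.memLp_f H.meas_f
  have LH := Lf.locBound (l2Lim_moll H.memLp_h H.meas_h)
    (fun i => l2Lim_moll (H.memLp_g i) (H.meas_g i))
    (fun i => l2Lim_moll (H.memLp_F i) (H.meas_F i)) hφ1 hφ.compact
  have Lφ := Lf.mul_bounded hφ1.continuous hφ.compact
  -- The L^p norm is not continuous under L² convergence, but almost everywhere convergence along a
  -- subsequence and Fatou's lemma are enough for an upper bound.
  obtain ⟨ns, hns, hae⟩ := Lφ.exists_subseq_ae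
  refine eLpNorm_le_of_tendsto_ae (fun n => Lφ.meas (ns n)) hae ?_
    (ENNReal.Tendsto.const_mul (LH.tendsto_eLpNorm.comp hns.tendsto_atTop)
      (Or.inr ENNReal.ofReal_ne_top))
  filter_upwards [hns.tendsto_atTop.eventually (H.eventually_smoothSub hφ h0 hw)] with n hn
  have hp0 : 0 < p := by linarith
  have key := hb _ _ _ _ hn p hp hp2
  rw [lintegral_ofReal_sq_eq locBound_nonneg] at key
  refine le_trans (le_of_eq ?_) key
  rw [eLpNorm_eq_lintegral_rpow_enorm_toReal (by simpa using hp0) ENNReal.ofReal_ne_top,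
    ENNReal.toReal_ofReal hp0.le]
  congr 2
  funext z
  rw [Real.enorm_eq_ofReal (mul_nonneg (H.moll_nonneg _ z) (h0 z))]

/-- Increments in position of localized weak sub-solutions. -/
theorem exists_increment_bound (d : ℕ) : ∃ C : ℝ, 0 < C ∧ ∀ (V : Set (Z d))
    (f h : Z d → ℝ) (g F : Fin d → Z d → ℝ), WeakSub V f h g F → volume V ≠ ∞ → ∀ φ, IsTest V φ →
    (∀ z, 0 ≤ φ z) → ∀ t₀, (∀ z, φ z ≠ 0 → t₀ - 1 < z.1 ∧ z.1 ≤ t₀) → ∀ k : E d,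
      ∫⁻ z, ‖f (shiftX k z) * φ (shiftX k z) - f z * φ z‖ₑ ≤
        ENNReal.ofReal (C * ‖k‖ ^ (1 / 3 : ℝ)) *
          (eLpNorm (locBound φ f h g F) 2 volume * volume V ^ (1 / 2 : ℝ)) := by
  obtain ⟨C, hC, hb⟩ := exists_smooth_increment_bound d
  refine ⟨C, hC, fun V f h g F H hV φ hφ h0 t₀ hw k => ?_⟩
  have hφ1 : ContDiff ℝ 1 φ := hφ.smooth.of_le (by exact_mod_cast le_top)
  have Lf := l2Lim_moll H.memLp_f H.meas_f
  have LH := Lf.locBound (l2Lim_moll H.memLp_h H.meas_h)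
    (fun i => l2Lim_moll (H.memLp_g i) (H.meas_g i))
    (fun i => l2Lim_moll (H.memLp_F i) (H.meas_F i)) hφ1 hφ.compact
  have Lφ := Lf.mul_bounded hφ1.continuous hφ.compact
  obtain ⟨ns, hns, hae⟩ := Lφ.exists_subseq_ae
  have hk := measurePreserving_shiftX (d := d) k
  have hae' := hk.quasiMeasurePreserving.ae hae
  rw [← eLpNorm_one_eq_lintegral_enorm]
  have hm : ∀ n, AEStronglyMeasurable (fun z => moll (mollSeq d (ns n)) f (shiftX k z) *
      φ (shiftX k z) - moll (mollSeq d (ns n)) f z * φ z) volume := fun n =>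
    ((Lφ.meas (ns n)).comp_measurePreserving hk).sub (Lφ.meas (ns n))
  refine eLpNorm_le_of_tendsto_ae hm
    (by filter_upwards [hae, hae'] with z h1 h2; exact h2.sub h1) ?_
    (ENNReal.Tendsto.const_mul (ENNReal.Tendsto.mul_const
      (LH.tendsto_eLpNorm.comp hns.tendsto_atTop)
      (Or.inr (ENNReal.rpow_ne_top_of_nonneg (by norm_num) hV))) (Or.inr ENNReal.ofReal_ne_top))
  filter_upwards [hns.tendsto_atTop.eventually (H.eventually_smoothSub hφ h0 hw)] with n hn
  have key := hb _ _ _ _ hn k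
  rw [eLpNorm_one_eq_lintegral_enorm]
  refine key.trans ?_
  gcongr
  exact lintegral_ofReal_le_eLpNorm_two (LH.meas _) fun z hz =>
    locBound_eq_zero_of_notMem fun h => hz (hφ.support h)

/-! ### Control of the localized right-hand side by f and S. -/

theorem eLpNorm_two_eq_sqrt {u : Z d → ℝ} (hu : MemLp u 2 volume) :
    eLpNorm u 2 volume = ENNReal.ofReal √(∫ z, u z ^ 2) := by
  rw [hu.eLpNorm_eq_integral_rpow_norm (by norm_num) (by norm_num), Real.sqrt_eq_rpow]
  simp

theorem WeakSub.memLp_locBound {V : Set (Z d)} {f h φ : Z d → ℝ} {g F : Fin d → Z d → ℝ}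
    (H : WeakSub V f h g F) (hφ : IsTest V φ) : MemLp (locBound φ f h g F) 2 volume :=
  ((l2Lim_moll H.memLp_f H.meas_f).locBound (l2Lim_moll H.memLp_h H.meas_h)
    (fun i => l2Lim_moll (H.memLp_g i) (H.meas_g i))
    (fun i => l2Lim_moll (H.memLp_F i) (H.meas_F i))
    (hφ.smooth.of_le (by exact_mod_cast le_top)) hφ.compact).memLp

/-- In the application a = 1/(R-r), and 6Ma and 27Ma² are the cutoff bounds for a gap (R-r)/3. The
square of the gradient is weighted by a² only, because the Caccioppoli inequality costs another a²;
every term then ends with at most a⁴. -/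
theorem locBound_sq_le {φ f h S : Z d → ℝ} {g F : Fin d → Z d → ℝ} {z : Z d} {M a Lam : ℝ}
    (hM : 1 ≤ M) (ha : 1 ≤ a) (hφ0 : 0 ≤ φ z) (hφ1 : φ z ≤ 1) (hd : ∀ i, |dV i φ z| ≤ 6 * M * a)
    (ht : transport φ z ≤ 27 * M * a ^ 2) (h1 : ∑ i, F i z ^ 2 ≤ Lam ^ 2 * ∑ i, g i z ^ 2)
    (h2 : h z ^ 2 ≤ 2 * Lam ^ 2 * ∑ i, g i z ^ 2 + 2 * S z ^ 2) :
    locBound φ f h g F z ^ 2 ≤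
      (294 * d * M ^ 2 * (Lam ^ 2 + 1) + 6 * Lam ^ 2) * a ^ 2 * ∑ i, g i z ^ 2 + 6 * S z ^ 2 +
        3 * (6 * M * d + 27 * M) ^ 2 * a ^ 4 * f z ^ 2 := by
  set G := ∑ i, g i z ^ 2 with hG
  have hG0 : 0 ≤ G := Finset.sum_nonneg fun i _ => sq_nonneg _
  have hMa : 1 ≤ M * a := one_le_mul_of_one_le_of_one_le hM ha
  set A := 7 * M * a * ∑ i, (|F i z| + |g i z|) with hA
  set B := |h z| with hB
  set C := (6 * M * d + 27 * M) * a ^ 2 * |f z| with hC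
  have le1 : locBound φ f h g F z ≤ A + B + C := by
    have t1 : ∑ i, (|F i z * φ z| + |F i z * dV i φ z| + |g i z * φ z| + |f z * dV i φ z|) ≤
        ∑ i, (7 * M * a * (|F i z| + |g i z|) + 6 * M * a ^ 2 * |f z|) := by
      refine Finset.sum_le_sum fun i _ => ?_
      simp only [abs_mul, abs_of_nonneg hφ0]
      have q1 : |F i z| * φ z ≤ |F i z| * (M * a) := by gcongr; linarith
      have q2 : |F i z| * |dV i φ z| ≤ |F i z| * (6 * M * a) := by gcongr; exact hd i
      have q3 : |g i z| * φ z ≤ |g i z| * (7 * (M * a)) := by gcongr; linarith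
      have q4 : |f z| * |dV i φ z| ≤ |f z| * (6 * M * a ^ 2) := by
        gcongr
        refine (hd i).trans ?_
        have : a ≤ a ^ 2 := le_self_pow₀ ha two_ne_zero
        gcongr
      nlinarith
    have t2 : |h z * φ z| ≤ B := by
      rw [abs_mul, abs_of_nonneg hφ0]
      exact mul_le_of_le_one_right (abs_nonneg _) hφ1
    have t3 : |f z * max (transport φ z) 0| ≤ 27 * M * a ^ 2 * |f z| := by
      rw [abs_mul, abs_of_nonneg (le_max_right (transport φ z) 0), mul_comm]
      gcongr
      exact max_le ht (by positivity)
    have t4 : ∑ i, (7 * M * a * (|F i z| + |g i z|) + 6 * M * a ^ 2 * |f z|) =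
        A + d * (6 * M * a ^ 2 * |f z|) := by
      rw [Finset.sum_add_distrib, ← Finset.mul_sum, Finset.sum_const, Finset.card_univ,
        Fintype.card_fin, nsmul_eq_mul]
    unfold locBound
    have e : C = d * (6 * M * a ^ 2 * |f z|) + 27 * M * a ^ 2 * |f z| := by rw [hC]; ring
    linarith
  have le2 : A ^ 2 ≤ 98 * d * M ^ 2 * a ^ 2 * ((Lam ^ 2 + 1) * G) := by
    have s1 : (∑ i, (|F i z| + |g i z|)) ^ 2 ≤ d * ∑ i, (|F i z| + |g i z|) ^ 2 := by
      simpa using sq_sum_le_card_mul_sum_sq (s := Finset.univ) (f := fun i => |F i z| + |g i z|)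
    have s2 : ∑ i, (|F i z| + |g i z|) ^ 2 ≤ 2 * ((Lam ^ 2 + 1) * G) := by
      have : ∑ i, (|F i z| + |g i z|) ^ 2 ≤ ∑ i, (2 * F i z ^ 2 + 2 * g i z ^ 2) := by
        refine Finset.sum_le_sum fun i _ => ?_
        rw [← sq_abs (F i z), ← sq_abs (g i z)]
        nlinarith [sq_nonneg (|F i z| - |g i z|)]
      rw [Finset.sum_add_distrib, ← Finset.mul_sum, ← Finset.mul_sum] at this
      linarith
    calc A ^ 2 = 49 * M ^ 2 * a ^ 2 * (∑ i, (|F i z| + |g i z|)) ^ 2 := by rw [hA]; ring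
      _ ≤ 49 * M ^ 2 * a ^ 2 * (d * (2 * ((Lam ^ 2 + 1) * G))) := by
        gcongr
        exact s1.trans (by gcongr)
      _ = _ := by ring
  have le3 : B ^ 2 ≤ 2 * Lam ^ 2 * G + 2 * S z ^ 2 := by rw [hB, sq_abs]; exact h2
  have le4 : C ^ 2 = (6 * M * d + 27 * M) ^ 2 * a ^ 4 * f z ^ 2 := by
    rw [hC, ← sq_abs (f z)]; ring
  have le5 : locBound φ f h g F z ^ 2 ≤ 3 * (A ^ 2 + B ^ 2 + C ^ 2) := by
    calc locBound φ f h g F z ^ 2 ≤ (A + B + C) ^ 2 :=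
          pow_le_pow_left₀ (locBound_nonneg z) le1 2
      _ ≤ _ := by nlinarith [sq_nonneg (A - B), sq_nonneg (A - C), sq_nonneg (B - C)]
  have le6 : 6 * Lam ^ 2 * G ≤ 6 * Lam ^ 2 * G * a ^ 2 :=
    le_mul_of_one_le_right (by positivity) (one_le_pow₀ ha)
  rw [le4] at le5
  nlinarith

set_option maxHeartbeats 800000 in
/-- The localized right-hand side is controlled by the `L²` norms of the solution and of the
source. -/
theorem exists_locBound_le (d : ℕ) {lam Lam : ℝ} (hlam : 0 < lam) (hLam : lam < Lam) :
    ∃ C : ℝ, 0 < C ∧ ∀ (z₀ : Z d) (r R η : ℝ), 0 < r → r < R → R ≤ 1 → 0 < η →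
      ∀ (f h S : Z d → ℝ) (g F : Fin d → Z d → ℝ), WeakSub (openCylinder R z₀) f h g F →
        Elliptic lam Lam S h g F →
        eLpNorm (locBound (cutoff r (r + (R - r) / 3) η z₀) f h g F) 2 volume ≤
          ENNReal.ofReal (C / (R - r) ^ 2) * (eLpNorm f 2 volume + eLpNorm S 2 volume) := by
  obtain ⟨M, hM1, hM⟩ := exists_deriv_smoothTransition_le
  have hLam0 : 0 < Lam := hlam.trans hLam
  -- This gives 3εΛ² = λ/2, so half of the coercivity survives the absorption.
  set ε := lam / (6 * Lam ^ 2) with hε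
  have hε0 : 0 < ε := by positivity
  set c₁ := 36 * d * M ^ 2 / ε + 1 / (4 * ε) + 27 * M + 2 * ε with hc₁
  set c₂ := 294 * d * M ^ 2 * (Lam ^ 2 + 1) + 6 * Lam ^ 2 with hc₂
  set c₃ := 3 * (6 * M * d + 27 * M) ^ 2 with hc₃
  have h1 : 0 < c₁ := by positivity
  have h2 : 0 < c₂ := by positivity
  have h3 : 0 ≤ c₃ := by positivity
  set c₄ := c₂ * (2 / lam * c₁) + 6 + c₃ with hc₄
  have h4 : 0 < c₄ := by positivity
  refine ⟨√c₄, Real.sqrt_pos.2 h4, fun z₀ r R η hr hrR hR hη f h S g F H hE => ?_⟩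
  set a := 1 / (R - r) with ha
  have hδ : 0 < R - r := sub_pos.2 hrR
  have ha1 : 1 ≤ a := by rw [ha, le_div_iff₀ hδ]; linarith
  set b := r + (R - r) / 3 with hb
  have hrb : r < b := by linarith
  set b' := r + 2 * (R - r) / 3 with hb'
  have hbb' : b < b' := by linarith
  set φ := cutoff r b η z₀ with hφ
  -- The support of φ lies in the core of radius b at distance η/2 from the final time, exactly
  -- where ψ = 1. So ∇_v f on the support of φ is controlled by the Caccioppoli inequality with ψ.
  set ψ := cutoff b b' (η / 2) z₀ with hψ
  have hb0 : 0 < b := hr.trans hrb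
  have hφT : IsTest (openCylinder R z₀) φ := cutoff.isTest hr hrb (by linarith) hη
  have hψT : IsTest (openCylinder R z₀) ψ :=
    cutoff.isTest hb0 hbb' (by linarith) (by linarith)
  have et : ∀ x : ℝ, x = (R - r) / 3 → 3 * M / x ^ 2 = 27 * M * a ^ 2 := fun x hx => by
    rw [hx, ha]; field_simp; norm_num
  have ed : ∀ x : ℝ, x = (R - r) / 3 → 2 * M / x = 6 * M * a := fun x hx => by
    rw [hx, ha]; field_simp; norm_num
  have hφt : ∀ z, transport φ z ≤ 27 * M * a ^ 2 := fun z => by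
    rw [← et (b - r) (by rw [hb]; ring)]; exact cutoff.transport_le hM hr hrb hη z
  have hψt : ∀ z, transport ψ z ≤ 27 * M * a ^ 2 := fun z => by
    rw [← et (b' - b) (by rw [hb, hb']; ring)]
    exact cutoff.transport_le hM hb0 hbb' (by linarith) z
  have hφd : ∀ i z, |dV i φ z| ≤ 6 * M * a := fun i z => by
    rw [← ed (b - r) (by rw [hb]; ring)]; exact cutoff.abs_dV_le hM hr hrb i z
  have hψd : ∀ i z, |dV i ψ z| ≤ 6 * M * a := fun i z => by
    rw [← ed (b' - b) (by rw [hb, hb']; ring)]; exact cutoff.abs_dV_le hM hb0 hbb' i z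
  have cac := H.caccioppoli hE hψT cutoff.nonneg cutoff.le_one hε0 (by positivity) hψt hψd
  have If : Integrable fun z => f z ^ 2 := H.memLp_f.integrable_sq
  have IS : Integrable fun z => S z ^ 2 := hE.memLp_S.integrable_sq
  have hψ' : ContDiff ℝ 1 fun z => ψ z ^ 2 :=
    (hψT.smooth.of_le (by exact_mod_cast le_top)).pow 2
  have hψc : HasCompactSupport fun z => ψ z ^ 2 := by
    have e : (fun z => ψ z ^ 2) = ψ * ψ := funext fun z => sq _
    rw [e]; exact hψT.compact.mul_left
  have IG : Integrable fun z => ψ z ^ 2 * ∑ i, g i z ^ 2 := by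
    have : ∀ i, Integrable fun z => g i z * (g i z * ψ z ^ 2) := fun i =>
      (H.memLp_g i).integrable_mul_mul_of_hasCompactSupport (H.memLp_g i) hψ'.continuous hψc
    refine (integrable_finsetSum Finset.univ fun i _ => this i).congr
      (Eventually.of_forall fun z => ?_)
    simp only [Finset.mul_sum]
    exact Finset.sum_congr rfl fun i _ => by ring
  have hf0 : 0 ≤ ∫ z, f z ^ 2 := integral_nonneg fun z => sq_nonneg _
  have hS0 : 0 ≤ ∫ z, S z ^ 2 := integral_nonneg fun z => sq_nonneg _
  set X := ∫ z, f z ^ 2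
  set Y := ∫ z, S z ^ 2
  have ha2 : 1 ≤ a ^ 2 := one_le_pow₀ ha1
  have hG : ∫ z, ψ z ^ 2 * ∑ i, g i z ^ 2 ≤ 2 / lam * c₁ * a ^ 2 * (X + Y) := by
    have e1 : lam - 3 * ε * Lam ^ 2 = lam / 2 := by rw [hε]; field_simp; norm_num
    have e2 : d * (6 * M * a) ^ 2 / ε + 1 / (4 * ε) + 27 * M * a ^ 2 ≤ c₁ * a ^ 2 := by
      have q1 : 1 / (4 * ε) * 1 ≤ 1 / (4 * ε) * a ^ 2 := by gcongr
      have q2 : 0 ≤ 2 * ε * a ^ 2 := by positivity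
      have q3 : d * (6 * M * a) ^ 2 / ε = 36 * d * M ^ 2 / ε * a ^ 2 := by ring
      rw [q3, hc₁]; linarith
    have e3 : 2 * ε ≤ c₁ * a ^ 2 := by
      have q : 2 * ε ≤ c₁ := by
        have : 0 ≤ 36 * d * M ^ 2 / ε + 1 / (4 * ε) + 27 * M := by positivity
        linarith
      calc 2 * ε = 2 * ε * 1 := (mul_one _).symm
        _ ≤ c₁ * a ^ 2 := by gcongr
    rw [e1] at cac
    have q : lam / 2 * ∫ z, ψ z ^ 2 * ∑ i, g i z ^ 2 ≤ c₁ * a ^ 2 * (X + Y) := by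
      calc _ ≤ _ := cac
        _ ≤ c₁ * a ^ 2 * X + c₁ * a ^ 2 * Y := by gcongr
        _ = _ := by ring
    calc ∫ z, ψ z ^ 2 * ∑ i, g i z ^ 2
        = 2 / lam * (lam / 2 * ∫ z, ψ z ^ 2 * ∑ i, g i z ^ 2) := by field_simp
      _ ≤ 2 / lam * (c₁ * a ^ 2 * (X + Y)) := by gcongr
      _ = _ := by ring
  have mL := H.memLp_locBound hφT
  have hpt : ∫ z, locBound φ f h g F z ^ 2 ≤ c₂ * a ^ 2 * (∫ z, ψ z ^ 2 * ∑ i, g i z ^ 2) +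
      6 * Y + c₃ * a ^ 4 * X := by
    rw [← integral_const_mul, ← integral_const_mul, ← integral_const_mul,
      ← integral_add' (IG.const_mul _) (IS.const_mul _),
      ← integral_add' ((IG.const_mul _).add (IS.const_mul _)) (If.const_mul _)]
    refine integral_mono_ae mL.integrable_sq
      (((IG.const_mul _).add (IS.const_mul _)).add (If.const_mul _)) ?_
    filter_upwards [hE.flux_le, hE.source_le] with z k1 k2
    simp only [Pi.add_apply]
    by_cases hz : z ∈ tsupport φ
    · have hψ1 : ψ z = 1 :=
        cutoff.eq_one hb0 hbb' (by linarith) (cutoff.tsupport_subset hr hrb hη hz)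
      rw [hψ1, one_pow, one_mul]
      exact locBound_sq_le hM1 ha1 (cutoff.nonneg z) (cutoff.le_one z) (fun i => hφd i z) (hφt z)
        k1 k2
    · rw [locBound_eq_zero_of_notMem hz, zero_pow two_ne_zero]
      positivity
  have htot : ∫ z, locBound φ f h g F z ^ 2 ≤ c₄ * (a ^ 2) ^ 2 * (X + Y) := by
    have q1 : c₂ * a ^ 2 * (∫ z, ψ z ^ 2 * ∑ i, g i z ^ 2) ≤
        c₂ * a ^ 2 * (2 / lam * c₁ * a ^ 2 * (X + Y)) := by gcongr
    have q2 : 6 * Y ≤ 6 * (a ^ 2) ^ 2 * (X + Y) := by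
      have : 1 ≤ (a ^ 2) ^ 2 := one_le_pow₀ ha2
      calc 6 * Y = 6 * 1 * Y := by ring
        _ ≤ 6 * (a ^ 2) ^ 2 * (X + Y) := by gcongr; linarith
    have q3 : c₃ * a ^ 4 * X ≤ c₃ * a ^ 4 * (X + Y) := by gcongr; linarith
    calc _ ≤ _ := hpt
      _ ≤ c₂ * a ^ 2 * (2 / lam * c₁ * a ^ 2 * (X + Y)) + 6 * (a ^ 2) ^ 2 * (X + Y) +
          c₃ * a ^ 4 * (X + Y) := add_le_add (add_le_add q1 q2) q3
      _ = _ := by rw [hc₄]; ring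
  rw [eLpNorm_two_eq_sqrt mL, eLpNorm_two_eq_sqrt H.memLp_f, eLpNorm_two_eq_sqrt hE.memLp_S,
    ← ENNReal.ofReal_add (Real.sqrt_nonneg _) (Real.sqrt_nonneg _),
    ← ENNReal.ofReal_mul (by positivity)]
  refine ENNReal.ofReal_le_ofReal ?_
  have ea : √c₄ / (R - r) ^ 2 = √c₄ * a ^ 2 := by rw [ha]; field_simp
  rw [ea]
  refine Real.sqrt_le_iff.2 ⟨by positivity, htot.trans ?_⟩
  have s1 : (√c₄) ^ 2 = c₄ := Real.sq_sqrt h4.le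
  have s2 : X + Y ≤ (√X + √Y) ^ 2 := by
    have u1 := Real.sq_sqrt hf0
    have u2 := Real.sq_sqrt hS0
    have u3 := mul_nonneg (Real.sqrt_nonneg X) (Real.sqrt_nonneg Y)
    nlinarith
  rw [mul_pow, mul_pow, s1]
  gcongr

/-! ### Slices and volume of cylinders, and the singular weight. -/

/-- Integrals over phase space-time as iterated integrals, the position last. -/
theorem lintegral_eq_lintegral_position {G : Z d → ℝ≥0∞} (hG : Measurable G) :
    ∫⁻ p : ℝ × E d, ∫⁻ x : E d, G (p.1, x, p.2) = ∫⁻ z, G z := by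
  have hmp : MeasurePreserving (fun q : (ℝ × E d) × E d => ((q.1.1, q.2, q.1.2) : Z d))
      (((volume : Measure ℝ).prod (volume : Measure (E d))).prod (volume : Measure (E d)))
      ((volume : Measure ℝ).prod ((volume : Measure (E d)).prod (volume : Measure (E d)))) := by
    have h1 := measurePreserving_prodAssoc (volume : Measure ℝ) (volume : Measure (E d))
      (volume : Measure (E d))
    have h2 := (MeasurePreserving.id (volume : Measure ℝ)).prod
      (Measure.measurePreserving_swap (μ := (volume : Measure (E d)))
        (ν := (volume : Measure (E d))))
    exact h2.comp h1
  have h := hmp.lintegral_comp hG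
  have hm : Measurable fun q : (ℝ × E d) × E d => G (q.1.1, q.2, q.1.2) :=
    hG.comp hmp.measurable
  rw [lintegral_prod _ hm.aemeasurable] at h
  exact h

theorem ae_position_of_ae {P : Z d → Prop} (h : ∀ᵐ z, P z) :
    ∀ᵐ p : ℝ × E d, ∀ᵐ x : E d, P (p.1, x, p.2) := by
  obtain ⟨N, hN, hNm, hN0⟩ := exists_measurable_superset_of_null (ae_iff.1 h)
  have hG : Measurable (N.indicator (1 : Z d → ℝ≥0∞)) := measurable_one.indicator hNm
  have h0 := lintegral_eq_lintegral_position hG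
  rw [lintegral_indicator_one hNm, hN0] at h0
  have hm : Measurable fun q : (ℝ × E d) × E d =>
      N.indicator (1 : Z d → ℝ≥0∞) (q.1.1, q.2, q.1.2) := hG.comp (by fun_prop)
  rw [lintegral_eq_zero_iff (Measurable.lintegral_prod_right' hm)] at h0
  filter_upwards [h0] with p hp
  have hmp : Measurable fun x : E d => N.indicator (1 : Z d → ℝ≥0∞) (p.1, x, p.2) :=
    hG.comp (by fun_prop)
  have hp' : ∫⁻ x : E d, N.indicator (1 : Z d → ℝ≥0∞) (p.1, x, p.2) = 0 := hp
  rw [lintegral_eq_zero_iff hmp] at hp'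
  filter_upwards [hp'] with x hx
  by_contra hP
  have : ((p.1, x, p.2) : Z d) ∈ N := hN hP
  simp [this] at hx

theorem measurableSet_cylinder (r : ℝ) (z₀ : Z d) : MeasurableSet (cylinder r z₀) := by
  change MeasurableSet ({z : Z d | -r ^ 2 < z.1 - z₀.1} ∩ ({z : Z d | z.1 - z₀.1 ≤ 0} ∩
    ({z : Z d | ‖z.2.1 - z₀.2.1 - (z.1 - z₀.1) • z₀.2.2‖ < r ^ 3} ∩
      {z : Z d | ‖z.2.2 - z₀.2.2‖ < r})))
  refine MeasurableSet.inter ?_ (MeasurableSet.inter ?_ (MeasurableSet.inter ?_ ?_))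
  · exact measurableSet_lt (by fun_prop) (by fun_prop)
  · exact measurableSet_le (by fun_prop) (by fun_prop)
  · exact measurableSet_lt (by fun_prop) (by fun_prop)
  · exact measurableSet_lt (by fun_prop) (by fun_prop)

theorem cylinder_mono {r R : ℝ} (hr : 0 ≤ r) (h : r ≤ R) (z₀ : Z d) :
    cylinder r z₀ ⊆ cylinder R z₀ := by
  rintro z ⟨h1, h2, h3, h4⟩
  have := pow_le_pow_left₀ hr h 2
  exact ⟨by linarith, h2, h3.trans_le (pow_le_pow_left₀ hr h 3), h4.trans_le h⟩

/-- A measure preserving shear straightens the cylinder into a product of sides R², R³ and R. The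
power R^(2+4d) is written as a square because its root R^(1+2d) is the prefactor of 𝒞''. -/
theorem volume_cylinder {R : ℝ} (hR : 0 < R) (z₀ : Z d) :
    volume (cylinder R z₀) = ENNReal.ofReal ((R ^ (1 + 2 * d)) ^ 2) *
      volume (Metric.ball (0 : E d) 1) ^ 2 := by
  have hm := measurePreserving_shear (d := d) (-z₀.1) (-z₀.2.2)
    (c := fun t _ => -z₀.2.1 - (t - z₀.1) • z₀.2.2) (by fun_prop)
  have hs : MeasurableSet ((Ioc (-R ^ 2) 0 : Set ℝ) ×ˢ
      (Metric.ball (0 : E d) (R ^ 3) ×ˢ Metric.ball (0 : E d) R)) :=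
    measurableSet_Ioc.prod (Metric.isOpen_ball.measurableSet.prod Metric.isOpen_ball.measurableSet)
  have e : cylinder R z₀ = (fun z : Z d => ((z.1 + -z₀.1,
      z.2.1 + (-z₀.2.1 - (z.1 - z₀.1) • z₀.2.2), z.2.2 + -z₀.2.2) : Z d)) ⁻¹'
      ((Ioc (-R ^ 2) 0 : Set ℝ) ×ˢ
        (Metric.ball (0 : E d) (R ^ 3) ×ˢ Metric.ball (0 : E d) R)) := by
    ext z
    have : z.2.1 + (-z₀.2.1 - (z.1 - z₀.1) • z₀.2.2) =
        z.2.1 - z₀.2.1 - (z.1 - z₀.1) • z₀.2.2 := by abel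
    simp [cylinder, this, ← sub_eq_add_neg, and_assoc]
  rw [e, hm.measure_preimage hs.nullMeasurableSet]
  change ((volume : Measure ℝ).prod ((volume : Measure (E d)).prod (volume : Measure (E d)))) _ = _
  rw [Measure.prod_prod, Measure.prod_prod, Real.volume_Ioc, Measure.addHaar_ball_of_pos _ _ hR,
    Measure.addHaar_ball_of_pos _ _ (by positivity : 0 < R ^ 3), finrank_euclideanSpace, Fintype.card_fin]
  have e2 : (R ^ (1 + 2 * d)) ^ 2 = (0 - -R ^ 2) * (R ^ 3) ^ d * R ^ d := by
    rw [← pow_mul, ← pow_mul]; ring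
  have q : 0 ≤ 0 - -R ^ 2 := by linarith [sq_nonneg R]
  rw [e2, ENNReal.ofReal_mul (mul_nonneg q (by positivity)), ENNReal.ofReal_mul q]
  ring

theorem volume_cylinder_rpow {R : ℝ} (hR : 0 < R) (z₀ : Z d) :
    volume (cylinder R z₀) ^ (1 / 2 : ℝ) =
      ENNReal.ofReal (volume.real (Metric.ball (0 : E d) 1) * R ^ (1 + 2 * d)) := by
  have hfin : volume (Metric.ball (0 : E d) 1) ≠ ∞ := measure_ball_lt_top.ne
  rw [volume_cylinder hR, ENNReal.ofReal_pow (by positivity), ← mul_pow, ← ENNReal.rpow_two,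
    ← ENNReal.rpow_mul]
  norm_num
  rw [mul_comm, Measure.real, ENNReal.ofReal_toReal hfin]

theorem volume_openCylinder_ne_top {R : ℝ} (hR : 0 < R) (z₀ : Z d) :
    volume (openCylinder R z₀) ≠ ∞ := by
  refine ((measure_mono (openCylinder_subset R z₀)).trans_lt ?_).ne
  rw [volume_cylinder hR]
  exact ENNReal.mul_lt_top ENNReal.ofReal_lt_top (ENNReal.pow_lt_top measure_ball_lt_top)

theorem ae_time_ne (t₀ : ℝ) : ∀ᵐ z : Z d, z.1 ≠ t₀ := by
  have h : Measure.QuasiMeasurePreserving (Prod.fst : Z d → ℝ) volume volume :=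
    Measure.quasiMeasurePreserving_fst
  exact h.ae (p := fun t => t ≠ t₀) (by simp [ae_iff])

/-- The singular weight of the Gagliardo semi-norm against Hölder increments of order `1/3`. -/
theorem exists_lintegral_weight_le (hd : 0 < d) : ∃ C : ℝ, 0 < C ∧ ∀ σ : ℝ, 0 ≤ σ → σ < 1 / 3 →
    ∫⁻ k in Metric.ball (0 : E d) 2, ENNReal.ofReal (‖k‖ ^ (1 / 3 : ℝ)) / ‖k‖ₑ ^ ((d : ℝ) + σ) ≤
      ENNReal.ofReal (C * (1 / 3 - σ)⁻¹) := by
  have : Nonempty (Fin d) := ⟨⟨0, hd⟩⟩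
  have hb : 0 < volume.real (Metric.ball (0 : E d) 1) :=
    ENNReal.toReal_pos (Metric.measure_ball_pos _ _ one_pos).ne' measure_ball_lt_top.ne
  refine ⟨d * volume.real (Metric.ball (0 : E d) 1) * 2, by positivity, fun σ h0 h1 => ?_⟩
  set a := 1 / 3 - σ with ha
  have ha0 : 0 < a := by linarith
  have ha1 : a ≤ 1 := by linarith
  -- In polar coordinates the radial integrand becomes s^(a-1) on (0, 2), of integral 2^a/a ≤ 2/a.
  set w : ℝ → ℝ := (Iio 2).indicator fun s => s ^ (a - d) with hw
  have hw0 : ∀ s, 0 ≤ s → 0 ≤ w s := fun s hs => by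
    rw [hw]; unfold indicator; split_ifs <;> positivity
  have hrad : ∀ s ∈ Ioi (0 : ℝ), s ^ (d - 1) • w s = (Ioo 0 2).indicator (fun s => s ^ (a - 1)) s := by
    intro s hs
    have hs0 : 0 < s := hs
    by_cases h2 : s < 2
    · rw [hw, indicator_of_mem (by exact h2), indicator_of_mem (by exact ⟨hs0, h2⟩), smul_eq_mul,
        ← Real.rpow_natCast, ← Real.rpow_add hs0, Nat.cast_sub hd]
      congr 1
      push_cast; ring
    · rw [hw, indicator_of_notMem (by exact h2), indicator_of_notMem (fun h => h2 h.2), smul_zero]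
  have hii : IntervalIntegrable (fun s : ℝ => s ^ (a - 1)) volume 0 2 :=
    intervalIntegral.intervalIntegrable_rpow' (by linarith)
  have hio : IntegrableOn (fun s : ℝ => s ^ (a - 1)) (Ioo 0 2) :=
    ((intervalIntegrable_iff_integrableOn_Ioc_of_le zero_le_two).1 hii).mono_set Ioo_subset_Ioc_self
  have hint : Integrable fun k : E d => w ‖k‖ := by
    rw [integrable_fun_norm_addHaar, finrank_euclideanSpace, Fintype.card_fin]
    refine IntegrableOn.congr_fun ?_ (fun s hs => (hrad s hs).symm) measurableSet_Ioi
    exact ((integrable_indicator_iff measurableSet_Ioo).2 hio).integrableOn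
  have hval : ∫ k : E d, w ‖k‖ ≤ d * volume.real (Metric.ball (0 : E d) 1) * 2 * a⁻¹ := by
    rw [integral_fun_norm_addHaar, finrank_euclideanSpace, Fintype.card_fin,
      setIntegral_congr_fun measurableSet_Ioi hrad, setIntegral_indicator measurableSet_Ioo,
      show Ioi (0 : ℝ) ∩ Ioo 0 2 = Ioo 0 2 from inter_eq_right.2 fun s hs => hs.1, ← integral_Ioc_eq_integral_Ioo,
      ← intervalIntegral.integral_of_le zero_le_two, integral_rpow (Or.inl (by linarith)),
      sub_add_cancel, Real.zero_rpow ha0.ne', sub_zero, nsmul_eq_mul, smul_eq_mul, div_eq_mul_inv]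
    have : (2 : ℝ) ^ a ≤ 2 := by
      simpa using Real.rpow_le_rpow_of_exponent_le one_le_two ha1
    calc _ = d * volume.real (Metric.ball (0 : E d) 1) * 2 ^ a * a⁻¹ := by ring
      _ ≤ _ := by gcongr
  refine le_trans ?_ (ENNReal.ofReal_le_ofReal hval)
  rw [ofReal_integral_eq_lintegral_ofReal hint
    (Eventually.of_forall fun k => hw0 _ (norm_nonneg _)),
    ← lintegral_indicator Metric.isOpen_ball.measurableSet]
  refine lintegral_mono fun k => ?_
  by_cases hk : k ∈ Metric.ball (0 : E d) 2
  swap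
  · rw [indicator_of_notMem hk]; exact zero_le
  rw [indicator_of_mem hk]
  have hk2 : ‖k‖ < 2 := by simpa using hk
  -- At the origin the numerator is zero, so the quotient is zero by the convention 0 · ∞ = 0.
  by_cases hk0 : k = 0
  · subst hk0
    simp
  have hn : 0 < ‖k‖ := norm_pos_iff.2 hk0
  rw [hw, indicator_of_mem (by exact hk2), ← ofReal_norm, ENNReal.ofReal_rpow_of_pos hn,
    ← ENNReal.ofReal_div_of_pos (by positivity), ← Real.rpow_sub hn]
  refine le_of_eq ?_
  congr 2
  rw [ha]; ring

/-- Away from the final time slice, the truncation no longer acts once its width is at most t₀ - t.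
-/
theorem eventually_cutoff_eq_one {r b : ℝ} (hr : 0 < r) (hrb : r < b) {z₀ z : Z d}
    (hz : z ∈ cylinder r z₀) (ht : z.1 ≠ z₀.1) :
    ∀ᶠ n : ℕ in atTop, cutoff r b (1 / ((n : ℝ) + 1)) z₀ z = 1 := by
  obtain ⟨h1, h2, h3, h4⟩ := hz
  have hlt : 0 < z₀.1 - z.1 := by
    rcases h2.lt_or_eq with h | h
    · linarith
    · exact absurd (sub_eq_zero.1 h) ht
  filter_upwards [(tendsto_one_div_add_atTop_nhds_zero_nat (𝕜 := ℝ)).eventually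
    (ge_mem_nhds hlt)] with n hn
  exact cutoff.eq_one hr hrb (by positivity) ⟨h1.le, by linarith, h3.le, h4.le⟩

/-- Since b < 1, the support has time length below one, as the time window of the representation
formula demands. -/
theorem cutoff_window {r b η : ℝ} (hr : 0 < r) (hrb : r < b) (hb : b < 1) (hη : 0 < η) {z₀ : Z d}
    (z : Z d) (hz : cutoff r b η z₀ z ≠ 0) : z₀.1 - 1 < z.1 ∧ z.1 ≤ z₀.1 := by
  obtain ⟨h1, h2, -, -⟩ := cutoff.mem_core hr hrb hη hz
  have : b ^ 2 < 1 := by nlinarith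
  exact ⟨by linarith, by linarith⟩

/-! ### Estimates on kinetic cylinders. -/

/-- Gain of integrability on kinetic cylinders. -/
theorem exists_eLpNorm_cylinder_le (hd : 0 < d) {lam Lam : ℝ} (hlam : 0 < lam)
    (hLam : lam < Lam) : ∃ C : ℝ, 0 < C ∧ ∀ (z₀ : Z d) (r R : ℝ), 0 < r → r < R → R ≤ 1 →
      ∀ (f h S : Z d → ℝ) (g F : Fin d → Z d → ℝ), WeakSub (openCylinder R z₀) f h g F →
        Elliptic lam Lam S h g F → ∀ p : ℝ, 2 ≤ p → p < 2 + 1 / (d : ℝ) →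
        eLpNorm f (ENNReal.ofReal p) (volume.restrict (cylinder r z₀)) ≤
          ENNReal.ofReal (C * (2 + 1 / (d : ℝ) - p)⁻¹ * (1 / (R - r) ^ 2)) *
            (eLpNorm f 2 volume + eLpNorm S 2 volume) := by
  obtain ⟨C₁, hC₁, hint⟩ := exists_integrability_bound hd
  obtain ⟨C₂, hC₂, hloc⟩ := exists_locBound_le d hlam hLam
  refine ⟨C₁ * C₂, by positivity, fun z₀ r R hr hrR hR f h S g F H hE p hp hp2 => ?_⟩
  have hrb : r < r + (R - r) / 3 := by linarith
  have hbR : r + (R - r) / 3 < R := by linarith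
  have hη : ∀ n : ℕ, 0 < 1 / ((n : ℝ) + 1) := fun n => Nat.one_div_pos_of_nat
  have hp' : 0 < 2 + 1 / (d : ℝ) - p := by linarith
  -- The truncation width 1/(n+1) tends to zero, with bounds independent of n, and Fatou's lemma
  -- gives the estimate up to the final time.
  refine (Lp.eLpNorm_lim_le_liminf_eLpNorm (f := fun n z => f z *
    cutoff r (r + (R - r) / 3) (1 / ((n : ℝ) + 1)) z₀ z) (fun n => ?_) f ?_).trans ?_
  · exact (H.meas_f.mul cutoff.smooth.continuous.measurable).aestronglyMeasurable
  · filter_upwards [ae_restrict_of_ae (ae_time_ne z₀.1),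
      ae_restrict_mem (measurableSet_cylinder r z₀)] with z hz hzc
    refine tendsto_const_nhds.congr' ?_
    filter_upwards [eventually_cutoff_eq_one hr hrb hzc hz] with n hn
    rw [hn, mul_one]
  · refine liminf_le_of_le (by isBoundedDefault) fun a ha => ?_
    obtain ⟨n, hn⟩ := ha.exists
    refine hn.trans ((eLpNorm_mono_measure _ Measure.restrict_le_self).trans ?_)
    refine (hint _ f h g F H _ (cutoff.isTest hr hrb hbR (hη n)) cutoff.nonneg z₀.1
      (cutoff_window hr hrb (hbR.trans_le hR) (hη n)) p hp hp2).trans ?_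
    calc _ ≤ ENNReal.ofReal (C₁ * (2 + 1 / (d : ℝ) - p)⁻¹) * (ENNReal.ofReal (C₂ / (R - r) ^ 2) *
          (eLpNorm f 2 volume + eLpNorm S 2 volume)) := by
          gcongr
          exact hloc z₀ r R _ hr hrR hR (hη n) f h S g F H hE
      _ = _ := by
          rw [← mul_assoc, ← ENNReal.ofReal_mul (by positivity)]
          congr 2
          ring

/-- Increments in position on kinetic cylinders. -/
theorem exists_increment_cylinder_le (d : ℕ) {lam Lam : ℝ} (hlam : 0 < lam)
    (hLam : lam < Lam) : ∃ C : ℝ, 0 < C ∧ ∀ (z₀ : Z d) (r R : ℝ), 0 < r → r < R → R ≤ 1 →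
      ∀ (f h S : Z d → ℝ) (g F : Fin d → Z d → ℝ), WeakSub (openCylinder R z₀) f h g F →
        Elliptic lam Lam S h g F → ∀ k : E d,
        ∫⁻ z in cylinder r z₀ ∩ shiftX k ⁻¹' cylinder r z₀, ‖f (shiftX k z) - f z‖ₑ ≤
          ENNReal.ofReal (C * (R ^ (1 + 2 * d) * (1 / (R - r) ^ 2))) *
            (eLpNorm f 2 volume + eLpNorm S 2 volume) * ENNReal.ofReal (‖k‖ ^ (1 / 3 : ℝ)) := by
  obtain ⟨C₁, hC₁, hint⟩ := exists_increment_bound d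
  obtain ⟨C₂, hC₂, hloc⟩ := exists_locBound_le d hlam hLam
  set ω := volume.real (Metric.ball (0 : E d) 1) with hω
  have hω0 : 0 < ω := ENNReal.toReal_pos (Metric.measure_ball_pos _ _ one_pos).ne'
    measure_ball_lt_top.ne
  refine ⟨C₁ * C₂ * ω, by positivity, fun z₀ r R hr hrR hR f h S g F H hE k => ?_⟩
  have hR0 : 0 < R := hr.trans hrR
  have hrb : r < r + (R - r) / 3 := by linarith
  have hbR : r + (R - r) / 3 < R := by linarith
  have hη : ∀ n : ℕ, 0 < 1 / ((n : ℝ) + 1) := fun n => Nat.one_div_pos_of_nat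
  have hk := measurePreserving_shiftX (d := d) k
  have hmQ : MeasurableSet (cylinder r z₀ ∩ shiftX k ⁻¹' cylinder r z₀) :=
    (measurableSet_cylinder r z₀).inter (hk.measurable (measurableSet_cylinder r z₀))
  have hmn : ∀ n : ℕ, Measurable fun z : Z d => f z *
      cutoff r (r + (R - r) / 3) (1 / ((n : ℝ) + 1)) z₀ z := fun n =>
    H.meas_f.mul cutoff.smooth.continuous.measurable
  have hmn' : ∀ n : ℕ, Measurable fun z : Z d => f (shiftX k z) *
      cutoff r (r + (R - r) / 3) (1 / ((n : ℝ) + 1)) z₀ (shiftX k z) := fun n =>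
    (hmn n).comp hk.measurable
  rw [← eLpNorm_one_eq_lintegral_enorm]
  -- The same limit as for integrability. The domain contains only points whose translate also lies
  -- in the cylinder, so both cutoffs become one.
  refine (Lp.eLpNorm_lim_le_liminf_eLpNorm (f := fun (n : ℕ) z => f (shiftX k z) *
    cutoff r (r + (R - r) / 3) (1 / ((n : ℝ) + 1)) z₀ (shiftX k z) - f z *
    cutoff r (r + (R - r) / 3) (1 / ((n : ℝ) + 1)) z₀ z) (fun n => ?_) _ ?_).trans ?_
  · exact ((hmn' n).sub (hmn n)).aestronglyMeasurable
  · filter_upwards [ae_restrict_of_ae (ae_time_ne z₀.1), ae_restrict_mem hmQ] with z hz hzc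
    refine tendsto_const_nhds.congr' ?_
    filter_upwards [eventually_cutoff_eq_one hr hrb hzc.1 hz,
      eventually_cutoff_eq_one hr hrb (z := shiftX k z) hzc.2 hz] with n hn hn'
    rw [hn, hn', mul_one, mul_one]
  · refine liminf_le_of_le (by isBoundedDefault) fun a ha => ?_
    obtain ⟨n, hn⟩ := ha.exists
    refine hn.trans ((eLpNorm_mono_measure _ Measure.restrict_le_self).trans ?_)
    rw [eLpNorm_one_eq_lintegral_enorm]
    refine (hint _ f h g F H (volume_openCylinder_ne_top hR0 z₀) _
      (cutoff.isTest hr hrb hbR (hη n)) cutoff.nonneg z₀.1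
      (cutoff_window hr hrb (hbR.trans_le hR) (hη n)) k).trans ?_
    have hvol : volume (openCylinder R z₀) ^ (1 / 2 : ℝ) ≤ ENNReal.ofReal (ω * R ^ (1 + 2 * d)) := by
      rw [← volume_cylinder_rpow hR0 z₀]
      gcongr
      exact openCylinder_subset R z₀
    calc _ ≤ ENNReal.ofReal (C₁ * ‖k‖ ^ (1 / 3 : ℝ)) * (ENNReal.ofReal (C₂ / (R - r) ^ 2) *
          (eLpNorm f 2 volume + eLpNorm S 2 volume) * ENNReal.ofReal (ω * R ^ (1 + 2 * d))) := by
          gcongr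
          exact hloc z₀ r R _ hr hrR hR (hη n) f h S g F H hE
      _ = ENNReal.ofReal C₁ * ENNReal.ofReal (C₂ / (R - r) ^ 2) *
          ENNReal.ofReal (ω * R ^ (1 + 2 * d)) *
          (eLpNorm f 2 volume + eLpNorm S 2 volume) * ENNReal.ofReal (‖k‖ ^ (1 / 3 : ℝ)) := by
          rw [ENNReal.ofReal_mul hC₁.le]; ring
      _ = _ := by
          rw [← ENNReal.ofReal_mul hC₁.le, ← ENNReal.ofReal_mul (by positivity)]
          congr 3
          ring

/-- The Gagliardo part of the kinetic Sobolev norm in terms of the increments in position. -/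
theorem lintegral_gagliardo_eq {f : Z d → ℝ} (hf : Measurable f) {Q : Set (Z d)}
    (hQ : MeasurableSet Q) (s : ℝ) :
    ∫⁻ p : ℝ × E d, ∫⁻ x in {x : E d | (p.1, x, p.2) ∈ Q}, ∫⁻ y in {x : E d | (p.1, x, p.2) ∈ Q},
        ‖f (p.1, x, p.2) - f (p.1, y, p.2)‖ₑ / ‖x - y‖ₑ ^ s =
      ∫⁻ k : E d, (∫⁻ z in Q ∩ shiftX k ⁻¹' Q, ‖f (shiftX k z) - f z‖ₑ) / ‖k‖ₑ ^ s := by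
  set G : E d × Z d → ℝ≥0∞ := fun q => Q.indicator 1 q.2 * Q.indicator 1 (shiftX q.1 q.2) *
    ‖f (shiftX q.1 q.2) - f q.2‖ₑ / ‖q.1‖ₑ ^ s with hG
  have hshift : Measurable fun q : E d × Z d => shiftX q.1 q.2 := by unfold shiftX; fun_prop
  have h1Q : Measurable (Q.indicator (1 : Z d → ℝ≥0∞)) := measurable_one.indicator hQ
  have hGm : Measurable G := by
    refine Measurable.div (((h1Q.comp measurable_snd).mul (h1Q.comp hshift)).mul ?_) ?_
    · exact ((hf.comp hshift).sub (hf.comp measurable_snd)).enorm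
    · exact (measurable_fst.enorm).pow_const s
  have slice : ∀ p : ℝ × E d, MeasurableSet {x : E d | (p.1, x, p.2) ∈ Q} := fun p =>
    (show Measurable fun x : E d => ((p.1, x, p.2) : Z d) by fun_prop) hQ
  have step : ∀ p : ℝ × E d, ∫⁻ x in {x : E d | (p.1, x, p.2) ∈ Q},
      ∫⁻ y in {x : E d | (p.1, x, p.2) ∈ Q},
        ‖f (p.1, x, p.2) - f (p.1, y, p.2)‖ₑ / ‖x - y‖ₑ ^ s =
      ∫⁻ x : E d, ∫⁻ k : E d, G (k, (p.1, x, p.2)) := by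
    intro p
    rw [← lintegral_indicator (slice p)]
    refine lintegral_congr fun x => ?_
    by_cases hx : ((p.1, x, p.2) : Z d) ∈ Q
    -- Substitution y = x + k at fixed x.
    · rw [indicator_of_mem (by exact hx), ← lintegral_indicator (slice p),
        ← lintegral_add_left_eq_self _ x]
      refine lintegral_congr fun k => ?_
      by_cases hk : ((p.1, x + k, p.2) : Z d) ∈ Q
      · rw [indicator_of_mem (by exact hk)]
        simp [hG, hx, hk, shiftX, enorm_sub_rev (f (p.1, x, p.2))]
      · rw [indicator_of_notMem (by exact hk)]
        simp [hG, hk, shiftX]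
    · rw [indicator_of_notMem (by exact hx)]
      simp [hG, hx]
  simp_rw [step]
  rw [lintegral_eq_lintegral_position (G := fun z => ∫⁻ k : E d, G (k, z))
    (Measurable.lintegral_prod_left' hGm), lintegral_lintegral_swap
    (f := fun z k => G (k, z)) (hGm.comp measurable_swap).aemeasurable]
  refine lintegral_congr fun k => ?_
  have hkm : Measurable fun z : Z d => shiftX k z := hshift.comp measurable_prodMk_left
  have hmQ : MeasurableSet (Q ∩ shiftX k ⁻¹' Q) := hQ.inter (hkm hQ)
  have hinc : Measurable fun z : Z d => ‖f (shiftX k z) - f z‖ₑ := ((hf.comp hkm).sub hf).enorm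
  rw [← lintegral_indicator hmQ, div_eq_mul_inv, ← lintegral_mul_const _ (hinc.indicator hmQ)]
  refine lintegral_congr fun z => ?_
  by_cases h1 : z ∈ Q <;> by_cases h2 : shiftX k z ∈ Q <;> simp [hG, h1, h2, div_eq_mul_inv]

/-- Position slices are balls of radius r³ < 1, so longer translations never join two points of a
slice. The singular weight then only has to be integrated over a bounded set of k. -/
theorem norm_lt_two_of_inter_nonempty {r : ℝ} (hr0 : 0 < r) (hr : r < 1) {z₀ : Z d} {k : E d}
    {z : Z d} (hz : z ∈ cylinder r z₀ ∩ shiftX k ⁻¹' cylinder r z₀) : k ∈ Metric.ball (0 : E d) 2 := by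
  obtain ⟨⟨-, -, h1, -⟩, ⟨-, -, h2, -⟩⟩ := hz
  have hr3 : r ^ 3 < 1 := pow_lt_one₀ hr0.le hr three_ne_zero
  have e : k = (z.2.1 + k - z₀.2.1 - (z.1 - z₀.1) • z₀.2.2) -
      (z.2.1 - z₀.2.1 - (z.1 - z₀.1) • z₀.2.2) := by abel
  rw [mem_ball_zero_iff, e]
  refine (norm_sub_le _ _).trans_lt ?_
  change ‖z.2.1 + k - z₀.2.1 - (z.1 - z₀.1) • z₀.2.2‖ < r ^ 3 at h2
  linarith

/-- Gain of regularity in position on kinetic cylinders. -/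
theorem exists_kineticSobolevNorm_cylinder_le (hd : 0 < d) {lam Lam : ℝ} (hlam : 0 < lam)
    (hLam : lam < Lam) : ∃ C : ℝ, 0 < C ∧ ∀ (z₀ : Z d) (r R : ℝ), 0 < r → r < R → R ≤ 1 →
      ∀ (f h S : Z d → ℝ) (g F : Fin d → Z d → ℝ), WeakSub (openCylinder R z₀) f h g F →
        Elliptic lam Lam S h g F → ∀ σ : ℝ, 0 ≤ σ → σ < 1 / 3 →
        kineticSobolevNorm σ (cylinder r z₀) f ≤
          ENNReal.ofReal (C * (1 / 3 - σ)⁻¹ * (R ^ (1 + 2 * d) * (1 / (R - r) ^ 2))) *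
            (eLpNorm f 2 volume + eLpNorm S 2 volume) := by
  obtain ⟨C₁, hC₁, hinc⟩ := exists_increment_cylinder_le d hlam hLam
  obtain ⟨C₂, hC₂, hwt⟩ := exists_lintegral_weight_le hd
  set ω := volume.real (Metric.ball (0 : E d) 1) with hω
  have hω0 : 0 < ω := ENNReal.toReal_pos (Metric.measure_ball_pos _ _ one_pos).ne'
    measure_ball_lt_top.ne
  refine ⟨ω + C₁ * C₂, by positivity, fun z₀ r R hr hrR hR f h S g F H hE σ h0 h1 => ?_⟩
  have hR0 : 0 < R := hr.trans hrR
  set Q := cylinder r z₀ with hQdef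
  have hQ : MeasurableSet Q := measurableSet_cylinder r z₀
  set N := eLpNorm f 2 volume + eLpNorm S 2 volume with hN
  set A := R ^ (1 + 2 * d) * (1 / (R - r) ^ 2) with hA
  have hδ : 0 < R - r := sub_pos.2 hrR
  have hA0 : 0 ≤ A := by positivity
  have hσ : 0 < 1 / 3 - σ := by linarith
  have slice : ∀ p : ℝ × E d, MeasurableSet {x : E d | (p.1, x, p.2) ∈ Q} := fun p =>
    (show Measurable fun x : E d => ((p.1, x, p.2) : Z d) by fun_prop) hQ
  have hfi : Measurable (Q.indicator fun z => ‖f z‖ₑ) := H.meas_f.enorm.indicator hQ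
  have eL1 : ∀ p : ℝ × E d, ∫⁻ x in {x : E d | (p.1, x, p.2) ∈ Q}, ‖f (p.1, x, p.2)‖ₑ =
      ∫⁻ x : E d, Q.indicator (fun z => ‖f z‖ₑ) (p.1, x, p.2) := fun p => by
    rw [← lintegral_indicator (slice p)]; rfl
  have mL1 : Measurable fun p : ℝ × E d =>
      ∫⁻ x in {x : E d | (p.1, x, p.2) ∈ Q}, ‖f (p.1, x, p.2)‖ₑ := by
    simp_rw [eL1]
    have hm : Measurable fun q : (ℝ × E d) × E d => Q.indicator (fun z => ‖f z‖ₑ)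
        (q.1.1, q.2, q.1.2) := hfi.comp (by fun_prop)
    exact hm.lintegral_prod_right'
  have bL1 : ∫⁻ p : ℝ × E d, ∫⁻ x in {x : E d | (p.1, x, p.2) ∈ Q}, ‖f (p.1, x, p.2)‖ₑ ≤
      ENNReal.ofReal (ω * (1 / 3 - σ)⁻¹ * A) * N := by
    simp_rw [eL1]
    rw [lintegral_eq_lintegral_position hfi, lintegral_indicator hQ,
      ← eLpNorm_one_eq_lintegral_enorm]
    refine (eLpNorm_le_eLpNorm_mul_rpow_measure_univ (q := 2) (by norm_num)
      H.memLp_f.1.restrict).trans ?_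
    rw [Measure.restrict_apply_univ, show 1 / (1 : ℝ≥0∞).toReal - 1 / (2 : ℝ≥0∞).toReal =
        (1 / 2 : ℝ) by norm_num, mul_comm]
    have v1 : volume Q ^ (1 / 2 : ℝ) ≤ ENNReal.ofReal (ω * (1 / 3 - σ)⁻¹ * A) := by
      calc volume Q ^ (1 / 2 : ℝ) ≤ volume (cylinder R z₀) ^ (1 / 2 : ℝ) := by
            gcongr; exact cylinder_mono hr.le hrR.le z₀
        _ = ENNReal.ofReal (ω * R ^ (1 + 2 * d)) := volume_cylinder_rpow hR0 z₀
        _ ≤ _ := by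
          refine ENNReal.ofReal_le_ofReal ?_
          -- The L¹ part needs neither (1/3 - σ)⁻¹ nor (R-r)⁻²; both are at least one and are
          -- inserted to match the Gagliardo part.
          have q1 : 1 ≤ (1 / 3 - σ)⁻¹ := (one_le_inv₀ hσ).2 (by linarith)
          have q2 : 1 ≤ 1 / (R - r) ^ 2 := by
            rw [one_le_div (by positivity)]; exact pow_le_one₀ hδ.le (by linarith)
          calc ω * R ^ (1 + 2 * d) = ω * 1 * (R ^ (1 + 2 * d) * 1) := by ring
            _ ≤ _ := by rw [hA]; gcongr
    gcongr
    calc eLpNorm f 2 (volume.restrict Q) ≤ eLpNorm f 2 volume :=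
          eLpNorm_mono_measure _ Measure.restrict_le_self
      _ ≤ N := le_self_add
  have bG : ∫⁻ p : ℝ × E d, ∫⁻ x in {x : E d | (p.1, x, p.2) ∈ Q},
      ∫⁻ y in {x : E d | (p.1, x, p.2) ∈ Q},
        ‖f (p.1, x, p.2) - f (p.1, y, p.2)‖ₑ / ‖x - y‖ₑ ^ ((d : ℝ) + σ) ≤
      ENNReal.ofReal (C₁ * C₂ * (1 / 3 - σ)⁻¹ * A) * N := by
    rw [lintegral_gagliardo_eq H.meas_f hQ]
    have hw : Measurable fun k : E d =>
        ENNReal.ofReal (‖k‖ ^ (1 / 3 : ℝ)) / ‖k‖ₑ ^ ((d : ℝ) + σ) := by fun_prop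
    calc _ ≤ ∫⁻ k : E d, ENNReal.ofReal (C₁ * A) * N * (Metric.ball (0 : E d) 2).indicator
          (fun k => ENNReal.ofReal (‖k‖ ^ (1 / 3 : ℝ)) / ‖k‖ₑ ^ ((d : ℝ) + σ)) k := by
          refine lintegral_mono fun k => ?_
          by_cases hk : k ∈ Metric.ball (0 : E d) 2
          · rw [indicator_of_mem hk, ← mul_div_assoc]
            gcongr
            exact hinc z₀ r R hr hrR hR f h S g F H hE k
          · have : Q ∩ shiftX k ⁻¹' Q = ∅ := by
              by_contra hne
              obtain ⟨z, hz⟩ := nonempty_iff_ne_empty.2 hne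
              exact hk (norm_lt_two_of_inter_nonempty hr (hrR.trans_le hR) hz)
            simp [this]
      _ = ENNReal.ofReal (C₁ * A) * N * ∫⁻ k in Metric.ball (0 : E d) 2,
          ENNReal.ofReal (‖k‖ ^ (1 / 3 : ℝ)) / ‖k‖ₑ ^ ((d : ℝ) + σ) := by
          rw [lintegral_const_mul _ (hw.indicator Metric.isOpen_ball.measurableSet),
            lintegral_indicator Metric.isOpen_ball.measurableSet]
      _ ≤ ENNReal.ofReal (C₁ * A) * N * ENNReal.ofReal (C₂ * (1 / 3 - σ)⁻¹) := by
          gcongr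
          exact hwt σ h0 h1
      _ = _ := by
          rw [mul_right_comm, ← ENNReal.ofReal_mul (by positivity)]
          congr 2
          ring
  unfold kineticSobolevNorm sobolevNorm
  rw [lintegral_add_left mL1]
  calc _ ≤ ENNReal.ofReal (ω * (1 / 3 - σ)⁻¹ * A) * N +
        ENNReal.ofReal (C₁ * C₂ * (1 / 3 - σ)⁻¹ * A) * N := by
        refine add_le_add bL1 (le_trans ?_ bG)
        refine lintegral_mono fun p => ?_
        dsimp only
        split_ifs
        · exact zero_le
        · exact le_rfl
    _ = _ := by
        rw [← add_mul, ← ENNReal.ofReal_add (by positivity) (by positivity)]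
        congr 2
        ring

/-! ### From the equation on U to fields on the whole space. -/

section Spectral

variable {A : Matrix (Fin d) (Fin d) ℝ}

theorem inner_eigenvectorBasis_toEuclideanLin (hA : A.IsHermitian) (i : Fin d) (x : E d) :
    inner ℝ (hA.eigenvectorBasis i) (Matrix.toEuclideanLin A x) =
      hA.eigenvalues i * inner ℝ (hA.eigenvectorBasis i) x := by
  have hs := Matrix.isSymmetric_toEuclideanLin_iff.2 hA
  have he : Matrix.toEuclideanLin A (hA.eigenvectorBasis i) =
      hA.eigenvalues i • hA.eigenvectorBasis i := by
    rw [Matrix.toLpLin_apply, hA.mulVec_eigenvectorBasis]; rfl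
  rw [← hs, he, real_inner_smul_left]

theorem le_inner_toEuclideanLin (hA : A.IsHermitian) {lam Lam : ℝ}
    (hs : spectrum ℝ A ⊆ Icc lam Lam) (x : E d) :
    lam * ‖x‖ ^ 2 ≤ inner ℝ (Matrix.toEuclideanLin A x) x := by
  rw [← hA.eigenvectorBasis.sum_sq_norm_inner_right x,
    ← hA.eigenvectorBasis.sum_inner_mul_inner, Finset.mul_sum]
  refine Finset.sum_le_sum fun i _ => ?_
  rw [real_inner_comm (hA.eigenvectorBasis i), inner_eigenvectorBasis_toEuclideanLin, Real.norm_eq_abs, sq_abs, mul_assoc,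
    ← sq]
  exact mul_le_mul_of_nonneg_right (hs (hA.eigenvalues_mem_spectrum_real i)).1 (sq_nonneg _)

theorem norm_toEuclideanLin_sq_le (hA : A.IsHermitian) {lam Lam : ℝ} (hlam : 0 ≤ lam)
    (hs : spectrum ℝ A ⊆ Icc lam Lam) (x : E d) :
    ‖Matrix.toEuclideanLin A x‖ ^ 2 ≤ Lam ^ 2 * ‖x‖ ^ 2 := by
  rw [← hA.eigenvectorBasis.sum_sq_norm_inner_right x,
    ← hA.eigenvectorBasis.sum_sq_norm_inner_right (Matrix.toEuclideanLin A x), Finset.mul_sum]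
  refine Finset.sum_le_sum fun i _ => ?_
  rw [inner_eigenvectorBasis_toEuclideanLin, norm_mul, mul_pow]
  have h := hs (hA.eigenvalues_mem_spectrum_real i)
  gcongr
  rw [Real.norm_eq_abs, abs_of_nonneg (hlam.trans h.1)]
  exact h.2

end Spectral

theorem exists_measurable_extension {V : Set (Z d)} (hV : MeasurableSet V) {u : Z d → ℝ}
    (hu : MemLp u 2 (volume.restrict V)) : ∃ u' : Z d → ℝ, Measurable u' ∧ MemLp u' 2 volume ∧
      (∀ᵐ z ∂volume.restrict V, u' z = u z) ∧ (∀ z, z ∉ V → u' z = 0) := by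
  have hm := hu.1.aemeasurable
  have hae : ∀ᵐ z ∂volume.restrict V, V.indicator (hm.mk u) z = u z := by
    filter_upwards [hm.ae_eq_mk, ae_restrict_mem hV] with z h1 h2
    rw [indicator_of_mem h2, h1]
  refine ⟨V.indicator (hm.mk u), hm.measurable_mk.indicator hV, ?_, hae, fun z hz =>
    indicator_of_notMem hz _⟩
  rw [memLp_indicator_iff_restrict hV]
  exact (memLp_congr_ae hm.ae_eq_mk).1 hu

theorem setIntegral_eq_integral_of_ae {U V : Set (Z d)} (hU : MeasurableSet U)
    (hVU : V ⊆ U) {w w' : Z d → ℝ} (h : ∀ᵐ z ∂volume.restrict V, w z = w' z)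
    (h0 : ∀ z, z ∉ V → w z = 0) (h0' : ∀ z, z ∉ V → w' z = 0) :
    ∫ z in U, w z = ∫ z, w' z := by
  rw [setIntegral_eq_of_subset_of_forall_sdiff_eq_zero hU hVU fun z hz => h0 z hz.2,
    integral_congr_ae h, setIntegral_eq_integral_of_forall_compl_eq_zero h0']

theorem continuous_gradV {φ : Z d → ℝ} (hφ : ContDiff ℝ 1 φ) : Continuous (gradV φ) := by
  have e : gradV φ = fun z => WithLp.toLp 2 fun i => dV i φ z := by
    funext z
    ext i
    exact gradV_apply (hφ.differentiable one_ne_zero z) i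
  rw [e]
  exact (PiLp.continuous_toLp 2 _).comp (continuous_pi fun i => continuous_dV hφ i)

theorem hasCompactSupport_gradV {φ : Z d → ℝ} (hφ : ContDiff ℝ 1 φ) (hs : HasCompactSupport φ) :
    HasCompactSupport (gradV φ) := by
  refine HasCompactSupport.intro hs fun z hz => ?_
  ext i
  rw [gradV_apply (hφ.differentiable one_ne_zero z), dV_eq_zero_of_notMem hz]
  rfl

theorem IsTest.mono {U V : Set (Z d)} {φ : Z d → ℝ} (h : IsTest V φ) (hVU : V ⊆ U) :
    IsTest U φ :=
  ⟨h.smooth, h.compact, h.support.trans hVU⟩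

theorem IsWeakGradV.integral_mul_dV {U : Set (Z d)} {f : Z d → ℝ} {g : Z d → E d}
    (h : IsWeakGradV U f g) (hf : MemLp f 2 (volume.restrict U))
    (hg : MemLp g 2 (volume.restrict U)) {φ : Z d → ℝ} (hφ : IsTest U φ) (i : Fin d) :
    ∫ z in U, f z * dV i φ z = -∫ z in U, φ z * g z i := by
  have hφ1 : ContDiff ℝ 1 φ := hφ.smooth.of_le (by exact_mod_cast le_top)
  have m1 : MemLp (gradV φ) 2 (volume.restrict U) :=
    (continuous_gradV hφ1).memLp_of_hasCompactSupport (hasCompactSupport_gradV hφ1 hφ.compact)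
  have m2 : MemLp φ 2 (volume.restrict U) :=
    hφ1.continuous.memLp_of_hasCompactSupport hφ.compact
  have i1 : Integrable (fun z => f z • gradV φ z) (volume.restrict U) :=
    memLp_one_iff_integrable.1 (m1.smul (r := 1) hf)
  have i2 : Integrable (fun z => φ z • g z) (volume.restrict U) :=
    memLp_one_iff_integrable.1 (hg.smul (r := 1) m2)
  have key := congrArg (EuclideanSpace.proj i : E d →L[ℝ] ℝ) (h.parts φ hφ)
  rw [map_neg, ← ContinuousLinearMap.integral_comp_comm _ i1,
    ← ContinuousLinearMap.integral_comp_comm _ i2] at key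
  simpa [gradV_apply (hφ1.differentiable one_ne_zero _)] using key

/-- The only renormalization that is used: the nonlinear energy estimate comes from multiplying the
mollified inequality by the solution, not from a choice of β. -/
theorem renormalization_id : Renormalization fun s => s where
  smooth := contDiff_id
  deriv_nonneg s := by simp
  deriv2_nonneg s := by simp
  bounded := ⟨1, fun s => by simp⟩

theorem memLp_flux {V : Set (Z d)} {lam Lam : ℝ} {A : Z d → Matrix (Fin d) (Fin d) ℝ}
    {g : Z d → E d} (hA : ∀ i j, AEMeasurable (fun z => A z i j) (volume.restrict V))
    (hg : MemLp g 2 (volume.restrict V)) (hlam : 0 ≤ lam) (hLam : 0 ≤ Lam)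
    (hS : ∀ᵐ z ∂volume.restrict V, (A z).IsHermitian)
    (hE : ∀ᵐ z ∂volume.restrict V, spectrum ℝ (A z) ⊆ Icc lam Lam) (i : Fin d) :
    MemLp (fun z => Matrix.toEuclideanLin (A z) (g z) i) 2 (volume.restrict V) := by
  have hgi : ∀ j, AEMeasurable (fun z => g z j) (volume.restrict V) := fun j =>
    (EuclideanSpace.proj j : E d →L[ℝ] ℝ).continuous.measurable.comp_aemeasurable hg.1.aemeasurable
  have hm : AEMeasurable (fun z => Matrix.toEuclideanLin (A z) (g z) i) (volume.restrict V) := by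
    have e : (fun z => Matrix.toEuclideanLin (A z) (g z) i) =
        fun z => ∑ j, A z i j * g z j := by
      funext z
      rw [Matrix.toLpLin_apply]
      rfl
    rw [e]
    exact Finset.aemeasurable_fun_sum _ fun j _ => (hA i j).mul (hgi j)
  refine hg.of_le_mul (c := Lam) hm.aestronglyMeasurable ?_
  filter_upwards [hS, hE] with z h1 h2
  refine (PiLp.norm_apply_le _ i).trans ?_
  refine le_of_sq_le_sq ?_ (by positivity)
  rw [mul_pow]
  exact norm_toEuclideanLin_sq_le h1 hlam h2 (g z)

theorem memLp_source {V : Set (Z d)} {Lam : ℝ} {B g : Z d → E d} {S : Z d → ℝ}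
    (hB : AEMeasurable B (volume.restrict V)) (hb : ∀ᵐ z ∂volume.restrict V, ‖B z‖ ≤ Lam)
    (hg : MemLp g 2 (volume.restrict V)) (hS : MemLp S 2 (volume.restrict V)) :
    MemLp (fun z => inner ℝ (B z) (g z) + S z) 2 (volume.restrict V) := by
  refine MemLp.add ?_ hS
  refine hg.of_le_mul (c := Lam) (hB.inner hg.1.aemeasurable).aestronglyMeasurable ?_
  filter_upwards [hb] with z h
  exact (norm_inner_le_norm _ _).trans (by gcongr)

/-- Weak sub-solutions, restricted to an open subset of finite measure and extended by zero. -/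
theorem exists_weakSub {lam Lam : ℝ} (hlam : 0 < lam) (hLam : lam < Lam) {U V : Set (Z d)}
    {A : Z d → Matrix (Fin d) (Fin d) ℝ} {B : Z d → E d} {S f : Z d → ℝ} (hU : IsOpen U)
    (hV : IsOpen V) (hVU : V ⊆ U) (hfin : volume V ≠ ∞) (hc : Coefficients U lam Lam A B S)
    (hf : IsWeakSubsolution U A B S f) (h0 : ∀ᵐ z ∂volume.restrict U, 0 ≤ f z) :
    ∃ (f' h' S' : Z d → ℝ) (g' F' : Fin d → Z d → ℝ), WeakSub V f' h' g' F' ∧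
      Elliptic lam Lam S' h' g' F' ∧ (∀ᵐ z ∂volume.restrict V, f' z = f z) ∧
      eLpNorm f' 2 volume = eLpNorm f 2 (volume.restrict V) ∧
      eLpNorm S' 2 volume = eLpNorm S 2 (volume.restrict V) := by
  obtain ⟨hf2, -, g, hg, hg2⟩ := hf.energy
  have hLam0 : 0 ≤ Lam := (hlam.trans hLam).le
  have hVm := hV.measurableSet
  have hle : volume.restrict V ≤ volume.restrict U := Measure.restrict_mono_set _ hVU
  have hac : ∀ {P : Z d → Prop}, (∀ᵐ z ∂volume.restrict U, P z) →
      ∀ᵐ z ∂volume.restrict V, P z := fun h => ae_mono hle h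
  have hgV := hg2.mono_measure hle
  have hherm : ∀ᵐ z ∂volume.restrict V, (A z).IsHermitian := by
    filter_upwards [hac hc.symm_A] with z hz
    rwa [Matrix.IsHermitian, Matrix.conjTranspose_eq_transpose_of_trivial]
  have hSV : MemLp S 2 (volume.restrict V) := by
    have : IsFiniteMeasure (volume.restrict V) := ⟨by simpa using hfin.lt_top⟩
    exact (hc.bounded_S.mono_measure hle).mono_exponent le_top
  have hFV := memLp_flux (fun i j => (hc.measurable_A i j).mono_measure hle) hgV hlam.le hLam0
    hherm (hac hc.eigenvalues_A)
  have hhV := memLp_source (hc.measurable_B.mono_measure hle) (hac hc.bound_B) hgV hSV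
  have hgi : ∀ i, MemLp (fun z => g z i) 2 (volume.restrict V) := fun i =>
    hgV.continuousLinearMap_comp (EuclideanSpace.proj i : E d →L[ℝ] ℝ)
  obtain ⟨f', mf, lf, af, zf⟩ := exists_measurable_extension hVm (hf2.mono_measure hle)
  obtain ⟨S', mS, lS, aS, zS⟩ := exists_measurable_extension hVm hSV
  obtain ⟨h', mh, lh, ah, zh⟩ := exists_measurable_extension hVm hhV
  choose g' mg lg ag zg using fun i => exists_measurable_extension hVm (hgi i)
  choose F' mF lF aF zF using fun i => exists_measurable_extension hVm (hFV i)
  have glob : ∀ {P : Z d → Prop}, (∀ᵐ z ∂volume.restrict V, P z) → (∀ z, z ∉ V → P z) →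
      ∀ᵐ z, P z := by
    intro P h1 h2
    filter_upwards [(ae_restrict_iff' hVm).1 h1] with z hz
    by_cases hzV : z ∈ V
    · exact hz hzV
    · exact h2 z hzV
  have ag' : ∀ᵐ z ∂volume.restrict V, ∀ i, g' i z = g z i := ae_all_iff.2 ag
  have aF' : ∀ᵐ z ∂volume.restrict V, ∀ i, F' i z = Matrix.toEuclideanLin (A z) (g z) i :=
    ae_all_iff.2 aF
  have norm_eq : ∀ {u u' : Z d → ℝ}, (∀ᵐ z ∂volume.restrict V, u' z = u z) →
      (∀ z, z ∉ V → u' z = 0) → eLpNorm u' 2 volume = eLpNorm u 2 (volume.restrict V) := by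
    intro u u' h1 h2
    have e : V.indicator u' = u' := indicator_eq_self.2 fun z hz => by
      by_contra h; exact hz (h2 z h)
    rw [← eLpNorm_congr_ae h1, ← eLpNorm_indicator_eq_eLpNorm_restrict hVm, e]
  refine ⟨f', h', S', g', F', ⟨hV, lf, mf, lh, mh, lg, mg, lF, mF, ?_, ?_, ?_⟩,
    ⟨lS, ?_, ?_, ?_⟩, af, norm_eq af zf, norm_eq aS zS⟩
  · refine glob ?_ fun z hz => (zf z hz).ge
    filter_upwards [af, hac h0] with z h1 h2
    rwa [h1]
  · intro i φ hφ
    have hz : ∀ z, z ∉ V → φ z = 0 := fun z hz =>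
      image_eq_zero_of_notMem_tsupport fun h => hz (hφ.support h)
    have hz' : ∀ z, z ∉ V → dV i φ z = 0 := fun z hz =>
      dV_eq_zero_of_notMem fun h => hz (hφ.support h)
    have key := hg.integral_mul_dV hf2 hg2 (hφ.mono hVU) i
    rw [setIntegral_eq_integral_of_ae hU.measurableSet hVU (w' := fun z => f' z * dV i φ z)
      (by filter_upwards [af] with z h; rw [h]) (fun z h => by rw [hz' z h, mul_zero])
      (fun z h => by rw [hz' z h, mul_zero]),
      setIntegral_eq_integral_of_ae hU.measurableSet hVU (w' := fun z => g' i z * φ z)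
      (by filter_upwards [ag i] with z h; rw [h, mul_comm]) (fun z h => by rw [hz z h, zero_mul])
      (fun z h => by rw [hz z h, mul_zero])] at key
    exact key
  · intro φ hφ hφ0
    have hφ1 : ContDiff ℝ 1 φ := hφ.smooth.of_le (by exact_mod_cast le_top)
    have hz : ∀ z, z ∉ V → φ z = 0 := fun z hz =>
      image_eq_zero_of_notMem_tsupport fun h => hz (hφ.support h)
    have hz' : ∀ i, ∀ z, z ∉ V → dV i φ z = 0 := fun i z hz =>
      dV_eq_zero_of_notMem fun h => hz (hφ.support h)
    have hzt : ∀ z, z ∉ V → transport φ z = 0 := fun z hz =>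
      transport_eq_zero_of_notMem fun h => hz (hφ.support h)
    have einn : ∀ (y : E d) z, inner ℝ y (gradV φ z) = ∑ i, y i * dV i φ z := fun y z => by
      rw [PiLp.inner_apply]
      refine Finset.sum_congr rfl fun i _ => ?_
      rw [gradV_apply (hφ1.differentiable one_ne_zero z)]
      simp [mul_comm]
    -- With β = id the field ∇_v β(f) is g itself and β' = 1. All integrands carry φ or its
    -- derivatives, supported in V, so the fields may be replaced by their extensions by zero.
    have key := hf.ineq _ renormalization_id g hg φ (hφ.mono hVU) hφ0
    simp only [einn, deriv_id'', mul_one] at key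
    rw [setIntegral_eq_integral_of_ae hU.measurableSet hVU (w' := fun z => f' z * transport φ z)
      (by filter_upwards [af] with z h; rw [h]) (fun z h => by rw [hzt z h, mul_zero])
      (fun z h => by rw [hzt z h, mul_zero]),
      setIntegral_eq_integral_of_ae hU.measurableSet hVU (w' := fun z => ∑ i, F' i z * dV i φ z)
      (by filter_upwards [aF'] with z h; simp only [h]) (fun z h => by simp [hz' _ z h])
      (fun z h => by simp [hz' _ z h]),
      setIntegral_eq_integral_of_ae hU.measurableSet hVU (w' := fun z => h' z * φ z)
      (by filter_upwards [ah] with z h; rw [h]) (fun z h => by rw [hz z h, mul_zero])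
      (fun z h => by rw [hz z h, mul_zero]), integral_finsetSum] at key
    · exact key
    · intro i _
      have hd : MemLp (dV i φ) 2 volume :=
        (continuous_dV hφ1 i).memLp_of_hasCompactSupport (hφ.compact.dV i)
      exact (lF i).integrable_mul hd
  · refine glob ?_ fun z hz => by simp [zg _ z hz]
    filter_upwards [ag', aF', hherm, hac hc.eigenvalues_A] with z h1 h2 h3 h4
    have := le_inner_toEuclideanLin h3 h4 (g z)
    rw [EuclideanSpace.real_norm_sq_eq, PiLp.inner_apply] at this
    simp only [h1, h2]
    simpa [mul_comm] using this
  · refine glob ?_ fun z hz => by simp [zg _ z hz, zF _ z hz]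
    filter_upwards [ag', aF', hherm, hac hc.eigenvalues_A] with z h1 h2 h3 h4
    have := norm_toEuclideanLin_sq_le h3 hlam.le h4 (g z)
    rw [EuclideanSpace.real_norm_sq_eq, EuclideanSpace.real_norm_sq_eq] at this
    simpa only [h1, h2] using this
  · refine glob ?_ fun z hz => by simp [zg _ z hz, zh z hz, zS z hz]
    filter_upwards [ag', ah, aS, hac hc.bound_B] with z h1 h2 h3 h4
    simp only [h1, h2, h3]
    rw [← EuclideanSpace.real_norm_sq_eq]
    have h5 := abs_real_inner_le_norm (B z) (g z)
    have h6 : ‖B z‖ * ‖g z‖ ≤ Lam * ‖g z‖ := by gcongr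
    have h7 : (inner ℝ (B z) (g z) : ℝ) ^ 2 ≤ (Lam * ‖g z‖) ^ 2 := by
      rw [← sq_abs]
      exact pow_le_pow_left₀ (abs_nonneg _) (h5.trans h6) 2
    nlinarith [sq_nonneg ((inner ℝ (B z) (g z) : ℝ) - S z)]

/-! ### Null sets and comparison with the stated constants. -/

theorem ae_cylinder_mem_openCylinder {r R : ℝ} (hr : 0 < r) (hrR : r ≤ R) (z₀ : Z d) :
    ∀ᵐ z, z ∈ cylinder r z₀ → z ∈ openCylinder R z₀ := by
  filter_upwards [ae_time_ne (d := d) z₀.1] with z hz hzc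
  obtain ⟨h1, h2, h3⟩ := cylinder_mono hr.le hrR z₀ hzc
  exact ⟨h1, h2.lt_of_ne (sub_ne_zero.2 hz), h3⟩

/-- By Fubini, for almost every (t, v) the two functions agree at almost every x of the slice, and
the slice norm does not see null sets. -/
theorem kineticSobolevNorm_le_of_ae {Q : Set (Z d)} (hQ : MeasurableSet Q) {f f' : Z d → ℝ}
    (h : ∀ᵐ z, z ∈ Q → f z = f' z) (σ : ℝ) :
    kineticSobolevNorm σ Q f ≤ kineticSobolevNorm σ Q f' := by
  refine lintegral_mono_ae ?_
  filter_upwards [ae_position_of_ae h] with p hp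
  have slice : MeasurableSet {x : E d | (p.1, x, p.2) ∈ Q} :=
    (show Measurable fun x : E d => ((p.1, x, p.2) : Z d) by fun_prop) hQ
  have hp' : ∀ᵐ x ∂volume.restrict {x : E d | (p.1, x, p.2) ∈ Q},
      f (p.1, x, p.2) = f' (p.1, x, p.2) := (ae_restrict_iff' slice).2 hp
  refine le_of_eq ?_
  unfold sobolevNorm
  congr 1
  · exact lintegral_congr_ae (hp'.mono fun x hx => by simp only [hx])
  · congr 1
    refine lintegral_congr_ae (hp'.mono fun x hx => ?_)
    exact lintegral_congr_ae (hp'.mono fun y hy => by simp only [hx, hy])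

/-- The estimates lose only (R-r)⁻², a summand of 𝒞 whose other summands are nonnegative. The
dependence on v₀ and the extra factor 1 + 1/(R-r) are slack. -/
theorem one_div_sq_le_C0 {r R : ℝ} (hr : 0 < r) (hrR : r < R) (v₀ : E d) :
    1 / (R - r) ^ 2 ≤ C0 r R v₀ := by
  have hδ : 0 < R - r := sub_pos.2 hrR
  have hR : 0 < R := hr.trans hrR
  have h1 : 0 ≤ (‖v₀‖ + R) / ((R - r) * r ^ 2) := by positivity
  have h2 : 0 ≤ 1 / ((R - r) * r) := by positivity
  unfold C0
  linarith

theorem one_div_sq_le_C1 {r R : ℝ} (hr : 0 < r) (hrR : r < R) (v₀ : E d) :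
    1 / (R - r) ^ 2 ≤ C1 r R v₀ := by
  have hδ : 0 < R - r := sub_pos.2 hrR
  have h0 := one_div_sq_le_C0 hr hrR v₀
  have h1 : 0 < 1 / (R - r) ^ 2 := by positivity
  refine h0.trans (le_mul_of_one_le_left (h1.le.trans h0) ?_)
  have : 0 < 1 / (R - r) := by positivity
  linarith

theorem mul_one_div_sq_le_C2 {r R : ℝ} (hr : 0 < r) (hrR : r < R) (v₀ : E d) :
    R ^ (1 + 2 * d) * (1 / (R - r) ^ 2) ≤ C2 r R v₀ := by
  have hR : 0 < R := hr.trans hrR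
  have h1 := one_div_sq_le_C1 hr hrR v₀
  have e : C2 r R v₀ = R ^ (1 + 2 * d) * C1 r R v₀ := by unfold C2 C1; ring
  rw [e]
  gcongr

end KineticFP

end

theorem proposition2p3 (d : ℕ) (hd : 0 < d) (lam Lam : ℝ) (hlam : 0 < lam) (hLam : lam < Lam) :
    ∃ C : ℝ, 0 < C ∧
      ∀ (U : Set (KineticFP.Z d)) (A : KineticFP.Z d → Matrix (Fin d) (Fin d) ℝ)
        (B : KineticFP.Z d → KineticFP.E d) (S f : KineticFP.Z d → ℝ),
        IsOpen U →
        KineticFP.Coefficients U lam Lam A B S →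
        KineticFP.IsWeakSubsolution U A B S f →
        (∀ᵐ z ∂volume.restrict U, 0 ≤ f z) →
        ∀ (z₀ : KineticFP.Z d) (r R : ℝ), 0 < r → r < R → R ≤ 1 →
          KineticFP.cylinder R z₀ ⊆ U →
          (∀ p : ℝ, 2 ≤ p → p < 2 + 1 / (d : ℝ) →
            eLpNorm f (ENNReal.ofReal p) (volume.restrict (KineticFP.cylinder r z₀)) ≤
              ENNReal.ofReal
                  (C * (2 + 1 / (d : ℝ) - p)⁻¹ * KineticFP.C1 r R z₀.2.2) *
                (eLpNorm f 2 (volume.restrict (KineticFP.cylinder R z₀)) +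
                  eLpNorm S 2 (volume.restrict (KineticFP.cylinder R z₀)))) ∧
          (∀ σ : ℝ, 0 ≤ σ → σ < 1 / 3 →
            KineticFP.kineticSobolevNorm σ (KineticFP.cylinder r z₀) f ≤
              ENNReal.ofReal
                  (C * (1 / 3 - σ)⁻¹ * KineticFP.C2 r R z₀.2.2) *
                (eLpNorm f 2 (volume.restrict (KineticFP.cylinder R z₀)) +
                  eLpNorm S 2 (volume.restrict (KineticFP.cylinder R z₀)))) := by
  obtain ⟨C₁, hC₁, hLp⟩ := KineticFP.exists_eLpNorm_cylinder_le hd hlam hLam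
  obtain ⟨C₂, hC₂, hW⟩ := KineticFP.exists_kineticSobolevNorm_cylinder_le hd hlam hLam
  refine ⟨C₁ + C₂, by positivity, fun U A B S f hU hc hf h0 z₀ r R hr hrR hR hQ => ?_⟩
  have hR0 : 0 < R := hr.trans hrR
  have hδ : 0 < R - r := sub_pos.2 hrR
  have hVQ := KineticFP.openCylinder_subset R z₀
  -- The equation is used on the interior of the cylinder only. It has finite measure, so S is in L²
  -- there, and only the norms on Q_R enter.
  obtain ⟨f', h', S', g', F', H, hE, hae, nf, nS⟩ :=
    KineticFP.exists_weakSub hlam hLam hU (KineticFP.isOpen_openCylinder R z₀) (hVQ.trans hQ)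
      (KineticFP.volume_openCylinder_ne_top hR0 z₀) hc hf h0
  have hN : eLpNorm f' 2 volume + eLpNorm S' 2 volume ≤
      eLpNorm f 2 (volume.restrict (KineticFP.cylinder R z₀)) +
        eLpNorm S 2 (volume.restrict (KineticFP.cylinder R z₀)) := by
    rw [nf, nS]
    gcongr
  have hff : ∀ᵐ z, z ∈ KineticFP.cylinder r z₀ → f z = f' z := by
    filter_upwards [KineticFP.ae_cylinder_mem_openCylinder hr hrR.le z₀,
      (ae_restrict_iff' (KineticFP.isOpen_openCylinder R z₀).measurableSet).1 hae] with z h1 h2 hz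
    exact (h2 (h1 hz)).symm
  refine ⟨fun p hp hp2 => ?_, fun σ hσ hσ2 => ?_⟩
  · have hp' : 0 < 2 + 1 / (d : ℝ) - p := by linarith
    rw [eLpNorm_congr_ae ((ae_restrict_iff' (KineticFP.measurableSet_cylinder r z₀)).2 hff)]
    refine (hLp z₀ r R hr hrR hR f' h' S' g' F' H hE p hp hp2).trans ?_
    gcongr
    · linarith
    · exact KineticFP.one_div_sq_le_C1 hr hrR _
  · have hσ' : 0 < 1 / 3 - σ := by linarith
    refine (KineticFP.kineticSobolevNorm_le_of_ae (KineticFP.measurableSet_cylinder r z₀) hff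
      σ).trans ?_
    refine (hW z₀ r R hr hrR hR f' h' S' g' F' H hE σ hσ hσ2).trans ?_
    gcongr
    · linarith
    · exact KineticFP.mul_one_div_sq_le_C2 hr hrR _
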